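/- Let $m\ge 0$, let $(\mathcal M,g)$ be a smooth Lorentzian manifold of dimension $2m+2$ and let $(N,K)$ be an almost Robinson structure on it: $N\subset{}^{\mathbb C}T\mathcal M$ is a smooth complex subbundle of rank $m+1$, totally null for the complexified metric, and $K\subset T\mathcal M$ is the real line bundle with ${}^{\mathbb C}K=N\cap\overline N$. Then $K$ is null and ${}^{\mathbb C}K\subset N\subset{}^{\mathbb C}K^\perp$. The metric $g$ induces a positive definite bundle metric $h$ on the screen bundle $H_K=K^\perp/K$, and $N$ induces on $H_K$ the orthogonal complex structure $J$ that equals $-\mathrm i$ on $H_K^{(0,1)}=N/{}^{\mathbb C}K$ and $+\mathrm i$ on $H_K^{(1,0)}=\overline N/{}^{\mathbb C}K$. An optical vector field is a (local) section $k$ of $K$. A complex Robinson $(m+1)$-form is a (local, smooth) nowhere vanishing section of $\bigwedge^{m+1}\mathrm{Ann}(N)$, where $\mathrm{Ann}(N)\subset{}^{\mathbb C}T^*\mathcal M$ is the annihilator of $N$. Notation. A local splitting consists of an optical vector field $k$ and a null vector field $\ell$ with $g(k,\ell)=1$; it identifies $H_K$ with $\{k,\ell\}^\perp$. Put $\kappa=g(k,\cdot)$,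 $\omega(v,w)=h(Jv,w)$ (extended by $0$ on $k$ and $\ell$) and $\rho_{abc}=3\kappa_{[a}\omega_{bc]}$. Let $\nabla$ be the Levi-Civita connection, let $i,j$ be indices for $H_K$ and $\alpha,\beta$ indices for $H_K^{(1,0)}$. Set $$\gamma_i=(\nabla\kappa)(k,e_i),\quad \tau_{ij}=(\nabla\kappa)_{[ij]},\quad \sigma_{ij}=(\nabla\kappa)_{(ij)}-\tfrac1{2m}h^{kl}(\nabla\kappa)_{kl}h_{ij},\quad \zeta_{ij}=(\nabla\rho)(k,e_i,e_j,\ell),$$ where the first argument of $\nabla\kappa$ and of $\nabla\rho$ is the direction of differentiation; $\sigma$ is the shear of $K$ (if $m=0$ there are no such components). At each point let $\mathfrak g$ be the Lie algebra of skew endomorphisms of $(T\mathcal M,g)$ and $\mathfrak q\subset\mathfrak g$ the stabiliser of $N$. The intrinsic torsion is the section of $\mathcal G=T^*\mathcal M\otimes(\mathfrak g/\mathfrak q)$ given by the class of $\nabla-D$, for any local linear connection $D$ that preserves $g$ and $N$; it does not depend on $D$. For a tensor $\Gamma\in T^*\mathcal M\otimes\mathfrak g$ define $\gamma,\tau,\sigma,\zeta$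 by the same formulae with $\nabla\kappa$ and $\nabla\rho$ replaced by $(\Gamma\cdot\kappa)_{ab}=-\Gamma_{ab}{}^c\kappa_c$ and $(\Gamma\cdot\rho)_{abcd}=-3\Gamma_{a[b}{}^e\rho_{cd]e}$. Define subbundles of $\mathcal G$ as the sets of classes of those $\Gamma$ that satisfy, in every splitting, $$(\slashed{\mathcal G}_{-1}^{1\times3})_{[z:w]}:\ z\tau_{\alpha\beta}+w\zeta_{\alpha\beta}=0,\ (z+4\mathrm i w)\gamma_i=0;\qquad \slashed{\mathcal G}_{-1}^{2,1}:\ \sigma_{\alpha\beta}=0,\ \gamma_i=0.$$ A local leaf space of $K$ is a smooth submersion $p\colon\mathcal U\to\underline{\mathcal M}$ from an open set $\mathcal U\subset\mathcal M$ onto a $(2m+1)$-dimensional manifold, with connected fibres tangent to $K$. One says that $(N,K)$ induces an almost CR structure on $\underline{\mathcal M}$ if there are a smooth rank-$2m$ distribution $\underline H\subset T\underline{\mathcal M}$ and a smooth bundle complex structure $\underline J$ on $\underline H$ such that, at every $x\in\mathcal U$, $dp_x(K^\perp_x)=\underline H_{p(x)}$ and $dp_x(N_x)=\underline H^{(0,1)}_{p(x)}$,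 the $(-\mathrm i)$-eigenspace of $\underline J$. **Proposition.** The following statements are equivalent: 1. $(N,K)$ is nearly Robinson, $[K,N]\subset N$: for every optical vector field $k$ and every local section $v$ of $N$, $\mathcal L_kv$ is a section of $N$. 2. Every complex Robinson $(m+1)$-form $\nu$ is preserved along $K$: for every optical vector field $k$, $\mathcal L_k\nu=f\nu$ for some smooth complex-valued function $f$. 3. The intrinsic torsion is a section of $(\slashed{\mathcal G}_{-1}^{1\times3})_{[-2\mathrm i:1]}\cap\slashed{\mathcal G}_{-1}^{2,1}$; and this is in turn equivalent to the statement that, in every local splitting, $\gamma_i=0$, $\sigma_{\alpha\beta}=0$ and $\zeta_{\alpha\beta}=2\mathrm i\,\tau_{\alpha\beta}$. 4. $(N,K)$ induces an almost CR structure on the leaf space of $K$. (More precisely: given any family of local leaf spaces whose domains cover $\mathcal M$, for instance one global leaf space, (1)–(3) hold if and only if $(N,K)$ induces an almost CR structure on each of them.) If these conditions hold, then the integral curves of $K$ are geodesics, that is, $\nabla_kk$ is a section of $K$ for every optical $k$, and the shear commutes with $J$, that is, $J_{(i}{}^k\sigma_{j)k}=0$. -/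

import Mathlib

set_option maxSynthPendingDepth 3

open scoped Manifold ContDiff TensorProduct Topology

noncomputable section

namespace Robinson

/-! ### Linear algebra of Robinson structures

`V` is a real vector space (later a tangent space), `g` a bilinear form on `V`, and `N` a complex
subspace of the complexification `ℂ ⊗[ℝ] V`. -/

section Algebra

variable {V : Type*} [AddCommGroup V] [Module ℝ V]

/-- The complex vector `a + i b`. -/
def cvec (a b : V) : ℂ ⊗[ℝ] V := (1 : ℂ) ⊗ₜ[ℝ] a + Complex.I ⊗ₜ[ℝ] b

/-- Complex conjugation on the complexification. -/
def conj : (ℂ ⊗[ℝ] V) →ₗ[ℝ] (ℂ ⊗[ℝ] V) :=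
  LinearMap.rTensor V Complex.conjAe.toLinearMap

/-- The value `B (a + i b, c + i d)` of the complex bilinear extension of a real bilinear `B`. -/
def cext (B : V → V → ℝ) (a b c d : V) : ℂ :=
  ⟨B a c - B b d, B a d + B b c⟩

/-- A choice of splitting: `k` spans the null line `K`, and `ℓ` is null with `g (k, ℓ) = 1`. -/
structure IsSplitting (g : LinearMap.BilinForm ℝ V) (K : Submodule ℝ V) (k ℓ : V) : Prop where
  mem : k ∈ K
  null : g ℓ ℓ = 0
  pairing : g k ℓ = 1

/-- `H_{K,L} = K^⊥ ∩ L^⊥`, which is isomorphic to the screen space `K^⊥ / K`. -/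
def screen (g : LinearMap.BilinForm ℝ V) (k ℓ : V) : Submodule ℝ V :=
  LinearMap.ker (g k) ⊓ LinearMap.ker (g ℓ)

/-- The projection of `V = L ⊕ H_{K,L} ⊕ K` onto `H_{K,L}`. -/
def proj (g : LinearMap.BilinForm ℝ V) (k ℓ v : V) : V :=
  v - g ℓ v • k - g k v • ℓ

/-- The screen space complex structure `J` carried to `H_{K,L}`. As `J` acts as `-i` on
`N / ℂK`, the vector `J v` is the unique `v' ∈ H_{K,L}` with `v + i v' ∈ N`. -/
def screenJ (g : LinearMap.BilinForm ℝ V) (N : Submodule ℂ (ℂ ⊗[ℝ] V)) (k ℓ v : V) : V :=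
  Classical.epsilon fun v' => v' ∈ screen g k ℓ ∧ cvec v v' ∈ N

/-- The Hermitian 2-form `ω (v, w) = h (J v, w)`, extended by zero on `K` and `L`. -/
def omega (g : LinearMap.BilinForm ℝ V) (N : Submodule ℂ (ℂ ⊗[ℝ] V)) (k ℓ v w : V) : ℝ :=
  g (screenJ g N k ℓ (proj g k ℓ v)) (proj g k ℓ w)

/-- The Robinson 3-form `ρ_{abc} = 3 κ_{[a} ω_{bc]}` (that is, `κ ∧ ω`) of the optical 1-form
`κ = g (k, ·)`. -/
def rho (g : LinearMap.BilinForm ℝ V) (N : Submodule ℂ (ℂ ⊗[ℝ] V)) (k ℓ a b c : V) : ℝ :=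
  g k a * omega g N k ℓ b c + g k b * omega g N k ℓ c a + g k c * omega g N k ℓ a b

/-- `a + i b` belongs to `H_{K,L}^{(1,0)} = (ℂ H_{K,L}) ∩ N̄`. -/
structure IsOneZero (g : LinearMap.BilinForm ℝ V) (N : Submodule ℂ (ℂ ⊗[ℝ] V)) (k ℓ a b : V) :
    Prop where
  left : a ∈ screen g k ℓ
  right : b ∈ screen g k ℓ
  mem_conj : conj (cvec a b) ∈ N

/-- The trace `h^{ij} A_{ij}` over the `2m`-dimensional Euclidean space `H_{K,L}`: the common value
of `∑ A (b_i, b_i)` for all orthonormal bases `b`. -/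
def screenTrace (m : ℕ) (g : LinearMap.BilinForm ℝ V) (k ℓ : V) (A : V → V → ℝ) : ℝ :=
  Classical.epsilon fun r => ∀ b : Fin (2 * m) → V, (∀ i, b i ∈ screen g k ℓ) →
    (∀ i j, g (b i) (b j) = if i = j then 1 else 0) → r = ∑ i, A (b i) (b i)

/-! Components of a pair `(A, R)`. Here `A` stands for `∇κ` or `Γ · κ`, and `R` for `∇ρ` or
`Γ · ρ`; the first argument is the one in the direction of differentiation. -/

/-- `τ_{ij} = A_{[ij]}`. -/
def twist (A : V → V → ℝ) (v w : V) : ℝ := (A v w - A w v) / 2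

/-- `σ_{ij} = A_{(ij)∘}`, the tracefree symmetric part. -/
def shear (m : ℕ) (g : LinearMap.BilinForm ℝ V) (k ℓ : V) (A : V → V → ℝ) (v w : V) : ℝ :=
  (A v w + A w v) / 2 - screenTrace m g k ℓ A / (2 * m) * g v w

/-- `ζ_{ij} = R^0{}_{ij0} = R (k, i, j, ℓ)`. -/
def zeta (k ℓ : V) (R : V → V → V → V → ℝ) (v w : V) : ℝ := R k v w ℓ

/-- `γ_i = A^0{}_i = A (k, i)` is zero. -/
def GammaVanishes (g : LinearMap.BilinForm ℝ V) (k ℓ : V) (A : V → V → ℝ) : Prop :=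
  ∀ v ∈ screen g k ℓ, A k v = 0

/-- `σ_{αβ}`, the `(2,0)`-part of the shear, is zero. -/
def ShearTwoZeroVanishes (m : ℕ) (g : LinearMap.BilinForm ℝ V) (N : Submodule ℂ (ℂ ⊗[ℝ] V))
    (k ℓ : V) (A : V → V → ℝ) : Prop :=
  ∀ a b c d, IsOneZero g N k ℓ a b → IsOneZero g N k ℓ c d →
    cext (shear m g k ℓ A) a b c d = 0

/-- The Lie algebra `𝔤` of `g`-skew endomorphisms. -/
def skewEnd (g : LinearMap.BilinForm ℝ V) : Submodule ℝ (V →ₗ[ℝ] V) where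
  carrier := {A | ∀ v w, g (A v) w + g v (A w) = 0}
  add_mem' {A B} hA hB v w := by
    have h1 := hA v w
    have h2 := hB v w
    simp only [LinearMap.add_apply, map_add]
    linarith
  zero_mem' v w := by simp
  smul_mem' c A hA v w := by
    have h1 := hA v w
    simp only [LinearMap.smul_apply, map_smul, smul_eq_mul]
    rw [← mul_add, h1, mul_zero]

/-- The Lie algebra `𝔮 ⊂ 𝔤` of the stabiliser of the Robinson structure. -/
def stabilizer (g : LinearMap.BilinForm ℝ V) (N : Submodule ℂ (ℂ ⊗[ℝ] V)) :
    Submodule ℝ (skewEnd g) where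
  carrier := {A | ∀ z ∈ N, (A : V →ₗ[ℝ] V).baseChange ℂ z ∈ N}
  add_mem' {A B} hA hB z hz := by
    simpa [LinearMap.baseChange_add] using N.add_mem (hA z hz) (hB z hz)
  zero_mem' z hz := by simp
  smul_mem' c A hA z hz := by
    simpa [LinearMap.baseChange_smul] using N.smul_of_tower_mem c (hA z hz)

/-- The subspace `V* ⊗ 𝔮` of `V* ⊗ 𝔤`. -/
def stabilizerForms (g : LinearMap.BilinForm ℝ V) (N : Submodule ℂ (ℂ ⊗[ℝ] V)) :
    Submodule ℝ (V →ₗ[ℝ] skewEnd g) where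
  carrier := {Γ | ∀ v, Γ v ∈ stabilizer g N}
  add_mem' hA hB v := Submodule.add_mem _ (hA v) (hB v)
  zero_mem' _ := Submodule.zero_mem _
  smul_mem' c _ hA v := Submodule.smul_mem _ c (hA v)

/-- The space `𝔾 = V* ⊗ (𝔤 / 𝔮) = (V* ⊗ 𝔤) / (V* ⊗ 𝔮)` of algebraic intrinsic torsions. -/
abbrev TorsionSpace (g : LinearMap.BilinForm ℝ V) (N : Submodule ℂ (ℂ ⊗[ℝ] V)) : Type _ :=
  (V →ₗ[ℝ] skewEnd g) ⧸ stabilizerForms g N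

/-- `(Γ · κ)_{ab} = - Γ_{ab}{}^c κ_c` for `κ = g (k, ·)`. -/
def dotKappa (g : LinearMap.BilinForm ℝ V) (k : V) (Γ : V →ₗ[ℝ] skewEnd g) (a b : V) : ℝ :=
  - g k ((Γ a : V →ₗ[ℝ] V) b)

/-- `(Γ · ρ)_{abcd} = - 3 Γ_{a[b}{}^e ρ_{cd]e}`. -/
def dotRho (g : LinearMap.BilinForm ℝ V) (N : Submodule ℂ (ℂ ⊗[ℝ] V)) (k ℓ : V)
    (Γ : V →ₗ[ℝ] skewEnd g) (a b c d : V) : ℝ :=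
  - (rho g N k ℓ ((Γ a : V →ₗ[ℝ] V) b) c d + rho g N k ℓ b ((Γ a : V →ₗ[ℝ] V) c) d
    + rho g N k ℓ b c ((Γ a : V →ₗ[ℝ] V) d))

/-- The submodule `(G̸_{-1}^{1×3})_{[z:w]}` of `𝔾`: in any splitting,
`z τ_{αβ} + w ζ_{αβ} = 0` and `(z + 4 i w) γ_i = 0`. -/
def slash13 (g : LinearMap.BilinForm ℝ V) (N : Submodule ℂ (ℂ ⊗[ℝ] V)) (K : Submodule ℝ V)
    (z w : ℂ) : Set (TorsionSpace g N) :=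
  (stabilizerForms g N).mkQ '' {Γ | ∀ k ℓ, IsSplitting g K k ℓ →
    (∀ a b c d, IsOneZero g N k ℓ a b → IsOneZero g N k ℓ c d →
      z * cext (twist (dotKappa g k Γ)) a b c d
        + w * cext (zeta k ℓ (dotRho g N k ℓ Γ)) a b c d = 0) ∧
    (∀ v ∈ screen g k ℓ, (z + 4 * Complex.I * w) * (dotKappa g k Γ k v : ℂ) = 0)}

/-- The submodule `G̸_{-1}^{2,1}` of `𝔾`: in any splitting, `σ_{αβ} = 0` and `γ_i = 0`. -/
def slash21 (m : ℕ) (g : LinearMap.BilinForm ℝ V) (N : Submodule ℂ (ℂ ⊗[ℝ] V))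
    (K : Submodule ℝ V) : Set (TorsionSpace g N) :=
  (stabilizerForms g N).mkQ '' {Γ | ∀ k ℓ, IsSplitting g K k ℓ →
    ShearTwoZeroVanishes m g N k ℓ (dotKappa g k Γ) ∧ GammaVanishes g k ℓ (dotKappa g k Γ)}

end Algebra

/-! ### Vector fields and Lorentzian metrics -/

section Geometry

/-- Vector fields, with no regularity. -/
abbrev VField (n : ℕ) (M : Type*) [TopologicalSpace M]
    [ChartedSpace (EuclideanSpace ℝ (Fin n)) M] : Type _ :=
  (x : M) → TangentSpace (𝓡 n) x

variable {n : ℕ} {M : Type*} [TopologicalSpace M] [ChartedSpace (EuclideanSpace ℝ (Fin n)) M]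

/-- The vector field `X` is smooth on `U`. -/
def SmoothOn [IsManifold (𝓡 n) ∞ M] (U : Set M) (X : VField n M) : Prop :=
  ContMDiffOn (𝓡 n) (𝓡 n).tangent ∞ (fun x => (⟨x, X x⟩ : TangentBundle (𝓡 n) M)) U

/-- The vector field `X` is differentiable at `x`. -/
def DiffAt [IsManifold (𝓡 n) ∞ M] (X : VField n M) (x : M) : Prop :=
  MDifferentiableAt (𝓡 n) (𝓡 n).tangent (fun y => (⟨y, X y⟩ : TangentBundle (𝓡 n) M)) x

variable (n M) in
/-- A smooth Lorentzian metric of signature `(+, …, +, -)`: there is a timelike vector, and `g` is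
positive definite on its orthogonal complement. -/
structure LorentzMetric [IsManifold (𝓡 n) ∞ M] where
  val : ∀ x : M, TangentSpace (𝓡 n) x →L[ℝ] TangentSpace (𝓡 n) x →L[ℝ] ℝ
  symm : ∀ (x : M) (v w : TangentSpace (𝓡 n) x), val x v w = val x w v
  lorentzian : ∀ x : M, ∃ t : TangentSpace (𝓡 n) x, val x t t < 0 ∧
    ∀ v : TangentSpace (𝓡 n) x, v ≠ 0 → val x t v = 0 → 0 < val x v v
  contMDiff : ContMDiff (𝓡 n)
    ((𝓡 n).prod 𝓘(ℝ, EuclideanSpace ℝ (Fin n) →L[ℝ] EuclideanSpace ℝ (Fin n) →L[ℝ] ℝ)) ∞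
    (fun x => Bundle.TotalSpace.mk'
      (EuclideanSpace ℝ (Fin n) →L[ℝ] EuclideanSpace ℝ (Fin n) →L[ℝ] ℝ)
      (E := fun x : M => TangentSpace (𝓡 n) x →L[ℝ] TangentSpace (𝓡 n) x →L[ℝ] ℝ) x (val x))

variable [IsManifold (𝓡 n) ∞ M]

/-- The metric at `x` as a bilinear form. -/
def LorentzMetric.form (g : LorentzMetric n M) (x : M) :
    LinearMap.BilinForm ℝ (TangentSpace (𝓡 n) x) :=
  LinearMap.mk₂ ℝ (fun v w => g.val x v w) (by simp) (by simp) (by simp) (by simp)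

/-- The function `g (X, Y)`. -/
def LorentzMetric.pair (g : LorentzMetric n M) (X Y : VField n M) (x : M) : ℝ :=
  g.val x (X x) (Y x)

/-- The right hand side of the Koszul formula for `2 g (∇_X Y, Z)`. -/
def LorentzMetric.koszul (g : LorentzMetric n M) (X Y Z : VField n M) (x : M) : ℝ :=
  mvfderiv (𝓡 n) (g.pair Y Z) x (X x) + mvfderiv (𝓡 n) (g.pair Z X) x (Y x)
    - mvfderiv (𝓡 n) (g.pair X Y) x (Z x)
    + g.val x (VectorField.mlieBracket (𝓡 n) X Y x) (Z x)
    - g.val x (VectorField.mlieBracket (𝓡 n) X Z x) (Y x)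
    - g.val x (VectorField.mlieBracket (𝓡 n) Y Z x) (X x)

/-- The Levi-Civita derivative `∇_v Y` at `x`: the unique tangent vector determined by the Koszul
formula (for `Y` differentiable at `x`). -/
def LorentzMetric.nabla (g : LorentzMetric n M) (Y : VField n M) (x : M)
    (v : TangentSpace (𝓡 n) x) : TangentSpace (𝓡 n) x :=
  Classical.epsilon fun u => ∀ X Z : VField n M, DiffAt X x → DiffAt Z x → X x = v →
    2 * g.val x u (Z x) = g.koszul X Y Z x

/-- `(∇κ)_{ab}` at `x`, for `κ = g (k, ·)`: the value on `(a, b)` is `g (∇_a k, b)`. -/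
def LorentzMetric.nablaKappa (g : LorentzMetric n M) (k : VField n M) (x : M)
    (a b : TangentSpace (𝓡 n) x) : ℝ :=
  g.val x (g.nabla k x a) b

/-- `(∇ρ)_{abcd}` at `x` for a covariant 3-tensor field `ρ`: the number
`v (ρ (B, C, D)) - ρ (∇_v B, C, D) - ρ (B, ∇_v C, D) - ρ (B, C, ∇_v D)`, for arbitrary
differentiable extensions `B, C, D` of `b, c, d`. -/
def LorentzMetric.nablaThree (g : LorentzMetric n M)
    (ρ : (x : M) → TangentSpace (𝓡 n) x → TangentSpace (𝓡 n) x → TangentSpace (𝓡 n) x → ℝ)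
    (x : M) (v b c d : TangentSpace (𝓡 n) x) : ℝ :=
  Classical.epsilon fun r => ∀ B C D : VField n M, DiffAt B x → DiffAt C x → DiffAt D x →
    B x = b → C x = c → D x = d →
    r = mvfderiv (𝓡 n) (fun y => ρ y (B y) (C y) (D y)) x v
      - ρ x (g.nabla B x v) c d - ρ x b (g.nabla C x v) d - ρ x b c (g.nabla D x v)

end Geometry

/-! ### Almost Robinson structures -/

section Structures

variable {m : ℕ} {M : Type*} [TopologicalSpace M]
  [ChartedSpace (EuclideanSpace ℝ (Fin (2 * m + 2))) M] [IsManifold (𝓡 (2 * m + 2)) ∞ M]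

/-- An almost Robinson structure on a Lorentzian manifold of dimension `2m + 2`: a smooth complex
distribution `N` of rank `m + 1`, totally null for the complexified metric, and a smooth real line
distribution `K` with `ℂK = N ∩ N̄`. -/
structure AlmostRobinson (g : LorentzMetric (2 * m + 2) M) where
  N : ∀ x : M, Submodule ℂ (ℂ ⊗[ℝ] TangentSpace (𝓡 (2 * m + 2)) x)
  K : ∀ x : M, Submodule ℝ (TangentSpace (𝓡 (2 * m + 2)) x)
  N_frame : ∀ x₀ : M, ∃ U : Set M, IsOpen U ∧ x₀ ∈ U ∧
    ∃ A B : Fin (m + 1) → VField (2 * m + 2) M,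
      (∀ j, SmoothOn U (A j)) ∧ (∀ j, SmoothOn U (B j)) ∧
      ∀ x ∈ U, LinearIndependent ℂ (fun j => cvec (A j x) (B j x)) ∧
        Submodule.span ℂ (Set.range fun j => cvec (A j x) (B j x)) = N x
  K_frame : ∀ x₀ : M, ∃ U : Set M, IsOpen U ∧ x₀ ∈ U ∧
    ∃ k : VField (2 * m + 2) M, SmoothOn U k ∧
      ∀ x ∈ U, k x ≠ 0 ∧ Submodule.span ℝ {k x} = K x
  N_null : ∀ x, ∀ z ∈ N x, ∀ w ∈ N x, (g.form x).baseChange ℂ z w = 0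
  K_eq : ∀ (x : M) (z : ℂ ⊗[ℝ] TangentSpace (𝓡 (2 * m + 2)) x),
    z ∈ (K x).baseChange ℂ ↔ z ∈ N x ∧ conj z ∈ N x

namespace AlmostRobinson

variable {g : LorentzMetric (2 * m + 2) M} (R : AlmostRobinson g)

/-- `k` is a smooth optical vector field on `U`, that is, a section of `K`. -/
def IsOptical (U : Set M) (k : VField (2 * m + 2) M) : Prop :=
  SmoothOn U k ∧ ∀ x ∈ U, k x ∈ R.K x

/-- `X + i Y` is a smooth section of `N` on `U`. -/
def IsSection (U : Set M) (X Y : VField (2 * m + 2) M) : Prop :=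
  SmoothOn U X ∧ SmoothOn U Y ∧ ∀ x ∈ U, cvec (X x) (Y x) ∈ R.N x

/-- `k` and `ℓ` are smooth vector fields on `U` that give a splitting at each point. -/
def IsSplittingOn (U : Set M) (k ℓ : VField (2 * m + 2) M) : Prop :=
  SmoothOn U k ∧ SmoothOn U ℓ ∧ ∀ x ∈ U, IsSplitting (g.form x) (R.K x) (k x) (ℓ x)

/-- `(N, K)` is nearly Robinson: `[K, N] ⊂ N`, the bracket being extended complex linearly. -/
def NearlyRobinson : Prop :=
  ∀ (U : Set M) (k X Y : VField (2 * m + 2) M), IsOpen U → R.IsOptical U k → R.IsSection U X Y →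
    ∀ x ∈ U, cvec (VectorField.mlieBracket (𝓡 (2 * m + 2)) k X x)
      (VectorField.mlieBracket (𝓡 (2 * m + 2)) k Y x) ∈ R.N x

/-- A complex Robinson `(m+1)`-form on `U`: a smooth nowhere vanishing section `ν` of
`⋀^{m+1} Ann(N)`. A complex-valued form is given by its values on real vectors; that it lies in
`⋀^{m+1} Ann(N)` means that its contraction with every `a + i b` in `N` is zero. -/
structure IsRobinsonForm (U : Set M)
    (ν : (x : M) → (TangentSpace (𝓡 (2 * m + 2)) x) [⋀^Fin (m + 1)]→ₗ[ℝ] ℂ) : Prop where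
  smooth : ∀ (W : Set M) (X : Fin (m + 1) → VField (2 * m + 2) M), IsOpen W → W ⊆ U →
    (∀ j, SmoothOn W (X j)) →
    ContMDiffOn (𝓡 (2 * m + 2)) 𝓘(ℝ, ℂ) ∞ (fun x => ν x (fun j => X j x)) W
  ne_zero : ∀ x ∈ U, ν x ≠ 0
  annihilates : ∀ x ∈ U, ∀ a b : TangentSpace (𝓡 (2 * m + 2)) x, cvec a b ∈ R.N x →
    ∀ w : Fin m → TangentSpace (𝓡 (2 * m + 2)) x,
      ν x (Fin.cons a w) + Complex.I * ν x (Fin.cons b w) = 0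

/-- The value at `x` of `(𝓛_k ν) (X_0, …, X_m)`, that is, of
`k (ν (X_0, …, X_m)) - ∑ ν (X_0, …, [k, X_j], …, X_m)`. -/
def lieDerivForm (ν : (x : M) → (TangentSpace (𝓡 (2 * m + 2)) x) [⋀^Fin (m + 1)]→ₗ[ℝ] ℂ)
    (k : VField (2 * m + 2) M) (X : Fin (m + 1) → VField (2 * m + 2) M) (x : M) : ℂ :=
  mvfderiv (𝓡 (2 * m + 2)) (fun y => ν y (fun j => X j y)) x (k x)
    - ∑ j, ν x (Function.update (fun i => X i x) j
        (VectorField.mlieBracket (𝓡 (2 * m + 2)) k (X j) x))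

/-- Every (local) complex Robinson `(m+1)`-form `ν` is preserved along `K`: `𝓛_k ν = f ν` with a
smooth complex function `f`, for every optical vector field `k`. -/
def FormsPreserved : Prop :=
  ∀ (U : Set M) (ν : (x : M) → (TangentSpace (𝓡 (2 * m + 2)) x) [⋀^Fin (m + 1)]→ₗ[ℝ] ℂ)
    (k : VField (2 * m + 2) M), IsOpen U → R.IsRobinsonForm U ν → R.IsOptical U k →
    ∃ f : M → ℂ, ContMDiffOn (𝓡 (2 * m + 2)) 𝓘(ℝ, ℂ) ∞ f U ∧
      ∀ (W : Set M) (X : Fin (m + 1) → VField (2 * m + 2) M), IsOpen W → W ⊆ U →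
        (∀ j, SmoothOn W (X j)) →
        ∀ x ∈ W, lieDerivForm ν k X x = f x * ν x (fun j => X j x)

/-- `D` is, on the open set `U`, a linear connection that preserves `g` and `N` (hence `K`). The
value `D Y x v` is `D_v Y` at `x`. -/
structure IsAdaptedConnection (U : Set M)
    (D : VField (2 * m + 2) M →
      ((x : M) → TangentSpace (𝓡 (2 * m + 2)) x →L[ℝ] TangentSpace (𝓡 (2 * m + 2)) x)) : Prop where
  isOpen : IsOpen U
  isCov : IsCovariantDerivativeOn (EuclideanSpace ℝ (Fin (2 * m + 2))) D U
  metric : ∀ x ∈ U, ∀ Y Z : VField (2 * m + 2) M, DiffAt Y x → DiffAt Z x →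
    ∀ v, mvfderiv (𝓡 (2 * m + 2)) (g.pair Y Z) x v
      = g.val x (D Y x v) (Z x) + g.val x (Y x) (D Z x v)
  preserves : ∀ x ∈ U, ∀ X Y : VField (2 * m + 2) M, DiffAt X x → DiffAt Y x →
    (∀ᶠ y in 𝓝 x, cvec (X y) (Y y) ∈ R.N y) → ∀ v, cvec (D X x v) (D Y x v) ∈ R.N x

/-- The intrinsic torsion at `x`: the class in `𝔾` of the difference `Γ = ∇ - D` between the
Levi-Civita connection and any adapted connection `D` near `x`. -/
def intrinsicTorsion (x : M) : TorsionSpace (g.form x) (R.N x) :=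
  Classical.epsilon fun t =>
    ∃ (U : Set M) (D : VField (2 * m + 2) M →
      ((x : M) → TangentSpace (𝓡 (2 * m + 2)) x →L[ℝ] TangentSpace (𝓡 (2 * m + 2)) x))
      (Γ : TangentSpace (𝓡 (2 * m + 2)) x →ₗ[ℝ] skewEnd (g.form x)),
      x ∈ U ∧ R.IsAdaptedConnection U D ∧
      (∀ Y : VField (2 * m + 2) M, DiffAt Y x → ∀ v,
        (Γ v : TangentSpace (𝓡 (2 * m + 2)) x →ₗ[ℝ] TangentSpace (𝓡 (2 * m + 2)) x) (Y x)
          = g.nabla Y x v - D Y x v) ∧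
      t = (stabilizerForms (g.form x) (R.N x)).mkQ Γ

/-- The intrinsic torsion is a section of `(G̸_{-1}^{1×3})_{[-2i:1]} ∩ G̸_{-1}^{2,1}`. -/
def TorsionCondition : Prop :=
  ∀ x, R.intrinsicTorsion x ∈
    slash13 (g.form x) (R.N x) (R.K x) (-2 * Complex.I) 1 ∩
      slash21 m (g.form x) (R.N x) (R.K x)

/-- The Robinson 3-form field of the optical 1-form `g (k, ·)`. -/
def rhoField (k ℓ : VField (2 * m + 2) M) (x : M) (a b c : TangentSpace (𝓡 (2 * m + 2)) x) : ℝ :=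
  rho (g.form x) (R.N x) (k x) (ℓ x) a b c

/-- In components: `γ_i = 0`, `σ_{αβ} = 0` and `ζ_{αβ} = 2 i τ_{αβ}` for every local splitting. -/
def ComponentCondition : Prop :=
  ∀ (U : Set M) (k ℓ : VField (2 * m + 2) M), IsOpen U → R.IsSplittingOn U k ℓ → ∀ x ∈ U,
    GammaVanishes (g.form x) (k x) (ℓ x) (g.nablaKappa k x) ∧
    ShearTwoZeroVanishes m (g.form x) (R.N x) (k x) (ℓ x) (g.nablaKappa k x) ∧
    ∀ a b c d, IsOneZero (g.form x) (R.N x) (k x) (ℓ x) a b →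
      IsOneZero (g.form x) (R.N x) (k x) (ℓ x) c d →
      cext (zeta (k x) (ℓ x) (g.nablaThree (R.rhoField k ℓ) x)) a b c d
        = 2 * Complex.I * cext (twist (g.nablaKappa k x)) a b c d

/-- The integral curves of `K` are (unparametrised) geodesics: `∇_k k` is a section of `K`. -/
def Geodesic : Prop :=
  ∀ (U : Set M) (k : VField (2 * m + 2) M), IsOpen U → R.IsOptical U k →
    ∀ x ∈ U, g.nabla k x (k x) ∈ R.K x

/-- The shear commutes with the screen bundle complex structure, `J_{(i}{}^k σ_{j)k} = 0`. The
hypothesis `v + i v' ∈ N` says that `v ∈ K^⊥` and that `v'` represents `J v` modulo `K`. -/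
def ShearCommutes : Prop :=
  ∀ (U : Set M) (k ℓ : VField (2 * m + 2) M), IsOpen U → R.IsSplittingOn U k ℓ → ∀ x ∈ U,
    ∀ v v' w w' : TangentSpace (𝓡 (2 * m + 2)) x, cvec v v' ∈ R.N x → cvec w w' ∈ R.N x →
      shear m (g.form x) (k x) (ℓ x) (g.nablaKappa k x) v' w
        + shear m (g.form x) (k x) (ℓ x) (g.nablaKappa k x) v w' = 0

end AlmostRobinson

/-! ### Almost CR structures and leaf spaces -/

variable (m) in
/-- An almost CR structure on a manifold of dimension `2m + 1`: a smooth distribution `H` of rank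
`2m` with a smooth bundle complex structure `J`. -/
structure AlmostCR (L : Type*) [TopologicalSpace L]
    [ChartedSpace (EuclideanSpace ℝ (Fin (2 * m + 1))) L] [IsManifold (𝓡 (2 * m + 1)) ∞ L] where
  H : ∀ y : L, Submodule ℝ (TangentSpace (𝓡 (2 * m + 1)) y)
  J : ∀ y : L, H y →ₗ[ℝ] H y
  H_frame : ∀ y₀ : L, ∃ U : Set L, IsOpen U ∧ y₀ ∈ U ∧
    ∃ e : Fin (2 * m) → VField (2 * m + 1) L, (∀ j, SmoothOn U (e j)) ∧
      ∀ y ∈ U, LinearIndependent ℝ (fun j => e j y) ∧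
        Submodule.span ℝ (Set.range fun j => e j y) = H y
  J_sq : ∀ (y : L) (v : H y), J y (J y v) = -v
  J_smooth : ∀ (U : Set L) (X Y : VField (2 * m + 1) L), IsOpen U → SmoothOn U X →
    (∀ y ∈ U, ∃ h : X y ∈ H y, (J y ⟨X y, h⟩ : TangentSpace (𝓡 (2 * m + 1)) y) = Y y) →
    SmoothOn U Y

variable {L : Type*} [TopologicalSpace L] [ChartedSpace (EuclideanSpace ℝ (Fin (2 * m + 1))) L]
  [IsManifold (𝓡 (2 * m + 1)) ∞ L]

/-- The `-i`-eigenspace `H^{(0,1)} = {v + i J v : v ∈ H}` of `J` at `y`. -/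
def AlmostCR.zeroOne (C : AlmostCR m L) (y : L) : Set (ℂ ⊗[ℝ] TangentSpace (𝓡 (2 * m + 1)) y) :=
  {z | ∃ v : C.H y, z = cvec (v : TangentSpace (𝓡 (2 * m + 1)) y) (C.J y v)}

namespace AlmostRobinson

variable {g : LorentzMetric (2 * m + 2) M} (R : AlmostRobinson g)

/-- `p` exhibits `L` as the leaf space of the congruence of integral curves of `K` in the open set
`U`: it is a surjective submersion whose fibres are connected and tangent to `K`. -/
structure IsLeafSpace (U : Set M) (p : M → L) : Prop where
  isOpen : IsOpen U
  smooth : ContMDiffOn (𝓡 (2 * m + 2)) (𝓡 (2 * m + 1)) ∞ p U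
  surj : p '' U = Set.univ
  submersion : ∀ x ∈ U,
    Function.Surjective (mfderiv (𝓡 (2 * m + 2)) (𝓡 (2 * m + 1)) p x)
  ker : ∀ x ∈ U, ∀ v : TangentSpace (𝓡 (2 * m + 2)) x,
    mfderiv (𝓡 (2 * m + 2)) (𝓡 (2 * m + 1)) p x v = 0 ↔ v ∈ R.K x
  connected : ∀ y : L, IsPreconnected (U ∩ p ⁻¹' {y})

/-- `(N, K)` induces the almost CR structure `(H, J)` on the leaf space: `H` is the image of
`K^⊥`, and `H^{(0,1)}` is the image of `N` (so that `J` is induced by the complex structure of the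
screen bundle `K^⊥ / K`). -/
structure Induces (U : Set M) (p : M → L) (C : AlmostCR m L) : Prop where
  map_perp : ∀ x ∈ U, mfderiv (𝓡 (2 * m + 2)) (𝓡 (2 * m + 1)) p x ''
      {v | ∀ w ∈ R.K x, g.val x w v = 0} = C.H (p x)
  map_N : ∀ x ∈ U,
    (mfderiv (𝓡 (2 * m + 2)) (𝓡 (2 * m + 1)) p x).toLinearMap.baseChange ℂ ''
      (R.N x : Set (ℂ ⊗[ℝ] TangentSpace (𝓡 (2 * m + 2)) x)) = C.zeroOne (p x)

end AlmostRobinson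

end Structures

end Robinson

end

/-! All conditions are compared with one pointwise algebraic condition. Near each point there is a
connection D that preserves g and N. The difference Γ = ∇ - D is a one-form with values in skew
endomorphisms, well defined modulo forms with values in 𝔮 (`IsTorsionForm.sub_mem`). For k in K and
a section z of N, torsion-freeness of ∇ gives [k, z] = (D_k z - D_z k) + (Γ_k z - Γ_z k). The first
bracket lies in N, because D preserves N and therefore K. Since N is totally null of half the
dimension, it is its own orthogonal complement (`IsRobinson.mem_of_orthogonal`). Hence [K, N] ⊂ N
says exactly that g(Γ_k z - Γ_z k, w) = 0 for all z, w in N. This is `PreservesAlong`, and the link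
is `IsTorsionForm.bracket_mem_iff`.

An adapted D is built from a frame A_j, B_j, k, ℓ with A_j + i B_j in N. The flat connection of the
frame preserves N, and so does its g-dual because N is its own orthogonal complement; their average
is in addition metric.

Condition (3) is the same identity in components (`IsRobinson.componentsVanish_iff`). Taking w = k
gives γ = 0. On the screen space Γ_k is skew, so the part symmetric in z and w is σ = 0, and the
antisymmetric part identifies τ with g(Γ_k z, w), of which ζ is a multiple, because ζ comes from the
commutator of Γ_k with J. The components of ∇κ and ∇ρ agree with those of Γ·κ and Γ·ρ up to a
multiple of ω, which has no (2,0)-part; so the torsion and the component versions both reduce to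
`PreservesAlong`.

For (2), contracting 𝓛_k ν with a section z of N leaves only the contraction of -ν with [k, z]. If
[k, z] is in N, then 𝓛_k ν again annihilates N, and such (m+1)-forms make up a complex line at each
point. Conversely the determinant of a coframe of Ann N detects membership in N.

For (4), read K^⊥/K and J through the differential of the projection p in a chart of the leaf space.
They become a field T of endomorphisms of a fixed vector space, where T² = -1 singles out the image
of K^⊥. The differential of p sends [k, X] to the k-derivative of the image of X. So the bracket
condition makes T constant along K, and T descends through a local section; connectedness of the
fibres makes the result independent of the point of the fibre. Conversely an endomorphism field
pulled back from the leaf space is constant along K, and differentiating the equations of N along k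
gives [k, N] ⊂ N. -/

noncomputable section

namespace Robinson

/-! ### Complexified vectors as pairs of real vectors. -/

section Complexification

variable {V W : Type*} [AddCommGroup V] [Module ℝ V] [AddCommGroup W] [Module ℝ W]

/-- The real part of a complexified vector. -/
def rePart : (ℂ ⊗[ℝ] V) →ₗ[ℝ] V := TensorProduct.lid ℝ V ∘ₗ LinearMap.rTensor V Complex.reLm

/-- The imaginary part of a complexified vector. -/
def imPart : (ℂ ⊗[ℝ] V) →ₗ[ℝ] V := TensorProduct.lid ℝ V ∘ₗ LinearMap.rTensor V Complex.imLm

@[simp] lemma rePart_cvec (a b : V) : rePart (cvec a b) = a := by simp [rePart, cvec]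

@[simp] lemma imPart_cvec (a b : V) : imPart (cvec a b) = b := by simp [imPart, cvec]

lemma cvec_add (a b c d : V) : cvec a b + cvec c d = cvec (a + c) (b + d) := by
  simp only [cvec, TensorProduct.tmul_add]; abel

lemma cvec_sub (a b c d : V) : cvec a b - cvec c d = cvec (a - c) (b - d) := by
  simp only [cvec, TensorProduct.tmul_sub]; abel

lemma smul_cvec (z : ℂ) (a b : V) :
    z • cvec a b = cvec (z.re • a - z.im • b) (z.im • a + z.re • b) := by
  have h1 : z = z.re • (1 : ℂ) + z.im • Complex.I := by
    apply Complex.ext <;> simp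
  have h2 : z * Complex.I = z.re • Complex.I - z.im • (1 : ℂ) := by
    apply Complex.ext <;> simp
  simp only [cvec, smul_add, TensorProduct.smul_tmul', smul_eq_mul, mul_one, h2,
    TensorProduct.tmul_sub, TensorProduct.tmul_add, TensorProduct.tmul_smul,
    TensorProduct.sub_tmul]
  nth_rewrite 1 [h1]
  simp only [TensorProduct.add_tmul, TensorProduct.smul_tmul]
  abel

lemma cvec_rePart_imPart (z : ℂ ⊗[ℝ] V) : cvec (rePart z) (imPart z) = z := by
  induction z using TensorProduct.induction_on with
  | zero => simp [cvec]
  | tmul c v =>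
    have : (c ⊗ₜ[ℝ] v : ℂ ⊗[ℝ] V) = c • cvec v 0 := by
      simp [cvec, TensorProduct.smul_tmul']
    rw [this, smul_cvec]; simp
  | add x y hx hy => rw [map_add, map_add, ← cvec_add, hx, hy]

lemma exists_cvec (z : ℂ ⊗[ℝ] V) : ∃ a b, z = cvec a b :=
  ⟨_, _, (cvec_rePart_imPart z).symm⟩

lemma cvec_inj {a b c d : V} : cvec a b = cvec c d ↔ a = c ∧ b = d :=
  ⟨fun h => ⟨by simpa using congrArg rePart h, by simpa using congrArg imPart h⟩,
    fun h => by rw [h.1, h.2]⟩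

@[simp] lemma cvec_zero : cvec (0 : V) 0 = 0 := by simp [cvec]

@[simp] lemma conj_cvec (a b : V) : conj (cvec a b) = cvec a (-b) := by
  simp [conj, cvec, TensorProduct.neg_tmul, TensorProduct.tmul_neg]

@[simp] lemma baseChange_cvec (f : V →ₗ[ℝ] W) (a b : V) :
    f.baseChange ℂ (cvec a b) = cvec (f a) (f b) := by simp [cvec]

lemma form_baseChange_cvec (g : LinearMap.BilinForm ℝ V) (a b c d : V) :
    g.baseChange ℂ (cvec a b) (cvec c d) = cext (fun v w => g v w) a b c d := by
  apply Complex.ext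
  · simp [cvec, cext]; ring
  · simp [cvec, cext]

lemma cvec_mem_baseChange (K : Submodule ℝ V) (a b : V) :
    cvec a b ∈ K.baseChange ℂ ↔ a ∈ K ∧ b ∈ K := by
  constructor
  · intro h
    suffices H : ∀ z ∈ K.baseChange ℂ, rePart z ∈ K ∧ imPart z ∈ K by simpa using H _ h
    intro z hz
    rw [Submodule.baseChange_eq_span] at hz
    induction hz using Submodule.span_induction with
    | mem x hx =>
      obtain ⟨v, hv, rfl⟩ := hx
      have : (TensorProduct.mk ℝ ℂ V 1) v = cvec v 0 := by simp [cvec]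
      rw [this]; exact ⟨by simpa using hv, by simp⟩
    | zero => simp
    | add x y _ _ hx hy =>
      rw [map_add, map_add]; exact ⟨K.add_mem hx.1 hy.1, K.add_mem hx.2 hy.2⟩
    | smul c x _ hx =>
      rw [← cvec_rePart_imPart x, smul_cvec]
      simp only [rePart_cvec, imPart_cvec]
      exact ⟨K.sub_mem (K.smul_mem _ hx.1) (K.smul_mem _ hx.2),
        K.add_mem (K.smul_mem _ hx.1) (K.smul_mem _ hx.2)⟩
  · rintro ⟨ha, hb⟩
    exact add_mem (Submodule.tmul_mem_baseChange_of_mem 1 ha)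
      (Submodule.tmul_mem_baseChange_of_mem Complex.I hb)

lemma I_mem {N : Submodule ℂ (ℂ ⊗[ℝ] V)} {a b : V} (h : cvec a b ∈ N) : cvec (-b) a ∈ N := by
  have := N.smul_mem Complex.I h
  rw [smul_cvec] at this
  simpa using this

end Complexification

/-! ### Linear algebra of a maximal totally null subspace. -/

/-- The algebraic properties of a Robinson structure on one tangent space. -/
structure IsRobinson (m : ℕ) {V : Type*} [AddCommGroup V] [Module ℝ V]
    (g : LinearMap.BilinForm ℝ V) (N : Submodule ℂ (ℂ ⊗[ℝ] V)) (K : Submodule ℝ V) : Prop where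
  finrank_eq : Module.finrank ℝ V = 2 * m + 2
  finrank_N : Module.finrank ℂ N = m + 1
  symm : ∀ v w, g v w = g w v
  nondeg : ∀ v, (∀ w, g v w = 0) → v = 0
  null : ∀ z ∈ N, ∀ w ∈ N, g.baseChange ℂ z w = 0
  mem_K : ∀ v, v ∈ K ↔ cvec v 0 ∈ N
  K_span : ∃ k, k ≠ 0 ∧ Submodule.span ℝ {k} = K

namespace IsRobinson

variable {m : ℕ} {V : Type*} [AddCommGroup V] [Module ℝ V]
  {g : LinearMap.BilinForm ℝ V} {N : Submodule ℂ (ℂ ⊗[ℝ] V)} {K : Submodule ℝ V}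

section
variable (h : IsRobinson m g N K)
include h

lemma finite : Module.Finite ℝ V :=
  Module.finite_of_finrank_pos (by rw [h.finrank_eq]; omega)

lemma null_re {a b c d : V} (h1 : cvec a b ∈ N) (h2 : cvec c d ∈ N) : g a c = g b d := by
  have := congrArg Complex.re (h.null _ h1 _ h2)
  rw [form_baseChange_cvec] at this
  simp [cext] at this; linarith

lemma null_im {a b c d : V} (h1 : cvec a b ∈ N) (h2 : cvec c d ∈ N) : g a d = - g b c := by
  have := congrArg Complex.im (h.null _ h1 _ h2)
  rw [form_baseChange_cvec] at this
  simp [cext] at this; linarith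

/-- N is contained in its orthogonal complement, and both have complex dimension m + 1 inside
dimension 2m + 2, so they coincide. The real part of the orthogonality relation suffices as
hypothesis because N is closed under multiplication by i. -/
lemma mem_of_orthogonal {a b : V} (H : ∀ c d, cvec c d ∈ N → g a c = g b d) : cvec a b ∈ N := by
  have := h.finite
  set B := g.baseChange ℂ
  have hsymm : ∀ z w, B z w = B w z := by
    intro z w
    obtain ⟨a, b, rfl⟩ := exists_cvec z
    obtain ⟨c, d, rfl⟩ := exists_cvec w
    simp only [B, form_baseChange_cvec, cext]
    rw [h.symm a c, h.symm b d, h.symm a d, h.symm b c, add_comm]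
  have hrefl : B.IsRefl := fun z w hzw => by rw [hsymm, hzw]
  have hker : ∀ z, (∀ w, B z w = 0) → z = 0 := by
    intro z hz
    obtain ⟨a, b, rfl⟩ := exists_cvec z
    have h1 : a = 0 := h.nondeg a fun w => by
      have := congrArg Complex.re (hz (cvec w 0))
      simpa [B, form_baseChange_cvec, cext] using this
    have h2 : b = 0 := h.nondeg b fun w => by
      have := congrArg Complex.im (hz (cvec w 0))
      simpa [B, form_baseChange_cvec, cext] using this
    simp [h1, h2]
  have hnd : B.Nondegenerate := by
    refine ⟨hker, fun z hz => hker z fun w => by rw [hsymm]; exact hz w⟩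
  have hle : N ≤ B.orthogonal N := fun z hz w hw => h.null w hw z hz
  have hfr := LinearMap.BilinForm.finrank_orthogonal hnd N
  rw [Module.finrank_baseChange, h.finrank_eq, h.finrank_N] at hfr
  have heq : N = B.orthogonal N :=
    Submodule.eq_of_le_of_finrank_eq hle (by rw [h.finrank_N, hfr]; omega)
  rw [heq]
  intro w hw
  obtain ⟨c, d, rfl⟩ := exists_cvec w
  change B _ _ = 0
  rw [hsymm, form_baseChange_cvec]
  have e1 := H _ _ hw
  -- The hypothesis at i w supplies the imaginary part of the pairing with w.
  have e2 := H _ _ (I_mem hw)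
  rw [map_neg] at e2
  apply Complex.ext <;> simp [cext] <;> linarith

lemma orthogonal_left {a b v : V} (hv : v ∈ K) (hab : cvec a b ∈ N) : g v a = 0 := by
  have := h.null_re ((h.mem_K v).1 hv) hab
  simpa using this

lemma orthogonal_right {a b v : V} (hv : v ∈ K) (hab : cvec a b ∈ N) : g v b = 0 := by
  have := h.null_im ((h.mem_K v).1 hv) hab
  simpa using this

lemma K_null {v w : V} (hv : v ∈ K) (hw : w ∈ K) : g v w = 0 :=
  h.orthogonal_left hv ((h.mem_K w).1 hw)

lemma im_mem_K {b : V} (hb : cvec 0 b ∈ N) : b ∈ K := by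
  rw [h.mem_K]
  have := N.neg_mem (I_mem hb)
  have e : -cvec (-b) 0 = cvec b 0 := by
    rw [← zero_sub, ← cvec_zero (V := V), cvec_sub]; simp
  rwa [e] at this

lemma mem_K_of_orthogonal {v : V} (H : ∀ a b, cvec a b ∈ N → g v a = 0) : v ∈ K :=
  (h.mem_K v).2 (h.mem_of_orthogonal fun c d hcd => by simp [H c d hcd])

/-- Every vector of `K^⊥` is the real part of an element of `N`. -/
lemma exists_im {v : V} (hv : ∀ w ∈ K, g w v = 0) : ∃ v', cvec v v' ∈ N := by
  have := h.finite
  let S : Submodule ℝ V := (N.restrictScalars ℝ).map rePart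
  have hrefl : g.IsRefl := fun z w hzw => by rw [h.symm, hzw]
  have hnd : g.Nondegenerate :=
    ⟨h.nondeg, fun z hz => h.nondeg z fun w => by rw [h.symm]; exact hz w⟩
  -- The orthogonal complement of Re N consists of real vectors of N, hence lies in K; so K^⊥ is
  -- contained in the double complement of Re N, which is Re N itself.
  have hS : v ∈ g.orthogonal (g.orthogonal S) := by
    intro u hu
    refine hv u (h.mem_K_of_orthogonal fun a b hab => ?_)
    rw [h.symm]
    exact hu a ⟨_, hab, rePart_cvec a b⟩
  rw [LinearMap.BilinForm.orthogonal_orthogonal hnd hrefl] at hS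
  obtain ⟨z, hz, rfl⟩ := hS
  exact ⟨imPart z, by rwa [cvec_rePart_imPart]⟩

end

end IsRobinson

end Robinson

/-! ### Splittings and the complex structure on the screen space. -/

namespace Robinson

namespace IsRobinson

variable {m : ℕ} {V : Type*} [AddCommGroup V] [Module ℝ V]
  {g : LinearMap.BilinForm ℝ V} {N : Submodule ℂ (ℂ ⊗[ℝ] V)} {K : Submodule ℝ V} {k ℓ : V}

lemma _root_.Robinson.mem_screen {v : V} : v ∈ screen g k ℓ ↔ g k v = 0 ∧ g ℓ v = 0 := by
  simp [screen]

section
variable (h : IsRobinson m g N K) (s : IsSplitting g K k ℓ)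
include h s

lemma K_eq_smul {v : V} (hv : v ∈ K) : v = g v ℓ • k := by
  obtain ⟨k₀, -, hk⟩ := h.K_span
  have hk' := s.mem
  rw [← hk, Submodule.mem_span_singleton] at hk' hv
  obtain ⟨c, rfl⟩ := hk'
  obtain ⟨d, rfl⟩ := hv
  have := s.pairing
  simp only [map_smul, LinearMap.smul_apply, smul_eq_mul] at this ⊢
  rw [smul_smul]
  congr 1
  linear_combination -d * this

lemma perp_iff {v : V} : (∀ w ∈ K, g w v = 0) ↔ g k v = 0 := by
  refine ⟨fun H => H k s.mem, fun H w hw => ?_⟩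
  rw [h.K_eq_smul s hw]; simp [H]

lemma proj_mem (v : V) : proj g k ℓ v ∈ screen g k ℓ := by
  have h1 := h.K_null s.mem s.mem
  have h2 := s.null
  have h3 := s.pairing
  have h4 := h.symm ℓ k
  rw [mem_screen]
  simp only [proj, map_sub, map_smul, smul_eq_mul, h1, h2, h3, h4]
  constructor <;> ring

omit h s in
lemma proj_of_mem {v : V} (hv : v ∈ screen g k ℓ) : proj g k ℓ v = v := by
  rw [mem_screen] at hv
  simp [proj, hv.1, hv.2]

lemma sub_smul_mem {a b : V} (hab : cvec a b ∈ N) (α β : ℝ) :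
    cvec (a - α • k) (b - β • k) ∈ N := by
  have hk := (h.mem_K k).1 s.mem
  have h1 := N.sub_mem hab (N.smul_mem ⟨α, β⟩ hk)
  rwa [smul_cvec, cvec_sub, smul_zero, smul_zero, sub_zero, add_zero] at h1

lemma proj_mem_N {a b : V} (hab : cvec a b ∈ N) :
    cvec (proj g k ℓ a) (proj g k ℓ b) ∈ N := by
  have := h.sub_smul_mem s hab (g ℓ a) (g ℓ b)
  simpa [proj, h.orthogonal_left s.mem hab, h.orthogonal_right s.mem hab] using this

lemma screen_K {v : V} (hv : v ∈ screen g k ℓ) (hK : v ∈ K) : v = 0 := by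
  rw [h.K_eq_smul s hK, h.symm, (mem_screen.1 hv).2, zero_smul]

/-- This makes the choice in `screenJ` meaningful: K^⊥ is the real part of N, and projecting a
partner of v to the screen space changes it only by a multiple of k, which does not leave N. -/
lemma screenJ_spec {v : V} (hv : v ∈ screen g k ℓ) :
    screenJ g N k ℓ v ∈ screen g k ℓ ∧ cvec v (screenJ g N k ℓ v) ∈ N := by
  refine Classical.epsilon_spec (p := fun v' => v' ∈ screen g k ℓ ∧ cvec v v' ∈ N) ?_
  obtain ⟨v', hv'⟩ := h.exists_im (v := v) ((h.perp_iff s).2 (mem_screen.1 hv).1)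
  refine ⟨proj g k ℓ v', h.proj_mem s v', ?_⟩
  simpa [proj_of_mem hv] using h.proj_mem_N s hv'

lemma screenJ_mem {v : V} (hv : v ∈ screen g k ℓ) : screenJ g N k ℓ v ∈ screen g k ℓ :=
  (h.screenJ_spec s hv).1

/-- Two candidates differ by a vector b with i b in N, so b is in K, and K meets the screen space
only in zero. Linearity and skewness of J follow from this uniqueness. -/
lemma screenJ_eq {v v' : V} (hv : v ∈ screen g k ℓ) (hv' : v' ∈ screen g k ℓ)
    (hN : cvec v v' ∈ N) : screenJ g N k ℓ v = v' := by
  obtain ⟨h1, h2⟩ := h.screenJ_spec s hv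
  have h3 := N.sub_mem h2 hN
  rw [cvec_sub, sub_self] at h3
  exact sub_eq_zero.1 (h.screen_K s (Submodule.sub_mem _ h1 hv') (h.im_mem_K h3))

lemma screenJ_add {v w : V} (hv : v ∈ screen g k ℓ) (hw : w ∈ screen g k ℓ) :
    screenJ g N k ℓ (v + w) = screenJ g N k ℓ v + screenJ g N k ℓ w := by
  obtain ⟨h1, h2⟩ := h.screenJ_spec s hv
  obtain ⟨h3, h4⟩ := h.screenJ_spec s hw
  refine h.screenJ_eq s (Submodule.add_mem _ hv hw) (Submodule.add_mem _ h1 h3) ?_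
  rw [← cvec_add]; exact N.add_mem h2 h4

lemma screenJ_smul (c : ℝ) {v : V} (hv : v ∈ screen g k ℓ) :
    screenJ g N k ℓ (c • v) = c • screenJ g N k ℓ v := by
  obtain ⟨h1, h2⟩ := h.screenJ_spec s hv
  refine h.screenJ_eq s (Submodule.smul_mem _ c hv) (Submodule.smul_mem _ c h1) ?_
  have := N.smul_mem (c : ℂ) h2
  rw [smul_cvec] at this
  simpa using this

lemma screenJ_skew {v w : V} (hv : v ∈ screen g k ℓ) (hw : w ∈ screen g k ℓ) :
    g (screenJ g N k ℓ v) w = - g v (screenJ g N k ℓ w) := by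
  have := h.null_im (h.screenJ_spec s hv).2 (h.screenJ_spec s hw).2
  linarith

end

/-- The endomorphism of `V` that is the complex structure on the screen space and zero on the
splitting. -/
def Jmap (h : IsRobinson m g N K) (s : IsSplitting g K k ℓ) : V →ₗ[ℝ] V where
  toFun v := screenJ g N k ℓ (proj g k ℓ v)
  map_add' v w := by
    rw [← h.screenJ_add s (h.proj_mem s v) (h.proj_mem s w)]
    congr 1
    simp only [proj, map_add]; module
  map_smul' c v := by
    rw [RingHom.id_apply, ← h.screenJ_smul s c (h.proj_mem s v)]
    congr 1
    simp only [proj, map_smul, smul_eq_mul]; module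

section
variable (h : IsRobinson m g N K) (s : IsSplitting g K k ℓ)

lemma Jmap_apply (v : V) : h.Jmap s v = screenJ g N k ℓ (proj g k ℓ v) := rfl

lemma Jmap_mem (v : V) : h.Jmap s v ∈ screen g k ℓ := h.screenJ_mem s (h.proj_mem s v)

lemma Jmap_of_mem {v : V} (hv : v ∈ screen g k ℓ) : h.Jmap s v = screenJ g N k ℓ v := by
  rw [Jmap_apply, proj_of_mem hv]

lemma Jmap_eq {v v' : V} (hv : v ∈ screen g k ℓ) (hv' : v' ∈ screen g k ℓ)
    (hN : cvec v v' ∈ N) : h.Jmap s v = v' := by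
  rw [Jmap_of_mem h s hv, h.screenJ_eq s hv hv' hN]

lemma cvec_Jmap_mem {v : V} (hv : v ∈ screen g k ℓ) : cvec v (h.Jmap s v) ∈ N := by
  rw [Jmap_of_mem h s hv]; exact (h.screenJ_spec s hv).2

lemma Jmap_left : h.Jmap s k = 0 := by
  have : proj g k ℓ k = 0 := by
    simp [proj, h.K_null s.mem s.mem, h.symm ℓ k, s.pairing]
  rw [Jmap_apply, this, ← zero_smul ℝ (0 : V), h.screenJ_smul s 0 (Submodule.zero_mem _), zero_smul,
    zero_smul]

lemma Jmap_right : h.Jmap s ℓ = 0 := by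
  have : proj g k ℓ ℓ = 0 := by
    simp [proj, s.null, s.pairing]
  rw [Jmap_apply, this, ← zero_smul ℝ (0 : V), h.screenJ_smul s 0 (Submodule.zero_mem _), zero_smul,
    zero_smul]

omit s in
include h in
lemma inner_proj {v : V} (hv : v ∈ screen g k ℓ) (w : V) : g v (proj g k ℓ w) = g v w := by
  rw [mem_screen] at hv
  simp [proj, h.symm v k, h.symm v ℓ, hv.1, hv.2]

omit s in
include h in
lemma proj_inner {v : V} (hv : v ∈ screen g k ℓ) (w : V) : g (proj g k ℓ w) v = g w v := by
  rw [h.symm, h.inner_proj hv, h.symm]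

lemma omega_eq (v w : V) : omega g N k ℓ v w = g (h.Jmap s v) w := by
  rw [omega, ← Jmap_apply h s, h.inner_proj (Jmap_mem h s v)]

lemma Jmap_skew (v w : V) : g (h.Jmap s v) w = - g v (h.Jmap s w) := by
  rw [← h.inner_proj (Jmap_mem h s v), Jmap_apply, Jmap_apply,
    h.screenJ_skew s (h.proj_mem s v) (h.proj_mem s w),
    h.proj_inner (h.screenJ_mem s (h.proj_mem s w))]

end

end IsRobinson

/-! ### Components of algebraic torsions -/

section Components

variable {m : ℕ} {V : Type*} [AddCommGroup V] [Module ℝ V]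

/-- The three conditions on the components `γ`, `σ`, `τ`, `ζ` of a pair `(A, R)`. -/
def ComponentsVanish (m : ℕ) (g : LinearMap.BilinForm ℝ V) (N : Submodule ℂ (ℂ ⊗[ℝ] V)) (k ℓ : V)
    (A : V → V → ℝ) (R : V → V → V → V → ℝ) : Prop :=
  GammaVanishes g k ℓ A ∧ ShearTwoZeroVanishes m g N k ℓ A ∧
    ∀ a b c d, IsOneZero g N k ℓ a b → IsOneZero g N k ℓ c d →
      cext (zeta k ℓ R) a b c d = 2 * Complex.I * cext (twist A) a b c d

/-- The torsion-type tensor `Γ` satisfies `g (Γ_k z - Γ_z k, w) = 0` for `z`, `w` in `N`. -/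
def PreservesAlong (g : LinearMap.BilinForm ℝ V) (N : Submodule ℂ (ℂ ⊗[ℝ] V)) (k : V)
    (Γ : V →ₗ[ℝ] skewEnd g) : Prop :=
  ∀ a b c d, cvec a b ∈ N → cvec c d ∈ N →
    g ((Γ k : V →ₗ[ℝ] V) a) c - g ((Γ k : V →ₗ[ℝ] V) b) d
      = g ((Γ a : V →ₗ[ℝ] V) k) c - g ((Γ b : V →ₗ[ℝ] V) k) d

variable {g : LinearMap.BilinForm ℝ V} {N : Submodule ℂ (ℂ ⊗[ℝ] V)} {K : Submodule ℝ V} {k ℓ : V}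

lemma skewEnd_apply (A : skewEnd g) (v w : V) :
    g ((A : V →ₗ[ℝ] V) v) w = - g v ((A : V →ₗ[ℝ] V) w) := by
  have := A.2 v w
  linarith

/-- As N consists of the vectors v + i J v modulo K, its conjugate consists of the v - i J v; this
is the source of the minus sign. -/
lemma IsRobinson.isOneZero_iff (h : IsRobinson m g N K) (s : IsSplitting g K k ℓ) {a b : V} :
    IsOneZero g N k ℓ a b ↔ a ∈ screen g k ℓ ∧ b ∈ screen g k ℓ ∧ h.Jmap s a = -b := by
  constructor
  · rintro ⟨h1, h2, h3⟩
    rw [conj_cvec] at h3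
    exact ⟨h1, h2, h.Jmap_eq s h1 (Submodule.neg_mem _ h2) h3⟩
  · rintro ⟨h1, h2, h3⟩
    refine ⟨h1, h2, ?_⟩
    rw [conj_cvec, ← h3]
    exact h.cvec_Jmap_mem s h1

/-- The (2,0)-part of h is zero because N is null, so the trace term drops out whatever its value.
In particular nothing has to be known about `screenTrace`, nor about the division by 2m when m = 0.
-/
lemma IsRobinson.cext_shear (h : IsRobinson m g N K) (A : V → V → ℝ) {a b c d : V}
    (hab : IsOneZero g N k ℓ a b) (hcd : IsOneZero g N k ℓ c d) :
    cext (shear m g k ℓ A) a b c d = cext (fun v w => (A v w + A w v) / 2) a b c d := by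
  have h1 := hab.mem_conj
  have h2 := hcd.mem_conj
  rw [conj_cvec] at h1 h2
  have e1 := h.null_re h1 h2
  have e2 := h.null_im h1 h2
  simp only [map_neg, LinearMap.neg_apply, neg_neg] at e1 e2
  apply Complex.ext <;> simp only [cext, shear]
  · linear_combination (-screenTrace m g k ℓ A / (2 * m)) * e1
  · linear_combination (screenTrace m g k ℓ A / (2 * m)) * e2

/-- The component conditions only depend on the tensor `Γ`. -/
lemma IsRobinson.componentsVanish_iff (h : IsRobinson m g N K) (s : IsSplitting g K k ℓ)
    {A : V → V → ℝ} {R : V → V → V → V → ℝ} {Γ : V →ₗ[ℝ] skewEnd g}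
    (hA : ∀ v w, g k v = 0 → w ∈ screen g k ℓ → A v w = g ((Γ v : V →ₗ[ℝ] V) k) w)
    (t : ℝ) (hR : ∀ a ∈ screen g k ℓ, ∀ c ∈ screen g k ℓ, zeta k ℓ R a c
      = g ((Γ k : V →ₗ[ℝ] V) a) (h.Jmap s c) + g ((Γ k : V →ₗ[ℝ] V) (h.Jmap s a)) c
        + t * g (h.Jmap s a) c) :
    ComponentsVanish m g N k ℓ A R ↔ PreservesAlong g N k Γ := by
  have hkk := h.K_null s.mem s.mem
  -- the common form of the third condition
  have hzeta : ∀ a b c d, IsOneZero g N k ℓ a b → IsOneZero g N k ℓ c d →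
      cext (zeta k ℓ R) a b c d = ⟨-2 * (g ((Γ k : V →ₗ[ℝ] V) a) d + g ((Γ k : V →ₗ[ℝ] V) b) c),
        2 * (g ((Γ k : V →ₗ[ℝ] V) a) c - g ((Γ k : V →ₗ[ℝ] V) b) d)⟩ := by
    intro a b c d hab hcd
    have h1 := hab.mem_conj
    have h2 := hcd.mem_conj
    rw [conj_cvec] at h1 h2
    have e1 := h.null_re h1 h2
    have e2 := h.null_im h1 h2
    simp only [map_neg, LinearMap.neg_apply, neg_neg] at e1 e2
    obtain ⟨ha, hb, hJa⟩ := (h.isOneZero_iff s).1 hab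
    obtain ⟨hc, hd, hJc⟩ := (h.isOneZero_iff s).1 hcd
    have hJb : h.Jmap s b = a := h.Jmap_eq s hb ha (by simpa using I_mem h1)
    have hJd : h.Jmap s d = c := h.Jmap_eq s hd hc (by simpa using I_mem h2)
    apply Complex.ext <;>
      simp only [cext, hR _ ha _ hc, hR _ hb _ hd, hR _ ha _ hd, hR _ hb _ hc, hJa, hJb, hJc, hJd,
        map_neg, LinearMap.neg_apply]
    -- The terms with t are components of ω of type (2,0), which vanish because N is null.
    · linear_combination t * e2
    · linear_combination t * e1
  constructor
  · rintro ⟨hγ, hσ, hζ⟩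
    have hγ' : ∀ v ∈ screen g k ℓ, g v ((Γ k : V →ₗ[ℝ] V) k) = 0 := fun v hv => by
      rw [h.symm, ← hA k v hkk hv]; exact hγ v hv
    -- elements of `N` in the screen space
    have key : ∀ a b c d, a ∈ screen g k ℓ → b ∈ screen g k ℓ → c ∈ screen g k ℓ →
        d ∈ screen g k ℓ → cvec a b ∈ N → cvec c d ∈ N →
        g ((Γ k : V →ₗ[ℝ] V) a) c - g ((Γ k : V →ₗ[ℝ] V) b) d
          = g ((Γ a : V →ₗ[ℝ] V) k) c - g ((Γ b : V →ₗ[ℝ] V) k) d := by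
      intro a b c d ha hb hc hd hab hcd
      have oz1 : IsOneZero g N k ℓ a (-b) := ⟨ha, Submodule.neg_mem _ hb, by simpa using hab⟩
      have oz2 : IsOneZero g N k ℓ c (-d) := ⟨hc, Submodule.neg_mem _ hd, by simpa using hcd⟩
      -- The real part of σ = 0 kills the symmetric part of A, so twice the twist is 2A here. The
      -- imaginary part of ζ = 2iτ then compares g(Γ_k z, w) with A(z, w). The remaining real and
      -- imaginary parts are not needed, since N is stable under i.
      have e1 := hσ _ _ _ _ oz1 oz2
      rw [h.cext_shear _ oz1 oz2] at e1
      have e1 := congrArg Complex.re e1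
      have e2 := hζ _ _ _ _ oz1 oz2
      rw [hzeta _ _ _ _ oz1 oz2] at e2
      have e2 := congrArg Complex.im e2
      have ha' := (mem_screen.1 ha).1
      have hc' := (mem_screen.1 hc).1
      have hb' : g k (-b) = 0 := by rw [map_neg, (mem_screen.1 hb).1, neg_zero]
      have hd' : g k (-d) = 0 := by rw [map_neg, (mem_screen.1 hd).1, neg_zero]
      simp only [cext, twist, Complex.mul_re, Complex.mul_im, Complex.I_re, Complex.I_im,
        Complex.re_ofNat, Complex.im_ofNat, Complex.zero_re,
        hA a c ha' hc, hA c a hc' ha, hA _ _ hb' oz2.right, hA _ _ hd' oz1.right,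
        map_neg, LinearMap.neg_apply, neg_neg, NegMemClass.coe_neg] at e1 e2
      linarith
    intro a b c d hab hcd
    have k1 := key _ _ _ _ (h.proj_mem s a) (h.proj_mem s b) (h.proj_mem s c) (h.proj_mem s d)
      (h.proj_mem_N s hab) (h.proj_mem_N s hcd)
    have ga := h.orthogonal_left s.mem hab
    have gb := h.orthogonal_right s.mem hab
    have gc := h.orthogonal_left s.mem hcd
    have gd := h.orthogonal_right s.mem hcd
    have hγa := hγ' _ (h.proj_mem s a)
    have hγb := hγ' _ (h.proj_mem s b)
    have sk : ∀ v, g ((Γ v : V →ₗ[ℝ] V) k) k = 0 := fun v => by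
      have := skewEnd_apply (Γ v) k k
      rw [h.symm k] at this; linarith
    have eq1 : ∀ v, g ((Γ k : V →ₗ[ℝ] V) v) k = - g v ((Γ k : V →ₗ[ℝ] V) k) :=
      fun v => skewEnd_apply _ _ _
    -- Passing from the screen space to all of N adds multiples of k. Their contributions vanish by
    -- γ = 0 and by the skewness of the endomorphisms.
    have e : ∀ v, g k v = 0 → v = proj g k ℓ v + g ℓ v • k := fun v hv => by simp [proj, hv]
    rw [e a ga, e b gb, e c gc, e d gd]
    simp only [map_add, map_smul, LinearMap.add_apply, LinearMap.smul_apply, smul_eq_mul,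
      Submodule.coe_add, Submodule.coe_smul, eq1, sk, hγa, hγb] at k1 ⊢
    have := h.symm k ((Γ k : V →ₗ[ℝ] V) k)
    have := sk k
    linarith
  · intro H
    have sk : ∀ v, g ((Γ v : V →ₗ[ℝ] V) k) k = 0 := fun v => by
      have := skewEnd_apply (Γ v) k k
      rw [h.symm k] at this; linarith
    refine ⟨fun v hv => ?_, fun a b c d hab hcd => ?_, fun a b c d hab hcd => ?_⟩
    · rw [hA k v hkk hv]
      -- Testing against w = k isolates γ, because g(Γ_v k, k) = 0 by skewness.
      have := H v _ k 0 (h.cvec_Jmap_mem s hv) ((h.mem_K k).1 s.mem)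
      rw [sk, map_zero, map_zero, sub_zero, sub_zero, skewEnd_apply, h.symm] at this
      linarith
    all_goals
      have h1 := hab.mem_conj
      have h2 := hcd.mem_conj
      rw [conj_cvec] at h1 h2
      -- Exchanging z and w and multiplying by i give the real and imaginary parts in both orders.
      -- As Γ_k is skew, adding the two orders yields σ and subtracting them yields ζ - 2iτ.
      have e1 := H _ _ _ _ h1 h2
      have e2 := H _ _ _ _ h2 h1
      have e3 := H _ _ _ _ (I_mem h1) h2
      have e4 := H _ _ _ _ h2 (I_mem h1)
      have ha' := (mem_screen.1 hab.left).1
      have hb' := (mem_screen.1 hab.right).1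
      have hc' := (mem_screen.1 hcd.left).1
      have hd' := (mem_screen.1 hcd.right).1
      have f : ∀ v w, g ((Γ k : V →ₗ[ℝ] V) v) w = - g ((Γ k : V →ₗ[ℝ] V) w) v := fun v w => by
        rw [skewEnd_apply, h.symm]
      have f1 := f a c
      have f2 := f a d
      have f3 := f b c
      have f4 := f b d
      simp only [map_neg, LinearMap.neg_apply, neg_neg, NegMemClass.coe_neg] at e1 e2 e3 e4
    · rw [h.cext_shear _ hab hcd]
      apply Complex.ext <;>
        simp only [cext, Complex.zero_re, Complex.zero_im,
        hA a c ha' hcd.left, hA c a hc' hab.left, hA a d ha' hcd.right, hA d a hd' hab.left,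
        hA b c hb' hcd.left, hA c b hc' hab.right, hA b d hb' hcd.right, hA d b hd' hab.right] <;>
      linarith
    · rw [hzeta _ _ _ _ hab hcd]
      apply Complex.ext <;>
        simp only [cext, twist, Complex.mul_re, Complex.mul_im, Complex.I_re, Complex.I_im,
        Complex.re_ofNat, Complex.im_ofNat,
        hA a c ha' hcd.left, hA c a hc' hab.left, hA a d ha' hcd.right, hA d a hd' hab.left,
        hA b c hb' hcd.left, hA c b hc' hab.right, hA b d hb' hcd.right, hA d b hd' hab.right] <;>
      linarith

lemma PreservesAlong.smul {Γ : V →ₗ[ℝ] skewEnd g} (H : PreservesAlong g N k Γ) (c : ℝ) :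
    PreservesAlong g N (c • k) Γ := by
  intro a b a' b' h1 h2
  have := H a b a' b' h1 h2
  simp only [map_smul, LinearMap.smul_apply, Submodule.coe_smul, smul_eq_mul]
  linear_combination c * this

lemma IsRobinson.preservesAlong_iff (h : IsRobinson m g N K) (s : IsSplitting g K k ℓ)
    {Γ : V →ₗ[ℝ] skewEnd g} :
    (∀ v ∈ K, PreservesAlong g N v Γ) ↔ PreservesAlong g N k Γ := by
  refine ⟨fun H => H k s.mem, fun H v hv => ?_⟩
  rw [h.K_eq_smul s hv]
  exact H.smul _

lemma mem_stabilizer {A : skewEnd g} :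
    A ∈ stabilizer g N ↔ ∀ a b, cvec a b ∈ N →
      cvec ((A : V →ₗ[ℝ] V) a) ((A : V →ₗ[ℝ] V) b) ∈ N := by
  refine ⟨fun H a b hab => by simpa using H _ hab, fun H z hz => ?_⟩
  obtain ⟨a, b, rfl⟩ := exists_cvec z
  simpa using H a b hz

lemma IsRobinson.apply_mem_K (h : IsRobinson m g N K) {A : skewEnd g}
    (hA : A ∈ stabilizer g N) (hk : k ∈ K) : (A : V →ₗ[ℝ] V) k ∈ K := by
  rw [h.mem_K] at hk ⊢
  simpa using mem_stabilizer.1 hA _ _ hk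

/-- A form with values in 𝔮 maps N to N and K to K ⊂ N, so every term it contributes is a pairing
inside the null space N. Hence the condition descends to the class in 𝔾. -/
lemma IsRobinson.preservesAlong_congr (h : IsRobinson m g N K) (hk : k ∈ K)
    {Γ Γ' : V →ₗ[ℝ] skewEnd g} (hΓ : Γ - Γ' ∈ stabilizerForms g N) :
    PreservesAlong g N k Γ ↔ PreservesAlong g N k Γ' := by
  refine forall₄_congr fun a b c d => forall₂_congr fun hab hcd => ?_
  have e1 := h.null_re (mem_stabilizer.1 (hΓ k) _ _ hab) hcd
  have e2 := h.orthogonal_left (h.apply_mem_K (hΓ a) hk) hcd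
  have e3 := h.orthogonal_right (h.apply_mem_K (hΓ b) hk) hcd
  simp only [LinearMap.sub_apply, Submodule.coe_sub, map_sub] at e1 e2 e3
  constructor <;> intro <;> linarith

lemma dotKappa_eq (Γ : V →ₗ[ℝ] skewEnd g) (v w : V) :
    dotKappa g k Γ v w = g ((Γ v : V →ₗ[ℝ] V) k) w := by
  rw [dotKappa, skewEnd_apply]

lemma IsRobinson.rho_right (h : IsRobinson m g N K) (s : IsSplitting g K k ℓ) (v w : V) :
    rho g N k ℓ v w ℓ = g (h.Jmap s v) w + g k v * g (h.Jmap s w) ℓ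
      - g k w * g (h.Jmap s v) ℓ := by
  rw [rho, h.omega_eq s, h.omega_eq s, h.omega_eq s, s.pairing, h.Jmap_right, map_zero,
    LinearMap.zero_apply, h.Jmap_skew s w ℓ, h.Jmap_skew s v ℓ, h.Jmap_right]
  simp

/-- The first two terms are h([Γ_k, J] a, c). The last one is a multiple of ω and comes from the
slot filled by ℓ; it is the harmless term with t in `IsRobinson.componentsVanish_iff`. -/
lemma IsRobinson.zeta_dotRho (h : IsRobinson m g N K) (s : IsSplitting g K k ℓ)
    (Γ : V →ₗ[ℝ] skewEnd g) {a c : V} (ha : a ∈ screen g k ℓ) (hc : c ∈ screen g k ℓ) :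
    zeta k ℓ (dotRho g N k ℓ Γ) a c
      = g ((Γ k : V →ₗ[ℝ] V) a) (h.Jmap s c) + g ((Γ k : V →ₗ[ℝ] V) (h.Jmap s a)) c
        + (-g k ((Γ k : V →ₗ[ℝ] V) ℓ)) * g (h.Jmap s a) c := by
  have ea := (mem_screen.1 ha).1
  have ec := (mem_screen.1 hc).1
  have J0 : ∀ v, g (h.Jmap s v) ℓ = 0 := fun v => by rw [h.Jmap_skew, h.Jmap_right]; simp
  have e3 : ∀ q, rho g N k ℓ a c q = g k q * g (h.Jmap s a) c := fun q => by
    simp [rho, h.omega_eq s, ea, ec]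
  rw [zeta, dotRho, h.rho_right s, h.rho_right s, e3, J0, J0, J0, J0, h.Jmap_skew s _ c,
    skewEnd_apply _ (h.Jmap s a)]
  ring

lemma IsRobinson.componentsVanish_dot (h : IsRobinson m g N K) (s : IsSplitting g K k ℓ)
    (Γ : V →ₗ[ℝ] skewEnd g) :
    ComponentsVanish m g N k ℓ (dotKappa g k Γ) (dotRho g N k ℓ Γ) ↔ PreservesAlong g N k Γ :=
  h.componentsVanish_iff s (fun _ _ _ _ => dotKappa_eq Γ _ _) _
    fun _ ha _ hc => h.zeta_dotRho s Γ ha hc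

lemma IsRobinson.exists_splitting (h : IsRobinson m g N K) : ∃ k ℓ, IsSplitting g K k ℓ := by
  obtain ⟨k, hk0, hk⟩ := h.K_span
  have hkK : k ∈ K := hk ▸ Submodule.mem_span_singleton_self k
  have : ∃ w, g k w ≠ 0 := by
    by_contra! H
    exact hk0 (h.nondeg k H)
  obtain ⟨w, hw⟩ := this
  -- Any w transverse to K^⊥ is first normalised against k and then made null by adding a multiple
  -- of k, which does not change its product with k.
  refine ⟨k, (g k w)⁻¹ • w - (g w w / (2 * (g k w) ^ 2)) • k, hkK, ?_, ?_⟩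
  · simp [h.K_null hkK hkK, h.symm w k]
    field_simp
    ring
  · simp [h.K_null hkK hkK, hw]

/-- A torsion class lies in the two submodules if and only if `[k, N] ⊂ N` algebraically. -/
lemma IsRobinson.mkQ_mem_iff (h : IsRobinson m g N K) (Γ : V →ₗ[ℝ] skewEnd g) :
    (stabilizerForms g N).mkQ Γ ∈ slash13 g N K (-2 * Complex.I) 1 ∩ slash21 m g N K ↔
      ∀ k ∈ K, PreservesAlong g N k Γ := by
  constructor
  -- The two submodules may be witnessed by different representatives of the class. They differ by a
  -- form with values in 𝔮, which changes Γ·κ by multiples of κ only; so γ and σ can be carried over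
  -- from Γ₂ to Γ₁.
  · rintro ⟨⟨Γ₁, h1, e1⟩, ⟨Γ₂, h2, e2⟩⟩
    obtain ⟨k, ℓ, s⟩ := h.exists_splitting
    rw [h.preservesAlong_iff s]
    have e1' : Γ - Γ₁ ∈ stabilizerForms g N := by
      rw [← Submodule.Quotient.eq]; exact e1.symm
    have e2' : Γ₂ - Γ₁ ∈ stabilizerForms g N := by
      rw [← Submodule.Quotient.eq]; exact e2.trans e1.symm
    rw [h.preservesAlong_congr s.mem e1', ← h.componentsVanish_dot s]
    obtain ⟨h1a, h1b⟩ := h1 k ℓ s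
    obtain ⟨h2a, h2b⟩ := h2 k ℓ s
    have hk : ∀ v w, w ∈ screen g k ℓ → dotKappa g k Γ₂ v w = dotKappa g k Γ₁ v w := by
      intro v w hw
      have e := h.K_eq_smul s (h.apply_mem_K (e2' v) s.mem)
      have : g (((Γ₂ - Γ₁) v : V →ₗ[ℝ] V) k) w = 0 := by
        rw [e, map_smul, LinearMap.smul_apply, (mem_screen.1 hw).1, smul_zero]
      simp only [LinearMap.sub_apply, Submodule.coe_sub, map_sub] at this
      rw [dotKappa_eq, dotKappa_eq]; linarith
    refine ⟨fun v hv => by rw [← hk k v hv]; exact h2b v hv, fun a b c d hab hcd => ?_,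
      fun a b c d hab hcd => ?_⟩
    · have := h2a a b c d hab hcd
      rw [h.cext_shear _ hab hcd] at this ⊢
      simp only [cext, hk _ _ hab.left, hk _ _ hab.right, hk _ _ hcd.left, hk _ _ hcd.right]
        at this
      exact this
    · have := h1a a b c d hab hcd
      linear_combination this
  · intro H
    have H' : ∀ k ℓ, IsSplitting g K k ℓ →
        ComponentsVanish m g N k ℓ (dotKappa g k Γ) (dotRho g N k ℓ Γ) :=
      fun k ℓ s => (h.componentsVanish_dot s Γ).2 (H k s.mem)
    refine ⟨⟨Γ, fun k ℓ s => ⟨fun a b c d hab hcd => ?_, fun v hv => ?_⟩, rfl⟩,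
      ⟨Γ, fun k ℓ s => ⟨(H' k ℓ s).2.1, (H' k ℓ s).1⟩, rfl⟩⟩
    -- At [z : w] = [-2i : 1] the relation zτ + wζ = 0 is ζ = 2iτ.
    · rw [(H' k ℓ s).2.2 a b c d hab hcd]; ring
    · rw [(H' k ℓ s).1 v hv]; simp

end Components

end Robinson

/-! ### The Levi-Civita connection from the Koszul formula. -/

namespace Robinson
variable {n : ℕ} {M : Type*} [TopologicalSpace M] [ChartedSpace (EuclideanSpace ℝ (Fin n)) M]
  [IsManifold (𝓡 n) ∞ M] {x : M}

instance : FiniteDimensional ℝ (TangentSpace (𝓡 n) x) :=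
  inferInstanceAs (FiniteDimensional ℝ (EuclideanSpace ℝ (Fin n)))

namespace LorentzMetric

variable (g : LorentzMetric n M)

lemma form_apply (v w : TangentSpace (𝓡 n) x) : g.form x v w = g.val x v w := rfl

/-- Such a v is orthogonal to a timelike t, so it would be spacelike if nonzero, although g(v, v) =
0. -/
lemma eq_zero_of_forall {v : TangentSpace (𝓡 n) x} (h : ∀ w, g.val x v w = 0) : v = 0 := by
  obtain ⟨t, -, ht⟩ := g.lorentzian x
  by_contra hv
  have := ht v hv (by rw [g.symm]; exact h t)
  rw [h v] at this
  exact lt_irrefl _ this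

lemma mdifferentiableAt_pair {X Y : VField n M} (hX : DiffAt X x) (hY : DiffAt Y x) :
    MDifferentiableAt (𝓡 n) 𝓘(ℝ) (g.pair X Y) x := by
  have hg : MDifferentiableAt (𝓡 n)
    ((𝓡 n).prod 𝓘(ℝ, EuclideanSpace ℝ (Fin n) →L[ℝ] EuclideanSpace ℝ (Fin n) →L[ℝ] ℝ))
    (fun x => Bundle.TotalSpace.mk'
      (EuclideanSpace ℝ (Fin n) →L[ℝ] EuclideanSpace ℝ (Fin n) →L[ℝ] ℝ)
      (E := fun x : M => TangentSpace (𝓡 n) x →L[ℝ] TangentSpace (𝓡 n) x →L[ℝ] ℝ) x (g.val x)) x :=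
    (g.contMDiff x).mdifferentiableAt (by simp)
  have := MDifferentiableAt.clm_bundle_apply₂ (F₁ := EuclideanSpace ℝ (Fin n))
    (F₂ := EuclideanSpace ℝ (Fin n)) (F₃ := ℝ) (E₃ := fun _ : M => ℝ) hg hX hY
  rw [mdifferentiableAt_section] at this
  exact this

lemma contMDiffAt_pair {X Y : VField n M}
    (hX : ContMDiffAt (𝓡 n) (𝓡 n).tangent ∞ (fun x => (⟨x, X x⟩ : TangentBundle (𝓡 n) M)) x)
    (hY : ContMDiffAt (𝓡 n) (𝓡 n).tangent ∞ (fun x => (⟨x, Y x⟩ : TangentBundle (𝓡 n) M)) x) :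
    ContMDiffAt (𝓡 n) 𝓘(ℝ) ∞ (g.pair X Y) x := by
  have := ContMDiffAt.clm_bundle_apply₂ (F₁ := EuclideanSpace ℝ (Fin n))
    (F₂ := EuclideanSpace ℝ (Fin n)) (F₃ := ℝ) (E₃ := fun _ : M => ℝ) (g.contMDiff x) hX hY
  rw [Bundle.contMDiffAt_section] at this
  exact this

lemma pair_smul_left (f : M → ℝ) (X Y : VField n M) : g.pair (f • X) Y = f * g.pair X Y := by
  ext y; simp [pair]

lemma pair_smul_right (f : M → ℝ) (X Y : VField n M) : g.pair X (f • Y) = f * g.pair X Y := by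
  ext y; simp [pair]

lemma pair_add_left (X X' Y : VField n M) : g.pair (X + X') Y = g.pair X Y + g.pair X' Y := by
  ext y; simp [pair]

lemma pair_add_right (X Y Y' : VField n M) : g.pair X (Y + Y') = g.pair X Y + g.pair X Y' := by
  ext y; simp [pair]

lemma pair_comm (X Y : VField n M) : g.pair X Y = g.pair Y X := by
  ext y; exact g.symm _ _ _

/-- The terms with the derivative of f that come from functions cancel those that come from
brackets. So the right hand side depends only on values at the point, which makes the defining
property of `nabla` satisfiable. -/
lemma tensorialAt_koszul_left {Y Z : VField n M} (hY : DiffAt Y x) (hZ : DiffAt Z x) :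
    TensorialAt (𝓡 n) (EuclideanSpace ℝ (Fin n)) (fun X : VField n M => g.koszul X Y Z x) x where
  smul {f X} hf hX := by
    have h1 := g.mdifferentiableAt_pair hZ hX
    have h2 := g.mdifferentiableAt_pair hX hY
    simp only [koszul, pair_smul_left, pair_smul_right, mvfderiv_mul hf h1, mvfderiv_mul hf h2,
      VectorField.mlieBracket_smul_left hf hX]
    simp [pair, g.symm x (Z x) (X x)]
    ring
  add {X X'} hX hX' := by
    simp only [koszul, pair_add_left, pair_add_right,
      mvfderiv_add (g.mdifferentiableAt_pair hZ hX) (g.mdifferentiableAt_pair hZ hX'),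
      mvfderiv_add (g.mdifferentiableAt_pair hX hY) (g.mdifferentiableAt_pair hX' hY),
      VectorField.mlieBracket_add_left hX hX']
    simp
    ring

lemma tensorialAt_koszul_right {X Y : VField n M} (hX : DiffAt X x) (hY : DiffAt Y x) :
    TensorialAt (𝓡 n) (EuclideanSpace ℝ (Fin n)) (fun Z : VField n M => g.koszul X Y Z x) x where
  smul {f Z} hf hZ := by
    have h1 := g.mdifferentiableAt_pair hY hZ
    have h2 := g.mdifferentiableAt_pair hZ hX
    simp only [koszul, pair_smul_left, pair_smul_right, mvfderiv_mul hf h1, mvfderiv_mul hf h2,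
      VectorField.mlieBracket_smul_right hf hZ]
    simp [pair, g.symm x (Z x) (X x), g.symm x (Z x) (Y x)]
    ring
  add {Z Z'} hZ hZ' := by
    simp only [koszul, pair_add_left, pair_add_right,
      mvfderiv_add (g.mdifferentiableAt_pair hY hZ) (g.mdifferentiableAt_pair hY hZ'),
      mvfderiv_add (g.mdifferentiableAt_pair hZ hX) (g.mdifferentiableAt_pair hZ' hX),
      VectorField.mlieBracket_add_right hZ hZ']
    simp
    ring

lemma diffAt_extend (v : TangentSpace (𝓡 n) x) :
    DiffAt (FiberBundle.extend (EuclideanSpace ℝ (Fin n)) v : VField n M) x :=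
  FiberBundle.mdifferentiableAt_extend ..

lemma extend_self (v : TangentSpace (𝓡 n) x) :
    (FiberBundle.extend (EuclideanSpace ℝ (Fin n)) v : VField n M) x = v := by simp

lemma exists_dual (c : TangentSpace (𝓡 n) x →ₗ[ℝ] ℝ) :
    ∃ u : TangentSpace (𝓡 n) x, ∀ w, g.val x u w = c w := by
  have hnd : (g.form x).Nondegenerate :=
    ⟨fun v hv => g.eq_zero_of_forall hv,
      fun v hv => g.eq_zero_of_forall fun w => by rw [g.symm]; exact hv w⟩
  refine ⟨((g.form x).toDual hnd).symm c, fun w => ?_⟩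
  exact LinearMap.BilinForm.apply_toDual_symm_apply (hB := hnd) c w

lemma nabla_spec {X Y Z : VField n M} (hY : DiffAt Y x) (hX : DiffAt X x) (hZ : DiffAt Z x) :
    2 * g.val x (g.nabla Y x (X x)) (Z x) = g.koszul X Y Z x := by
  refine Classical.epsilon_spec (p := fun u => ∀ X' Z : VField n M, DiffAt X' x → DiffAt Z x →
    X' x = X x → 2 * g.val x u (Z x) = g.koszul X' Y Z x) ?_ X Z hX hZ rfl
  let Φ := TensorialAt.mkHom₂ (fun X Z : VField n M => g.koszul X Y Z x) x
    (fun Z hZ => g.tensorialAt_koszul_left hY hZ) (fun X hX => g.tensorialAt_koszul_right hX hY)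
  obtain ⟨u, hu⟩ := g.exists_dual (Φ (X x)).toLinearMap
  refine ⟨(1 / 2 : ℝ) • u, fun X' Z hX' hZ h => ?_⟩
  have := hu (Z x)
  rw [← h] at this
  rw [map_smul, smul_apply, this]
  have e := TensorialAt.mkHom₂_apply (fun Z hZ => g.tensorialAt_koszul_left hY hZ)
    (fun X hX => g.tensorialAt_koszul_right hX hY) hX' hZ
  simp only [ContinuousLinearMap.coe_coe, smul_eq_mul]
  rw [← e]
  ring

lemma eq_of_forall {u v : TangentSpace (𝓡 n) x}
    (h : ∀ Z : VField n M, DiffAt Z x → g.val x u (Z x) = g.val x v (Z x)) : u = v := by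
  rw [← sub_eq_zero]
  refine g.eq_zero_of_forall fun w => ?_
  have := h _ (diffAt_extend w)
  rw [extend_self] at this
  simp [this]

/-- Metric compatibility: in the sum of the Koszul formulas for (X, Y, Z) and (X, Z, Y) everything
cancels except the derivative along X. -/
lemma mvfderiv_pair {Y Z : VField n M} (hY : DiffAt Y x) (hZ : DiffAt Z x)
    (v : TangentSpace (𝓡 n) x) :
    mvfderiv (𝓡 n) (g.pair Y Z) x v
      = g.val x (g.nabla Y x v) (Z x) + g.val x (Y x) (g.nabla Z x v) := by
  have hX := diffAt_extend v
  have h1 := g.nabla_spec hY hX hZ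
  have h2 := g.nabla_spec hZ hX hY
  rw [extend_self] at h1 h2
  rw [g.symm x (Y x)]
  simp only [koszul, extend_self] at h1 h2
  rw [g.pair_comm Z (FiberBundle.extend _ v)] at h1
  rw [g.pair_comm Z Y, VectorField.mlieBracket_swap_apply (V := Z),
    g.pair_comm Y (FiberBundle.extend _ v)] at h2
  simp only [map_neg, neg_apply] at h2
  linarith

/-- Torsion-freeness: in the difference of the Koszul formulas for (X, Y, Z) and (Y, X, Z) only the
bracket survives. -/
lemma mlieBracket_eq {X Y : VField n M} (hX : DiffAt X x) (hY : DiffAt Y x) :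
    VectorField.mlieBracket (𝓡 n) X Y x = g.nabla Y x (X x) - g.nabla X x (Y x) := by
  refine g.eq_of_forall fun Z hZ => ?_
  have h1 := g.nabla_spec hY hX hZ
  have h2 := g.nabla_spec hX hY hZ
  simp only [koszul] at h1 h2
  rw [g.pair_comm X Z, g.pair_comm Y X, VectorField.mlieBracket_swap_apply (V := Y) (W := X)] at h2
  rw [g.pair_comm Z X] at h1 h2
  rw [g.pair_comm Z Y] at h2
  simp only [map_neg, map_sub, sub_apply,
    neg_apply] at h1 h2 ⊢
  linarith

lemma nabla_add_right {Y : VField n M} (hY : DiffAt Y x) (v w : TangentSpace (𝓡 n) x) :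
    g.nabla Y x (v + w) = g.nabla Y x v + g.nabla Y x w := by
  refine g.eq_of_forall fun Z hZ => ?_
  have h1 := g.mvfderiv_pair hY hZ v
  have h2 := g.nabla_spec hY (diffAt_extend v) hZ
  have h3 := g.nabla_spec hY (diffAt_extend w) hZ
  have h4 := g.nabla_spec hY (mdifferentiableAt_add_section (diffAt_extend v) (diffAt_extend w)) hZ
  have := (g.tensorialAt_koszul_left hY hZ).add (diffAt_extend v) (diffAt_extend w)
  simp only [Pi.add_apply, extend_self] at h2 h3 h4
  simp only [map_add, add_apply]
  linarith

lemma nabla_smul_right {Y : VField n M} (hY : DiffAt Y x) (c : ℝ) (v : TangentSpace (𝓡 n) x) :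
    g.nabla Y x (c • v) = c • g.nabla Y x v := by
  refine g.eq_of_forall fun Z hZ => ?_
  have hc : MDifferentiableAt (𝓡 n) 𝓘(ℝ) (fun _ : M => c) x := mdifferentiableAt_const
  have h2 := g.nabla_spec hY (diffAt_extend v) hZ
  have h4 := g.nabla_spec hY (hc.smul_section (diffAt_extend v)) hZ
  have := (g.tensorialAt_koszul_left hY hZ).smul hc (diffAt_extend v)
  simp only [Pi.smul_apply', extend_self] at h2 h4
  simp only [map_smul, smul_apply, smul_eq_mul] at this ⊢
  have e : 2 * g.val x (g.nabla Y x (c • v)) (Z x) = c * (2 * g.val x (g.nabla Y x v) (Z x)) := by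
    rw [h2, ← this, ← h4]
  linarith

/-- A linear endomorphism of a tangent space as a continuous linear map. -/
def _root_.Robinson.toCLM (f : TangentSpace (𝓡 n) x →ₗ[ℝ] TangentSpace (𝓡 n) x) :
    TangentSpace (𝓡 n) x →L[ℝ] TangentSpace (𝓡 n) x :=
  ⟨f, (fun f => f.continuous_of_finiteDimensional :
    ∀ f : EuclideanSpace ℝ (Fin n) →ₗ[ℝ] EuclideanSpace ℝ (Fin n), Continuous f) f⟩

open scoped Classical in
/-- The Levi-Civita connection in the form used by the library. -/
def cov (g : LorentzMetric n M) (Y : VField n M) (x : M) :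
    TangentSpace (𝓡 n) x →L[ℝ] TangentSpace (𝓡 n) x :=
  if hY : DiffAt Y x then
    toCLM
      { toFun := g.nabla Y x
        map_add' := g.nabla_add_right hY
        map_smul' := g.nabla_smul_right hY }
  else 0

lemma cov_apply {Y : VField n M} (hY : DiffAt Y x) (v : TangentSpace (𝓡 n) x) :
    g.cov Y x v = g.nabla Y x v := by
  rw [cov, dif_pos hY]; rfl

/-- Additivity and the Leibniz rule are read off from metric compatibility by testing against all Z.
This form allows the difference with another connection to be treated as a tensor. -/
lemma isCovariantDerivativeOn_cov :
    IsCovariantDerivativeOn (EuclideanSpace ℝ (Fin n)) (V := fun x : M => TangentSpace (𝓡 n) x) (I := 𝓡 n) g.cov Set.univ where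
  add {Y Y' x} hY hY' _ := by
    ext1 v
    have hs : DiffAt (Y + Y') x := mdifferentiableAt_add_section hY hY'
    rw [add_apply, g.cov_apply hY, g.cov_apply hY', g.cov_apply hs]
    refine g.eq_of_forall fun Z hZ => ?_
    have h1 := g.mvfderiv_pair hY hZ v
    have h2 := g.mvfderiv_pair hY' hZ v
    have h3 := g.mvfderiv_pair hs hZ v
    rw [pair_add_left, mvfderiv_add (g.mdifferentiableAt_pair hY hZ)
      (g.mdifferentiableAt_pair hY' hZ), add_apply] at h3
    simp only [Pi.add_apply, map_add, add_apply] at h3 ⊢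
    linarith
  leibniz {Y f x} hY hf _ := by
    ext1 v
    have hs : DiffAt (f • Y) x := hf.smul_section hY
    rw [add_apply, smul_apply, g.cov_apply hY,
      g.cov_apply hs]
    refine g.eq_of_forall fun Z hZ => ?_
    have h1 := g.mvfderiv_pair hY hZ v
    have h3 := g.mvfderiv_pair hs hZ v
    rw [pair_smul_left, mvfderiv_mul hf (g.mdifferentiableAt_pair hY hZ)] at h3
    simp only [Pi.smul_apply', map_smul, map_add, add_apply,
      smul_apply, ContinuousLinearMap.smulRight_apply, smul_eq_mul, h1,
      pair] at h3 ⊢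
    linarith

end LorentzMetric
end Robinson

/-! ### Local frames and regularity of their coefficients. -/

namespace Robinson

section Frames

variable {n : ℕ} {M : Type*} [TopologicalSpace M] [ChartedSpace (EuclideanSpace ℝ (Fin n)) M]
  [IsManifold (𝓡 n) ∞ M] {x : M}

/-- The vector field `X` is smooth at `x`. -/
abbrev SmoothAt (X : VField n M) (x : M) : Prop :=
  ContMDiffAt (𝓡 n) (𝓡 n).tangent ∞ (fun x => (⟨x, X x⟩ : TangentBundle (𝓡 n) M)) x

lemma SmoothOn.smoothAt {U : Set M} {X : VField n M} (h : SmoothOn U X) (hU : IsOpen U)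
    (hx : x ∈ U) : SmoothAt X x := h.contMDiffAt (hU.mem_nhds hx)

lemma SmoothAt.diffAt {X : VField n M} (h : SmoothAt X x) : DiffAt X x :=
  ContMDiffAt.mdifferentiableAt h (by simp)

lemma SmoothOn.diffAt {U : Set M} {X : VField n M} (h : SmoothOn U X) (hU : IsOpen U)
    (hx : x ∈ U) : DiffAt X x := (h.smoothAt hU hx).diffAt

lemma SmoothOn.mono {U U' : Set M} {X : VField n M} (h : SmoothOn U X) (hU : U' ⊆ U) :
    SmoothOn U' X := ContMDiffOn.mono h hU

/-- The vector `v` at `y` read in the trivialization around `x`. -/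
def triv (x y : M) (v : TangentSpace (𝓡 n) y) : EuclideanSpace ℝ (Fin n) :=
  (trivializationAt (EuclideanSpace ℝ (Fin n)) (TangentSpace (𝓡 n)) x
    (⟨y, v⟩ : TangentBundle (𝓡 n) M)).2

lemma diffAt_iff {X : VField n M} :
    DiffAt X x ↔ MDifferentiableAt (𝓡 n) 𝓘(ℝ, EuclideanSpace ℝ (Fin n))
      (fun y => triv x y (X y)) x :=
  mdifferentiableAt_section _ _

lemma smoothAt_iff {X : VField n M} :
    SmoothAt X x ↔ ContMDiffAt (𝓡 n) 𝓘(ℝ, EuclideanSpace ℝ (Fin n)) ∞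
      (fun y => triv x y (X y)) x :=
  Bundle.contMDiffAt_section _

lemma eventually_triv (x : M) : ∀ᶠ y in 𝓝 x, ∃ φ : TangentSpace (𝓡 n) y ≃ₗ[ℝ]
    EuclideanSpace ℝ (Fin n), ∀ v, triv x y v = φ v := by
  have h := (trivializationAt (EuclideanSpace ℝ (Fin n)) (TangentSpace (𝓡 n) (M := M))
    x).open_baseSet.mem_nhds (FiberBundle.mem_baseSet_trivializationAt' x)
  filter_upwards [h] with y hy
  exact ⟨(trivializationAt (EuclideanSpace ℝ (Fin n)) (TangentSpace (𝓡 n) (M := M))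
    x).linearEquivAt ℝ y hy, fun v => rfl⟩

variable {ι : Type*} [Fintype ι]

/-- A family of vector fields that is a basis at `x` has a dual family of smooth covector fields
near `x`. -/
lemma exists_dualFrame {e : ι → VField n M} (he : ∀ i, SmoothAt (e i) x)
    (hli : LinearIndependent ℝ (fun i => e i x)) (hcard : Fintype.card ι = n) :
    ∃ c : ι → M → (EuclideanSpace ℝ (Fin n) →L[ℝ] ℝ),
      (∀ i, ContMDiffAt (𝓡 n) 𝓘(ℝ, EuclideanSpace ℝ (Fin n) →L[ℝ] ℝ) ∞ (c i) x) ∧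
      ∀ᶠ y in 𝓝 x, ∀ (a : ι → ℝ) i, c i y (triv x y (∑ j, a j • e j y)) = a i := by
  obtain ⟨φ, hφ⟩ := (eventually_triv (n := n) x).self_of_nhds
  have hli' : LinearIndependent ℝ (fun i => φ (e i x)) :=
    hli.map' φ.toLinearMap (LinearMap.ker_eq_bot.2 φ.injective)
  let b : Module.Basis ι ℝ (EuclideanSpace ℝ (Fin n)) := by
    refine Module.Basis.mk hli' (le_of_eq ?_)
    exact (hli'.span_eq_top_of_card_eq_finrank' (by rw [hcard]; simp)).symm
  have hb : ∀ i, b i = φ (e i x) := fun i => Module.Basis.mk_apply _ _ i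
  -- T y carries the frame at x to the frame at y, read in the trivialization. It is the identity at
  -- x, so it is invertible with smooth inverse nearby, and the dual frame consists of the
  -- coordinates of that inverse.
  let T : M → (EuclideanSpace ℝ (Fin n) →L[ℝ] EuclideanSpace ℝ (Fin n)) := fun y =>
    ∑ i, (LinearMap.toContinuousLinearMap (b.coord i)).smulRight (triv x y (e i y))
  have hTb : ∀ y i, T y (b i) = triv x y (e i y) := by
    classical
    intro y i
    simp [T, Finsupp.single_apply]
  have hTx : T x = 1 := by
    refine ContinuousLinearMap.coe_injective (b.ext fun i => ?_)
    change T x (b i) = b i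
    rw [hTb, hb, hφ]
  have hT : ContMDiffAt (𝓡 n) 𝓘(ℝ, EuclideanSpace ℝ (Fin n) →L[ℝ] EuclideanSpace ℝ (Fin n)) ∞
      T x := by
    refine ContMDiffAt.sum fun i _ => ?_
    have h1 := smoothAt_iff.1 (he i)
    exact ((ContinuousLinearMap.smulRightL ℝ (EuclideanSpace ℝ (Fin n))
      (EuclideanSpace ℝ (Fin n)) (LinearMap.toContinuousLinearMap (b.coord i))).contDiff.contMDiff
      |>.contMDiffAt).comp x h1
  have hinv : ContMDiffAt (𝓡 n) 𝓘(ℝ, EuclideanSpace ℝ (Fin n) →L[ℝ] EuclideanSpace ℝ (Fin n)) ∞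
      (fun y => Ring.inverse (T y)) x := by
    have := contDiffAt_ringInverse ℝ (n := ∞)
      (1 : (EuclideanSpace ℝ (Fin n) →L[ℝ] EuclideanSpace ℝ (Fin n))ˣ)
    rw [Units.val_one, ← hTx] at this
    exact this.contMDiffAt.comp x hT
  have hunit : ∀ᶠ y in 𝓝 x, IsUnit (T y) := by
    have : {A : EuclideanSpace ℝ (Fin n) →L[ℝ] EuclideanSpace ℝ (Fin n) | IsUnit A} ∈ 𝓝 (T x) :=
      Units.isOpen.mem_nhds (by rw [hTx]; exact isUnit_one)
    exact hT.continuousAt this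
  refine ⟨fun i y => (LinearMap.toContinuousLinearMap (b.coord i)) ∘L Ring.inverse (T y),
    fun i => ?_, ?_⟩
  · exact ((ContinuousLinearMap.compL ℝ (EuclideanSpace ℝ (Fin n)) (EuclideanSpace ℝ (Fin n)) ℝ
      (LinearMap.toContinuousLinearMap (b.coord i))).contDiff.contMDiff.contMDiffAt).comp x hinv
  · filter_upwards [hunit, eventually_triv (n := n) x] with y hy hψ a i
    obtain ⟨ψ, hψ⟩ := hψ
    have h1 : triv x y (∑ j, a j • e j y) = T y (∑ j, a j • b j) := by
      rw [hψ, map_sum, map_sum]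
      refine Finset.sum_congr rfl fun j _ => ?_
      rw [map_smul, map_smul, hTb, hψ]
    have h2 : Ring.inverse (T y) (T y (∑ j, a j • b j)) = ∑ j, a j • b j := by
      rw [← mul_apply_eq_comp, Ring.inverse_mul_cancel _ hy]; rfl
    rw [h1, ContinuousLinearMap.comp_apply, h2]
    classical
    simp [Finsupp.single_apply]

/-- Independence persists near the point because the dual covectors recover the coefficients of any
linear combination. -/
lemma exists_isLocalFrameOn {U : Set M} (hU : IsOpen U) (hx : x ∈ U) {e : ι → VField n M}
    (he : ∀ i, SmoothOn U (e i)) (hli : LinearIndependent ℝ (fun i => e i x))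
    (hcard : Fintype.card ι = n) :
    ∃ U' ⊆ U, IsOpen U' ∧ x ∈ U' ∧
      IsLocalFrameOn (𝓡 n) (EuclideanSpace ℝ (Fin n)) ∞ e U' := by
  obtain ⟨c, -, hc⟩ := exists_dualFrame (fun i => (he i).smoothAt hU hx) hli hcard
  obtain ⟨O, hO, hOo, hxO⟩ := eventually_nhds_iff.1 hc
  have key : ∀ y ∈ O, LinearIndependent ℝ (fun i => e i y) := by
    intro y hy
    rw [Fintype.linearIndependent_iff]
    intro a ha i
    have h1 := hO y hy a i
    have h2 := hO y hy 0 i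
    rw [ha] at h1
    simp only [Pi.zero_apply, zero_smul, Finset.sum_const_zero] at h2
    rw [← h1, h2]
  refine ⟨U ∩ O, Set.inter_subset_left, hU.inter hOo, ⟨hx, hxO⟩, fun hy => key _ hy.2,
    fun hy => ?_, fun i => (he i).mono Set.inter_subset_left⟩
  refine ((key _ hy.2).span_eq_top_of_card_eq_finrank' ?_).ge
  rw [hcard]
  exact (finrank_euclideanSpace_fin (𝕜 := ℝ)).symm

section coeff

variable {e : ι → VField n M} {U : Set M}
  (hs : IsLocalFrameOn (𝓡 n) (EuclideanSpace ℝ (Fin n)) ∞ e U)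

include hs in
lemma card_of_frame (hx : x ∈ U) : Fintype.card ι = n := by
  have := Module.finrank_eq_card_basis (hs.toBasisAt hx)
  rw [← this]
  exact finrank_euclideanSpace_fin (𝕜 := ℝ)

/-- One smooth covector field serves for all Y at once, so the coefficients of Y inherit both mere
differentiability and smoothness from Y. -/
lemma exists_eventually_coeff (hU : IsOpen U) (hx : x ∈ U) (i : ι) :
    ∃ c : M → (EuclideanSpace ℝ (Fin n) →L[ℝ] ℝ),
      ContMDiffAt (𝓡 n) 𝓘(ℝ, EuclideanSpace ℝ (Fin n) →L[ℝ] ℝ) ∞ c x ∧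
      ∀ Y : VField n M, ∀ᶠ y in 𝓝 x, hs.coeff i y (Y y) = c y (triv x y (Y y)) := by
  obtain ⟨c, h1, h2⟩ := exists_dualFrame (fun i => hs.contMDiffAt hU hx i)
    (hs.linearIndependent hx) (card_of_frame hs hx)
  refine ⟨c i, h1 i, fun Y => ?_⟩
  filter_upwards [h2, hU.mem_nhds hx] with y hy hyU
  have := hy (fun j => hs.coeff j y (Y y)) i
  rw [← hs.coeff_sum_eq Y hyU] at this
  exact this.symm

lemma mdifferentiableAt_coeff (hU : IsOpen U) (hx : x ∈ U) (i : ι) {Y : VField n M}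
    (hY : DiffAt Y x) :
    MDifferentiableAt (𝓡 n) 𝓘(ℝ) (fun y => hs.coeff i y (Y y)) x := by
  obtain ⟨c, h1, h2⟩ := exists_eventually_coeff hs hU hx i
  refine MDifferentiableAt.congr_of_eventuallyEq ?_ (h2 Y)
  exact (h1.mdifferentiableAt (by simp)).clm_apply (diffAt_iff.1 hY)

lemma contMDiffAt_coeff (hU : IsOpen U) (hx : x ∈ U) (i : ι) {Y : VField n M}
    (hY : SmoothAt Y x) :
    ContMDiffAt (𝓡 n) 𝓘(ℝ) ∞ (fun y => hs.coeff i y (Y y)) x := by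
  obtain ⟨c, h1, h2⟩ := exists_eventually_coeff hs hU hx i
  refine ContMDiffAt.congr_of_eventuallyEq ?_ (h2 Y)
  exact h1.clm_apply (smoothAt_iff.1 hY)

lemma coeff_sum (hx : x ∈ U) (a : ι → ℝ) (i : ι) :
    hs.coeff i x (∑ j, a j • e j x) = a i := by
  classical
  have : ∀ j, hs.coeff i x (e j x) = if j = i then 1 else 0 := fun j => by
    rw [hs.coeff_apply_of_mem hx, ← hs.toBasisAt_coe hx j, Module.Basis.repr_self,
      Finsupp.single_apply]
  simp [map_sum, this]

end coeff

end Frames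

end Robinson

/-! ### Existence of smooth splittings, adapted frames and sections of N. -/

namespace Robinson

lemma cvec_sum {V ι : Type*} [AddCommGroup V] [Module ℝ V] (s : Finset ι) (a b : ι → V) :
    ∑ i ∈ s, cvec (a i) (b i) = cvec (∑ i ∈ s, a i) (∑ i ∈ s, b i) := by
  classical
  induction s using Finset.induction_on with
  | empty => simp
  | insert i s hi ih => rw [Finset.sum_insert hi, Finset.sum_insert hi, Finset.sum_insert hi, ih,
      cvec_add]

section Smooth

variable {n : ℕ} {M : Type*} [TopologicalSpace M] [ChartedSpace (EuclideanSpace ℝ (Fin n)) M]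
  [IsManifold (𝓡 n) ∞ M] {x : M} {U : Set M} {X Y : VField n M} {f : M → ℝ}

lemma smoothOn_of_smoothAt (h : ∀ y ∈ U, SmoothAt X y) : SmoothOn U X :=
  fun y hy => (h y hy).contMDiffWithinAt

lemma SmoothAt.smul (hf : ContMDiffAt (𝓡 n) 𝓘(ℝ) ∞ f x) (hX : SmoothAt X x) :
    SmoothAt (fun y => f y • X y) x := ContMDiffAt.smul_section hf hX

lemma SmoothAt.const_smul (c : ℝ) (hX : SmoothAt X x) :
    SmoothAt (fun y => c • X y) x := SmoothAt.smul contMDiffAt_const hX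

lemma SmoothAt.add (hX : SmoothAt X x) (hY : SmoothAt Y x) :
    SmoothAt (fun y => X y + Y y) x := ContMDiffAt.add_section hX hY

lemma SmoothAt.sub (hX : SmoothAt X x) (hY : SmoothAt Y x) :
    SmoothAt (fun y => X y - Y y) x := ContMDiffAt.sub_section hX hY

lemma SmoothAt.sum {ι : Type*} {s : Finset ι} {F : ι → VField n M}
    (h : ∀ i ∈ s, SmoothAt (F i) x) : SmoothAt (fun y => ∑ i ∈ s, F i y) x :=
  ContMDiffAt.sum_section h

lemma exists_smoothOn_extend (v : TangentSpace (𝓡 n) x) :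
    ∃ U : Set M, IsOpen U ∧ x ∈ U ∧ ∃ X : VField n M, SmoothOn U X ∧ X x = v := by
  obtain ⟨s, hs, h⟩ := FiberBundle.exists_contMDiffOn_extend (k := ∞) (𝓡 n)
    (EuclideanSpace ℝ (Fin n)) (V := TangentSpace (𝓡 n) (M := M)) v
  obtain ⟨U, hUs, hU, hx⟩ := mem_nhds_iff.1 hs
  exact ⟨U, hU, hx, _, h.mono hUs, by simp⟩

end Smooth

namespace AlmostRobinson

variable {m : ℕ} {M : Type*} [TopologicalSpace M]
  [ChartedSpace (EuclideanSpace ℝ (Fin (2 * m + 2))) M] [IsManifold (𝓡 (2 * m + 2)) ∞ M]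
  {g : LorentzMetric (2 * m + 2) M} (R : AlmostRobinson g) {x : M} {U : Set M}
  {k ℓ : VField (2 * m + 2) M}

lemma isRobinson (x : M) : IsRobinson m (g.form x) (R.N x) (R.K x) where
  finrank_eq := finrank_euclideanSpace_fin (𝕜 := ℝ)
  finrank_N := by
    obtain ⟨U, hU, hx, A, B, -, -, h⟩ := R.N_frame x
    rw [← (h x hx).2, finrank_span_eq_card (h x hx).1, Fintype.card_fin]
  symm := g.symm x
  nondeg v hv := g.eq_zero_of_forall hv
  null := R.N_null x
  mem_K v := by
    have h1 := R.K_eq x (cvec v 0)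
    rw [cvec_mem_baseChange, conj_cvec, neg_zero, and_self_iff] at h1
    simpa using h1
  K_span := by
    obtain ⟨U, hU, hx, k, -, h⟩ := R.K_frame x
    exact ⟨k x, h x hx⟩

lemma exists_isSplittingOn (x : M) :
    ∃ U : Set M, IsOpen U ∧ x ∈ U ∧ ∃ k ℓ, R.IsSplittingOn U k ℓ := by
  obtain ⟨U, hU, hx, k, hk, hkK⟩ := R.K_frame x
  obtain ⟨w, hw⟩ : ∃ w, g.val x (k x) w ≠ 0 := by
    by_contra! H
    exact (hkK x hx).1 (g.eq_zero_of_forall H)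
  obtain ⟨U', hU', hx', u, hu, rfl⟩ := exists_smoothOn_extend w
  have hsm : ∀ y ∈ U ∩ U', SmoothAt k y ∧ SmoothAt u y := fun y hy =>
    ⟨hk.smoothAt hU hy.1, hu.smoothAt hU' hy.2⟩
  have hcont : ContinuousOn (g.pair k u) (U ∩ U') := fun y hy =>
    (g.contMDiffAt_pair (hsm y hy).1 (hsm y hy).2).continuousAt.continuousWithinAt
  -- The pointwise formula for ℓ is smooth on the open set where the transverse field u pairs
  -- nontrivially with k.
  refine ⟨(U ∩ U') ∩ g.pair k u ⁻¹' {0}ᶜ,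
    hcont.isOpen_inter_preimage (hU.inter hU') isOpen_compl_singleton, ⟨⟨hx, hx'⟩, hw⟩, k,
    fun y => (g.pair k u y)⁻¹ • u y - (g.pair u u y / (2 * g.pair k u y ^ 2)) • k y,
    hk.mono fun y hy => hy.1.1, ?_, ?_⟩
  · refine smoothOn_of_smoothAt fun y hy => ?_
    obtain ⟨h1, h2⟩ := hsm y hy.1
    have h3 := g.contMDiffAt_pair h1 h2
    have h4 := g.contMDiffAt_pair h2 h2
    have hne : g.pair k u y ≠ 0 := hy.2
    refine SmoothAt.sub (SmoothAt.smul (h3.inv₀ hne) h2) (SmoothAt.smul ?_ h1)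
    exact h4.div₀ (contMDiffAt_const.mul (h3.pow 2)) (by positivity)
  · intro y hy
    have hkK := (hkK y hy.1.1).2
    have hk : k y ∈ R.K y := hkK ▸ Submodule.mem_span_singleton_self _
    have h0 := (R.isRobinson y).K_null hk hk
    rw [g.form_apply] at h0
    have hne : g.val y (k y) (u y) ≠ 0 := hy.2
    refine ⟨hk, ?_, ?_⟩
    · rw [g.form_apply]
      simp only [LorentzMetric.pair, map_sub, map_smul, sub_apply,
        smul_apply, smul_eq_mul, h0, g.symm y (u y) (k y)]
      field_simp
      ring
    · simp only [g.form_apply, LorentzMetric.pair, map_sub, map_smul, smul_eq_mul, h0]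
      field_simp
      ring

/-- The family `A_1, …, A_m, B_1, …, B_m, k, ℓ`. -/
abbrev frameFamily (k ℓ : VField (2 * m + 2) M) (A B : Fin m → VField (2 * m + 2) M) :
    Fin m ⊕ Fin m ⊕ Unit ⊕ Unit → VField (2 * m + 2) M :=
  Sum.elim A (Sum.elim B (Sum.elim (fun _ => k) (fun _ => ℓ)))

/-- A local frame `A_j, B_j, k, ℓ` where `k, ℓ` is a splitting and `A_j + i B_j` is a frame of
`N ∩ ℂ H_{K,L}`. -/
structure AdaptedFrame (U : Set M) (k ℓ : VField (2 * m + 2) M)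
    (A B : Fin m → VField (2 * m + 2) M) : Prop where
  isOpen : IsOpen U
  splitting : R.IsSplittingOn U k ℓ
  mem_A : ∀ x ∈ U, ∀ j, A j x ∈ screen (g.form x) (k x) (ℓ x)
  mem_B : ∀ x ∈ U, ∀ j, B j x ∈ screen (g.form x) (k x) (ℓ x)
  mem_N : ∀ x ∈ U, ∀ j, cvec (A j x) (B j x) ∈ R.N x
  frame : IsLocalFrameOn (𝓡 (2 * m + 2)) (EuclideanSpace ℝ (Fin (2 * m + 2))) ∞
    (frameFamily k ℓ A B) U

/-- From a frame of N one member is exchanged for k, and the K-components of the others are removed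
so that they lie in the complexified screen space. Their real and imaginary parts, with k and ℓ,
form the frame. -/
lemma exists_adaptedFrame (hU : IsOpen U) (s : R.IsSplittingOn U k ℓ) (hx : x ∈ U) :
    ∃ U' ⊆ U, x ∈ U' ∧ ∃ A B, R.AdaptedFrame U' k ℓ A B := by
  obtain ⟨U₁, hU₁, hx₁, A₀, B₀, hA₀, hB₀, hN⟩ := R.N_frame x
  have hs := s.2.2 x hx
  have hmem : ∀ y ∈ U₁, ∀ j, cvec (A₀ j y) (B₀ j y) ∈ R.N y := fun y hy j =>
    (hN y hy).2 ▸ Submodule.subset_span ⟨j, rfl⟩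
  have hkN : cvec (k x) 0 ∈ R.N x := ((R.isRobinson x).mem_K _).1 hs.mem
  have hkN' := hkN
  rw [← (hN x hx₁).2, Submodule.mem_span_range_iff_exists_fun] at hkN'
  obtain ⟨c, hc⟩ := hkN'
  -- The member j₀ occurs with nonzero coefficient in k at x, so it can be replaced by k.
  obtain ⟨j₀, hj₀⟩ : ∃ j, c j ≠ 0 := by
    by_contra! H
    simp only [H, zero_smul, Finset.sum_const_zero] at hc
    rw [← cvec_zero, cvec_inj] at hc
    have := hs.pairing
    rw [← hc.1] at this
    simp at this
  let A : Fin m → VField (2 * m + 2) M := fun j y =>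
    A₀ (j₀.succAbove j) y - g.pair ℓ (A₀ (j₀.succAbove j)) y • k y
  let B : Fin m → VField (2 * m + 2) M := fun j y =>
    B₀ (j₀.succAbove j) y - g.pair ℓ (B₀ (j₀.succAbove j)) y • k y
  have hscr : ∀ y ∈ U ∩ U₁, ∀ w, g.val y (k y) w = 0 →
      w - g.val y (ℓ y) w • k y ∈ screen (g.form y) (k y) (ℓ y) := by
    intro y hy w hw
    have hs := s.2.2 y hy.1
    have h0 := (R.isRobinson y).K_null hs.mem hs.mem
    have h1 := hs.pairing
    rw [g.form_apply] at h0 h1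
    rw [mem_screen]
    simp only [g.form_apply, map_sub, map_smul, hw, h0, g.symm y (ℓ y) (k y), h1]
    simp
  have hgA : ∀ y ∈ U ∩ U₁, ∀ j, g.val y (k y) (A₀ j y) = 0 := fun y hy j =>
    (R.isRobinson y).orthogonal_left (s.2.2 y hy.1).mem (hmem y hy.2 j)
  have hgB : ∀ y ∈ U ∩ U₁, ∀ j, g.val y (k y) (B₀ j y) = 0 := fun y hy j =>
    (R.isRobinson y).orthogonal_right (s.2.2 y hy.1).mem (hmem y hy.2 j)
  have hsm : ∀ i, SmoothOn (U ∩ U₁) (frameFamily k ℓ A B i) := by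
    intro i
    refine smoothOn_of_smoothAt fun y hy => ?_
    have hk := s.1.smoothAt hU hy.1
    have hl := s.2.1.smoothAt hU hy.1
    have hA := fun j => (hA₀ j).smoothAt hU₁ hy.2
    have hB := fun j => (hB₀ j).smoothAt hU₁ hy.2
    rcases i with i | i | i | i
    · exact (hA _).sub (SmoothAt.smul (g.contMDiffAt_pair hl (hA _)) hk)
    · exact (hB _).sub (SmoothAt.smul (g.contMDiffAt_pair hl (hB _)) hk)
    · exact hk
    · exact hl
  have hcard : Fintype.card (Fin m ⊕ Fin m ⊕ Unit ⊕ Unit) = 2 * m + 2 := by simp; omega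
  -- The number of fields is 2m + 2, so spanning is enough. The complexified span S contains N;
  -- hence S contains Re N = K^⊥, and ℓ supplies the missing direction.
  have hli : LinearIndependent ℝ (fun i => frameFamily k ℓ A B i x) := by
    refine linearIndependent_of_top_le_span_of_card_eq_finrank ?_
      (by rw [hcard]; exact (finrank_euclideanSpace_fin (𝕜 := ℝ)).symm)
    set S := Submodule.span ℝ (Set.range fun i => frameFamily k ℓ A B i x) with hS
    have hfS : ∀ i, frameFamily k ℓ A B i x ∈ S := fun i => Submodule.subset_span ⟨i, rfl⟩
    have hkS : k x ∈ S := hfS (Sum.inr (Sum.inr (Sum.inl ())))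
    have hlS : ℓ x ∈ S := hfS (Sum.inr (Sum.inr (Sum.inr ())))
    have hAS : ∀ j, A₀ (j₀.succAbove j) x ∈ S := fun j => by
      have := S.add_mem (hfS (Sum.inl j))
        (S.smul_mem (g.pair ℓ (A₀ (j₀.succAbove j)) x) hkS)
      simpa [A] using this
    have hBS : ∀ j, B₀ (j₀.succAbove j) x ∈ S := fun j => by
      have := S.add_mem (hfS (Sum.inr (Sum.inl j)))
        (S.smul_mem (g.pair ℓ (B₀ (j₀.succAbove j)) x) hkS)
      simpa [B] using this
    have hZ : ∀ j, cvec (A₀ (j₀.succAbove j) x) (B₀ (j₀.succAbove j) x) ∈ S.baseChange ℂ :=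
      fun j => (cvec_mem_baseChange _ _ _).2 ⟨hAS j, hBS j⟩
    have hZ₀ : cvec (A₀ j₀ x) (B₀ j₀ x) ∈ S.baseChange ℂ := by
      rw [Fin.sum_univ_succAbove _ j₀] at hc
      have e : cvec (A₀ j₀ x) (B₀ j₀ x) = (c j₀)⁻¹ • (cvec (k x) 0 -
          ∑ i, c (j₀.succAbove i) • cvec (A₀ (j₀.succAbove i) x) (B₀ (j₀.succAbove i) x)) := by
        rw [← hc, add_sub_cancel_right, smul_smul, inv_mul_cancel₀ hj₀, one_smul]
      rw [e]
      exact Submodule.smul_mem _ _ (Submodule.sub_mem _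
        ((cvec_mem_baseChange _ _ _).2 ⟨hkS, S.zero_mem⟩)
        (Submodule.sum_mem _ fun i _ => Submodule.smul_mem _ _ (hZ i)))
    have hNS : R.N x ≤ S.baseChange ℂ := by
      rw [← (hN x hx₁).2, Submodule.span_le]
      rintro _ ⟨j, rfl⟩
      rcases Fin.eq_self_or_eq_succAbove j₀ j with rfl | ⟨i, rfl⟩
      · exact hZ₀
      · exact hZ i
    intro v _
    have hv : g.form x (k x) (v - g.val x (k x) v • ℓ x) = 0 := by
      rw [map_sub, map_smul, hs.pairing, g.form_apply]; simp
    obtain ⟨v', hv'⟩ := (R.isRobinson x).exists_im (((R.isRobinson x).perp_iff hs).2 hv)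
    have := S.add_mem ((cvec_mem_baseChange _ _ _).1 (hNS hv')).1
      (S.smul_mem (g.val x (k x) v) hlS)
    simpa using this
  obtain ⟨U', hU'U, hU', hxU', hfr⟩ := exists_isLocalFrameOn (hU.inter hU₁) ⟨hx, hx₁⟩ hsm hli hcard
  refine ⟨U', fun y hy => (hU'U hy).1, hxU', A, B, hU', ⟨s.1.mono fun y hy => (hU'U hy).1,
    s.2.1.mono fun y hy => (hU'U hy).1, fun y hy => s.2.2 y (hU'U hy).1⟩, fun y hy j => ?_,
    fun y hy j => ?_, fun y hy j => ?_, hfr⟩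
  · exact hscr y (hU'U hy) _ (hgA y (hU'U hy) _)
  · exact hscr y (hU'U hy) _ (hgB y (hU'U hy) _)
  · exact (R.isRobinson y).sub_smul_mem (s.2.2 y (hU'U hy).1) (hmem y (hU'U hy).2 _) _ _

lemma exists_adaptedFrame_at (x : M) :
    ∃ U k ℓ A B, x ∈ U ∧ R.AdaptedFrame U k ℓ A B := by
  obtain ⟨U, hU, hx, k, ℓ, s⟩ := R.exists_isSplittingOn x
  obtain ⟨U', -, hx', A, B, h⟩ := R.exists_adaptedFrame hU s hx
  exact ⟨U', k, ℓ, A, B, hx', h⟩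

/-- Constant complex coefficients in a local frame of N extend a given element to a section. -/
lemma exists_isSection {a b : TangentSpace (𝓡 (2 * m + 2)) x} (h : cvec a b ∈ R.N x) :
    ∃ U : Set M, IsOpen U ∧ x ∈ U ∧ ∃ X Y, R.IsSection U X Y ∧ X x = a ∧ Y x = b := by
  obtain ⟨U, hU, hx, A, B, hA, hB, hN⟩ := R.N_frame x
  rw [← (hN x hx).2, Submodule.mem_span_range_iff_exists_fun] at h
  obtain ⟨c, hc⟩ := h
  have key : ∀ y, ∑ j, c j • cvec (A j y) (B j y) = cvec
      (∑ j, ((c j).re • A j y - (c j).im • B j y)) (∑ j, ((c j).im • A j y + (c j).re • B j y)) :=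
    fun y => by rw [← cvec_sum]; simp only [smul_cvec]
  rw [key, cvec_inj] at hc
  refine ⟨U, hU, hx, fun y => ∑ j, ((c j).re • A j y - (c j).im • B j y),
    fun y => ∑ j, ((c j).im • A j y + (c j).re • B j y), ⟨?_, ?_, fun y hy => ?_⟩, hc.1, hc.2⟩
  · refine smoothOn_of_smoothAt fun y hy => SmoothAt.sum fun j _ => ?_
    exact (((hA j).smoothAt hU hy).const_smul _).sub (((hB j).smoothAt hU hy).const_smul _)
  · refine smoothOn_of_smoothAt fun y hy => SmoothAt.sum fun j _ => ?_
    exact (((hA j).smoothAt hU hy).const_smul _).add (((hB j).smoothAt hU hy).const_smul _)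
  · rw [← key]
    exact Submodule.sum_mem _ fun j _ => Submodule.smul_mem _ _
      ((hN y hy).2 ▸ Submodule.subset_span ⟨j, rfl⟩)

end AlmostRobinson

end Robinson

/-! ### Coordinates in an adapted frame. -/

namespace Robinson

namespace AlmostRobinson

variable {m : ℕ} {M : Type*} [TopologicalSpace M]
  [ChartedSpace (EuclideanSpace ℝ (Fin (2 * m + 2))) M] [IsManifold (𝓡 (2 * m + 2)) ∞ M]
  {g : LorentzMetric (2 * m + 2) M} {R : AlmostRobinson g} {x : M} {U : Set M}
  {k ℓ : VField (2 * m + 2) M} {A B : Fin m → VField (2 * m + 2) M}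

namespace AdaptedFrame

/-- The coefficient of `A_j`. -/
def coA (F : R.AdaptedFrame U k ℓ A B) (j : Fin m) (x : M) :
    TangentSpace (𝓡 (2 * m + 2)) x →ₗ[ℝ] ℝ := F.frame.coeff (Sum.inl j) x

/-- The coefficient of `B_j`. -/
def coB (F : R.AdaptedFrame U k ℓ A B) (j : Fin m) (x : M) :
    TangentSpace (𝓡 (2 * m + 2)) x →ₗ[ℝ] ℝ := F.frame.coeff (Sum.inr (Sum.inl j)) x

variable (F : R.AdaptedFrame U k ℓ A B)
include F

lemma isSplitting (hx : x ∈ U) : IsSplitting (g.form x) (R.K x) (k x) (ℓ x) :=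
  F.splitting.2.2 x hx

omit [IsManifold (𝓡 (2 * m + 2)) ∞ M] F in
lemma sum_eq (c : Fin m ⊕ Fin m ⊕ Unit ⊕ Unit → ℝ) :
    ∑ i, c i • frameFamily k ℓ A B i x
      = ∑ j, (c (Sum.inl j) • A j x + c (Sum.inr (Sum.inl j)) • B j x)
        + (c (Sum.inr (Sum.inr (Sum.inl ()))) • k x
          + c (Sum.inr (Sum.inr (Sum.inr ()))) • ℓ x) := by
  simp [Finset.sum_add_distrib, add_assoc]

lemma pairing_comb (hx : x ∈ U) (α β : Fin m → ℝ) (s t : ℝ) :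
    g.val x (k x) (∑ j, (α j • A j x + β j • B j x) + (s • k x + t • ℓ x)) = t ∧
      g.val x (ℓ x) (∑ j, (α j • A j x + β j • B j x) + (s • k x + t • ℓ x)) = s := by
  have hs := F.isSplitting hx
  have hA := fun j => mem_screen.1 (F.mem_A x hx j)
  have hB := fun j => mem_screen.1 (F.mem_B x hx j)
  have h1 := (R.isRobinson x).K_null hs.mem hs.mem
  have h2 := hs.null
  have h3 := hs.pairing
  simp only [g.form_apply] at hA hB h1 h2 h3
  have h4 : g.val x (ℓ x) (k x) = 1 := by rw [g.symm]; exact h3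
  simp [map_sum, hA, hB, h1, h2, h3, h4]

lemma coA_comb (hx : x ∈ U) (α β : Fin m → ℝ) (s t : ℝ) (j : Fin m) :
    F.coA j x (∑ j, (α j • A j x + β j • B j x) + (s • k x + t • ℓ x)) = α j := by
  have := coeff_sum F.frame hx (Sum.elim α (Sum.elim β (Sum.elim (fun _ => s) fun _ => t)))
    (Sum.inl j)
  rwa [sum_eq] at this

lemma coB_comb (hx : x ∈ U) (α β : Fin m → ℝ) (s t : ℝ) (j : Fin m) :
    F.coB j x (∑ j, (α j • A j x + β j • B j x) + (s • k x + t • ℓ x)) = β j := by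
  have := coeff_sum F.frame hx (Sum.elim α (Sum.elim β (Sum.elim (fun _ => s) fun _ => t)))
    (Sum.inr (Sum.inl j))
  rwa [sum_eq] at this

lemma expand (hx : x ∈ U) (v : TangentSpace (𝓡 (2 * m + 2)) x) :
    v = ∑ j, (F.coA j x v • A j x + F.coB j x v • B j x)
      + (g.val x (ℓ x) v • k x + g.val x (k x) v • ℓ x) := by
  have h := F.frame.coeff_sum_eq (FiberBundle.extend (EuclideanSpace ℝ (Fin (2 * m + 2))) v) hx
  rw [sum_eq, FiberBundle.extend_apply_self] at h
  obtain ⟨h1, h2⟩ := F.pairing_comb hx (fun j => F.coA j x v) (fun j => F.coB j x v)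
    (F.frame.coeff (Sum.inr (Sum.inr (Sum.inl ()))) x v)
    (F.frame.coeff (Sum.inr (Sum.inr (Sum.inr ()))) x v)
  have h' : v = ∑ j, (F.coA j x v • A j x + F.coB j x v • B j x)
    + (F.frame.coeff (Sum.inr (Sum.inr (Sum.inl ()))) x v • k x
      + F.frame.coeff (Sum.inr (Sum.inr (Sum.inr ()))) x v • ℓ x) := h
  rw [← h'] at h1 h2
  rw [h1, h2]
  exact h'

lemma diffAt_A (hx : x ∈ U) (j : Fin m) : DiffAt (A j) x :=
  SmoothAt.diffAt (F.frame.contMDiffAt F.isOpen hx (Sum.inl j))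

lemma diffAt_B (hx : x ∈ U) (j : Fin m) : DiffAt (B j) x :=
  SmoothAt.diffAt (F.frame.contMDiffAt F.isOpen hx (Sum.inr (Sum.inl j)))

lemma Jmap_A (hx : x ∈ U) (j : Fin m) :
    (R.isRobinson x).Jmap (F.isSplitting hx) (A j x) = B j x :=
  (R.isRobinson x).Jmap_eq _ (F.mem_A x hx j) (F.mem_B x hx j) (F.mem_N x hx j)

lemma Jmap_B (hx : x ∈ U) (j : Fin m) :
    (R.isRobinson x).Jmap (F.isSplitting hx) (B j x) = -A j x := by
  refine (R.isRobinson x).Jmap_eq _ (F.mem_B x hx j) (Submodule.neg_mem _ (F.mem_A x hx j)) ?_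
  have := (R.N x).neg_mem (I_mem (F.mem_N x hx j))
  rwa [← zero_sub, ← cvec_zero, cvec_sub, sub_neg_eq_add, zero_add, zero_sub] at this

lemma Jmap_expand (hx : x ∈ U) (v : TangentSpace (𝓡 (2 * m + 2)) x) :
    (R.isRobinson x).Jmap (F.isSplitting hx) v
      = ∑ j, ((-F.coB j x v) • A j x + F.coA j x v • B j x) := by
  conv_lhs => rw [F.expand hx v]
  simp only [map_add, map_sum, map_smul, IsRobinson.Jmap_left, IsRobinson.Jmap_right, F.Jmap_A hx,
    F.Jmap_B hx, smul_zero, add_zero]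
  refine Finset.sum_congr rfl fun j _ => ?_
  module

/-- In an adapted frame the equations of N have constant coefficients: there is no ℓ-component, and
the coordinates of b are those of J a. This is why the flat connection of the frame preserves N. -/
lemma mem_N_iff (hx : x ∈ U) {a b : TangentSpace (𝓡 (2 * m + 2)) x} :
    cvec a b ∈ R.N x ↔ g.val x (k x) a = 0 ∧ g.val x (k x) b = 0 ∧
      ∀ j, F.coA j x b = -F.coB j x a ∧ F.coB j x b = F.coA j x a := by
  have h := R.isRobinson x
  have s := F.isSplitting hx
  constructor
  · intro hab
    have ha := h.orthogonal_left s.mem hab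
    have hb := h.orthogonal_right s.mem hab
    refine ⟨ha, hb, ?_⟩
    have e : b = ∑ j, ((-F.coB j x a) • A j x + F.coA j x a • B j x)
        + (g.val x (ℓ x) b • k x + (0 : ℝ) • ℓ x) := by
      rw [← F.Jmap_expand hx, h.Jmap_apply, h.screenJ_eq s (h.proj_mem s a) (h.proj_mem s b)
        (h.proj_mem_N s hab), proj, hb, g.form_apply]
      module
    intro j
    constructor
    · conv_lhs => rw [e]
      exact F.coA_comb hx _ _ _ _ j
    · conv_lhs => rw [e]
      exact F.coB_comb hx _ _ _ _ j
  · rintro ⟨ha, hb, hab⟩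
    -- With coordinates α, β of a, the identity used is (α - iβ)(A + iB) = αA + βB + i(αB - βA).
    have key : cvec a b = ∑ j, (⟨F.coA j x a, -F.coB j x a⟩ : ℂ) • cvec (A j x) (B j x)
        + (⟨g.val x (ℓ x) a, g.val x (ℓ x) b⟩ : ℂ) • cvec (k x) 0 := by
      simp only [smul_cvec]
      rw [cvec_sum, cvec_add, cvec_inj]
      constructor
      · conv_lhs => rw [F.expand hx a]
        simp [ha]
      · conv_lhs => rw [F.expand hx b]
        simp [hb, hab]
    rw [key]
    exact (R.N x).add_mem (Submodule.sum_mem _ fun j _ => Submodule.smul_mem _ _ (F.mem_N x hx j))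
      (Submodule.smul_mem _ _ ((h.mem_K _).1 s.mem))

end AdaptedFrame

end AlmostRobinson

end Robinson

/-! ### A connection that preserves g and N. -/

namespace Robinson

section MetricConnection

variable {n : ℕ} {M : Type*} [TopologicalSpace M] [ChartedSpace (EuclideanSpace ℝ (Fin n)) M]
  [IsManifold (𝓡 n) ∞ M] {x : M} {ι : Type*} [Fintype ι] {e : ι → VField n M} {U : Set M}

omit [IsManifold (𝓡 n) ∞ M] in
lemma mvfderiv_congr {F : Type*} [NormedAddCommGroup F] [NormedSpace ℝ F] {f f' : M → F}
    (h : f =ᶠ[𝓝 x] f') : mvfderiv (𝓡 n) f x = mvfderiv (𝓡 n) f' x := by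
  ext v
  simp only [mvfderiv, ContinuousLinearMap.comp_apply, h.mfderiv_eq]
  rfl

omit [IsManifold (𝓡 n) ∞ M] in
lemma mvfderiv_eq_of_eventuallyEq {F : Type*} [NormedAddCommGroup F] [NormedSpace ℝ F]
    {f f' : M → F} (h : f =ᶠ[𝓝 x] f') (v : TangentSpace (𝓡 n) x) :
    mvfderiv (𝓡 n) f x v = mvfderiv (𝓡 n) f' x v := by
  rw [mvfderiv_congr h]

omit [IsManifold (𝓡 n) ∞ M] in
lemma mvfderiv_sum {F : Type*} [NormedAddCommGroup F] [NormedSpace ℝ F] {κ : Type*} {s : Finset κ}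
    {f : κ → M → F} (h : ∀ i ∈ s, MDifferentiableAt (𝓡 n) 𝓘(ℝ, F) (f i) x) :
    mvfderiv (𝓡 n) (∑ i ∈ s, f i) x = ∑ i ∈ s, mvfderiv (𝓡 n) (f i) x := by
  classical
  suffices H : MDifferentiableAt (𝓡 n) 𝓘(ℝ, F) (∑ i ∈ s, f i) x ∧
    mvfderiv (𝓡 n) (∑ i ∈ s, f i) x = ∑ i ∈ s, mvfderiv (𝓡 n) (f i) x from H.2
  induction s using Finset.induction_on with
  | empty => exact ⟨by rw [Finset.sum_empty]; exact mdifferentiableAt_const, by simp⟩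
  | insert i s hi ih =>
    obtain ⟨h1, h2⟩ := ih fun j hj => h j (Finset.mem_insert_of_mem hj)
    have h3 := h i (Finset.mem_insert_self i s)
    rw [Finset.sum_insert hi, Finset.sum_insert hi, mvfderiv_add h3 h1, h2]
    exact ⟨h3.add h1, rfl⟩

namespace LorentzMetric

variable (g : LorentzMetric n M) (hs : IsLocalFrameOn (𝓡 n) (EuclideanSpace ℝ (Fin n)) ∞ e U)

/-- The frame `g`-dual to a local frame. -/
def dualFrame (i : ι) (x : M) : TangentSpace (𝓡 n) x :=
  Classical.choose (g.exists_dual (hs.coeff i x))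

omit [Fintype ι] in
lemma dualFrame_apply (i : ι) (x : M) (w : TangentSpace (𝓡 n) x) :
    g.val x (g.dualFrame hs i x) w = hs.coeff i x w :=
  Classical.choose_spec (g.exists_dual (hs.coeff i x)) w

/-- The average of the flat connection of a local frame and of its `g`-dual connection. -/
def frameConnection (Y : VField n M) (x : M) : TangentSpace (𝓡 n) x →L[ℝ] TangentSpace (𝓡 n) x :=
  (1 / 2 : ℝ) • (∑ i, (mvfderiv (𝓡 n) (fun y => hs.coeff i y (Y y)) x).smulRight (e i x)
    + ∑ i, (mvfderiv (𝓡 n) (g.pair Y (e i)) x).smulRight (g.dualFrame hs i x))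

lemma frameConnection_apply (Y : VField n M) (x : M) (v : TangentSpace (𝓡 n) x) :
    g.frameConnection hs Y x v
      = (1 / 2 : ℝ) • (∑ i, mvfderiv (𝓡 n) (fun y => hs.coeff i y (Y y)) x v • e i x
        + ∑ i, mvfderiv (𝓡 n) (g.pair Y (e i)) x v • g.dualFrame hs i x) := by
  simp [frameConnection]

variable {g}

omit [Fintype ι] in
lemma mvfderiv_pair_sum {Z : VField n M} (hZ : DiffAt Z x) (s : Finset ι) (he : ∀ i ∈ s, DiffAt (e i) x)
    (a : ι → ℝ) (v : TangentSpace (𝓡 n) x) :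
    mvfderiv (𝓡 n) (g.pair Z (fun y => ∑ i ∈ s, a i • e i y)) x v
      = ∑ i ∈ s, a i * mvfderiv (𝓡 n) (g.pair Z (e i)) x v := by
  have h1 : g.pair Z (fun y => ∑ i ∈ s, a i • e i y) = ∑ i ∈ s, (fun _ => a i) * g.pair Z (e i) := by
    ext y
    simp only [pair, map_sum, map_smul, smul_eq_mul, Finset.sum_apply, Pi.mul_apply]
  have h2 := fun i hi => g.mdifferentiableAt_pair hZ (he i hi)
  rw [h1, mvfderiv_sum (fun i hi => mdifferentiableAt_const.mul (h2 i hi)), sum_apply]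
  refine Finset.sum_congr rfl fun i hi => ?_
  rw [mvfderiv_mul mdifferentiableAt_const (h2 i hi), mvfderiv_const]
  simp

/-- The g-dual of the flat connection differentiates g(Z, W), where W is the constant-coefficient
extension of w. In this form its relation to N is visible. -/
lemma dualPart_apply (hU : IsOpen U) (hx : x ∈ U) {Z : VField n M} (hZ : DiffAt Z x)
    (v w : TangentSpace (𝓡 n) x) :
    g.val x (∑ i, mvfderiv (𝓡 n) (g.pair Z (e i)) x v • g.dualFrame hs i x) w
      = mvfderiv (𝓡 n) (g.pair Z (fun y => ∑ i, hs.coeff i x w • e i y)) x v := by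
  rw [mvfderiv_pair_sum hZ _ fun i _ => SmoothAt.diffAt (hs.contMDiffAt hU hx i)]
  simp only [map_sum, map_smul, sum_apply, smul_apply, smul_eq_mul, dualFrame_apply, mul_comm]

lemma sum_pair_dualFrame (hx : x ∈ U) (v : TangentSpace (𝓡 n) x) :
    ∑ i, g.val x v (e i x) • g.dualFrame hs i x = v := by
  rw [← sub_eq_zero]
  refine g.eq_zero_of_forall fun w => ?_
  have h := hs.coeff_sum_eq (FiberBundle.extend (EuclideanSpace ℝ (Fin n)) w) hx
  rw [FiberBundle.extend_apply_self] at h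
  have h2 : g.val x v w = ∑ i, hs.coeff i x w * g.val x v (e i x) := by
    conv_lhs => rw [h]
    simp [map_sum]
  simp only [map_sub, map_sum, map_smul, sub_apply, sum_apply, smul_apply, smul_eq_mul,
    dualFrame_apply, h2, mul_comm, sub_self]

lemma isCovariantDerivativeOn_frameConnection (hU : IsOpen U) :
    IsCovariantDerivativeOn (EuclideanSpace ℝ (Fin n)) (V := fun x : M => TangentSpace (𝓡 n) x)
      (I := 𝓡 n) (g.frameConnection hs) U where
  add {Y Y' x} hY hY' hx := by
    ext1 v
    rw [add_apply]
    simp only [frameConnection_apply, pair_add_left, Pi.add_apply, map_add]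
    have h1 : ∀ i, mvfderiv (𝓡 n) (fun y => hs.coeff i y (Y y) + hs.coeff i y (Y' y)) x
      = mvfderiv (𝓡 n) (fun y => hs.coeff i y (Y y)) x
        + mvfderiv (𝓡 n) (fun y => hs.coeff i y (Y' y)) x := fun i =>
      mvfderiv_add (mdifferentiableAt_coeff hs hU hx i hY) (mdifferentiableAt_coeff hs hU hx i hY')
    have h2 : ∀ i, mvfderiv (𝓡 n) (g.pair Y (e i) + g.pair Y' (e i)) x
      = mvfderiv (𝓡 n) (g.pair Y (e i)) x + mvfderiv (𝓡 n) (g.pair Y' (e i)) x := fun i =>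
      mvfderiv_add (g.mdifferentiableAt_pair hY (SmoothAt.diffAt (hs.contMDiffAt hU hx i)))
        (g.mdifferentiableAt_pair hY' (SmoothAt.diffAt (hs.contMDiffAt hU hx i)))
    simp only [h1, h2, add_apply, add_smul, Finset.sum_add_distrib]
    module
  leibniz {Y f x} hY hf hx := by
    ext1 v
    rw [add_apply, smul_apply, ContinuousLinearMap.smulRight_apply]
    simp only [frameConnection_apply, pair_smul_left]
    have h1 : ∀ i, mvfderiv (𝓡 n) (fun y => hs.coeff i y ((f • Y) y)) x v
      = f x * mvfderiv (𝓡 n) (fun y => hs.coeff i y (Y y)) x v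
        + hs.coeff i x (Y x) * mvfderiv (𝓡 n) f x v := fun i => by
      have := mvfderiv_mul (g := fun y => hs.coeff i y (Y y)) hf
        (mdifferentiableAt_coeff hs hU hx i hY)
      have e : (fun y => hs.coeff i y ((f • Y) y)) = f * fun y => hs.coeff i y (Y y) := by
        ext y; simp
      rw [e, this]
      simp
    have h2 : ∀ i, mvfderiv (𝓡 n) (f * g.pair Y (e i)) x v
      = f x * mvfderiv (𝓡 n) (g.pair Y (e i)) x v
        + g.pair Y (e i) x * mvfderiv (𝓡 n) f x v := fun i => by
      rw [mvfderiv_mul hf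
        (g.mdifferentiableAt_pair hY (SmoothAt.diffAt (hs.contMDiffAt hU hx i)))]
      simp
    have h3 := hs.coeff_sum_eq Y hx
    have h4 := sum_pair_dualFrame (g := g) hs hx (Y x)
    have h3' : ∑ i, (hs.coeff i x (Y x) * mvfderiv (𝓡 n) f x v) • e i x
        = mvfderiv (𝓡 n) f x v • Y x := by
      conv_rhs => rw [h3, Finset.smul_sum]
      exact Finset.sum_congr rfl fun i _ => by rw [smul_smul, mul_comm]
    have h4' : ∑ i, (g.pair Y (e i) x * mvfderiv (𝓡 n) f x v) • g.dualFrame hs i x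
        = mvfderiv (𝓡 n) f x v • Y x := by
      conv_rhs => rw [← h4, Finset.smul_sum]
      exact Finset.sum_congr rfl fun i _ => by rw [smul_smul, mul_comm]; rfl
    simp only [h1, h2, add_smul, Finset.sum_add_distrib, h3', h4']
    simp only [mul_smul, ← Finset.smul_sum]
    module

/-- For the flat connection and its g-dual one has v g(Y, Z) = g(D_v Y, Z) + g(Y, D*_v Z). Averaging
this with the version in which Y and Z are exchanged shows that (D + D*)/2 is metric. -/
lemma mvfderiv_pair_frameConnection (hU : IsOpen U) (hx : x ∈ U) {Y Z : VField n M}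
    (hY : DiffAt Y x) (hZ : DiffAt Z x) (v : TangentSpace (𝓡 n) x) :
    mvfderiv (𝓡 n) (g.pair Y Z) x v = g.val x (g.frameConnection hs Y x v) (Z x)
      + g.val x (Y x) (g.frameConnection hs Z x v) := by
  have key : ∀ {Y Z : VField n M}, DiffAt Y x → DiffAt Z x →
      mvfderiv (𝓡 n) (g.pair Y Z) x v
        = ∑ i, (mvfderiv (𝓡 n) (fun y => hs.coeff i y (Y y)) x v * g.val x (e i x) (Z x)
          + mvfderiv (𝓡 n) (g.pair Z (e i)) x v * hs.coeff i x (Y x)) := by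
    intro Y Z hY hZ
    have h1 : g.pair Y Z =ᶠ[𝓝 x] ∑ i, (fun y => hs.coeff i y (Y y)) * g.pair Z (e i) := by
      filter_upwards [hU.mem_nhds hx] with y hy
      rw [Finset.sum_apply]
      conv_lhs => rw [pair, hs.coeff_sum_eq Y hy]
      simp only [map_sum, map_smul, sum_apply, smul_apply, smul_eq_mul, Pi.mul_apply, pair,
        g.symm y (Z y)]
    have h2 : ∀ i, MDifferentiableAt (𝓡 n) 𝓘(ℝ) (fun y => hs.coeff i y (Y y)) x := fun i =>
      mdifferentiableAt_coeff hs hU hx i hY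
    have h3 : ∀ i, MDifferentiableAt (𝓡 n) 𝓘(ℝ) (g.pair Z (e i)) x := fun i =>
      g.mdifferentiableAt_pair hZ (SmoothAt.diffAt (hs.contMDiffAt hU hx i))
    rw [mvfderiv_congr h1, mvfderiv_sum (fun i _ => (h2 i).mul (h3 i)), sum_apply]
    refine Finset.sum_congr rfl fun i _ => ?_
    rw [mvfderiv_mul (h2 i) (h3 i)]
    simp [pair, g.symm x (Z x)]
    ring
  have h1 := key hY hZ
  have h2 := key hZ hY
  rw [pair_comm] at h2
  simp only [frameConnection_apply, map_smul, smul_apply, map_add, add_apply, map_sum, sum_apply,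
    smul_eq_mul, dualFrame_apply, g.symm x (Y x) (g.dualFrame hs _ _), g.symm x (Y x) (e _ x)]
  simp only [← Finset.sum_add_distrib] at h1 h2 ⊢
  rw [← mul_add, ← Finset.sum_add_distrib]
  have : ∀ a b c : ℝ, a = b → a = c → a = 1 / 2 * (b + c) := by intros; linarith
  have h3 := this _ _ _ h1 h2
  rw [← Finset.sum_add_distrib] at h3
  rw [h3]
  congr 1
  exact Finset.sum_congr rfl fun i _ => by ring

end LorentzMetric

end MetricConnection

namespace AlmostRobinson

variable {m : ℕ} {M : Type*} [TopologicalSpace M]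
  [ChartedSpace (EuclideanSpace ℝ (Fin (2 * m + 2))) M] [IsManifold (𝓡 (2 * m + 2)) ∞ M]
  {g : LorentzMetric (2 * m + 2) M} {R : AlmostRobinson g} {x : M} {U : Set M}
  {k ℓ : VField (2 * m + 2) M} {A B : Fin m → VField (2 * m + 2) M}

namespace AdaptedFrame

variable (F : R.AdaptedFrame U k ℓ A B)

lemma coeff_eq (hx : x ∈ U) (v : TangentSpace (𝓡 (2 * m + 2)) x) :
    F.frame.coeff (Sum.inr (Sum.inr (Sum.inl ()))) x v = g.val x (ℓ x) v ∧
    F.frame.coeff (Sum.inr (Sum.inr (Sum.inr ()))) x v = g.val x (k x) v := by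
  have h := F.expand hx v
  have h' := AdaptedFrame.sum_eq (x := x) (k := k) (ℓ := ℓ) (A := A) (B := B) (Sum.elim (F.coA · x v) (Sum.elim (F.coB · x v)
    (Sum.elim (fun _ => g.val x (ℓ x) v) fun _ => g.val x (k x) v)))
  simp only [Sum.elim_inl, Sum.elim_inr] at h'
  rw [← h] at h'
  have h1 := coeff_sum F.frame hx (Sum.elim (F.coA · x v) (Sum.elim (F.coB · x v)
    (Sum.elim (fun _ => g.val x (ℓ x) v) fun _ => g.val x (k x) v)))
  constructor
  · have := h1 (Sum.inr (Sum.inr (Sum.inl ())))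
    rw [h'] at this
    simpa using this
  · have := h1 (Sum.inr (Sum.inr (Sum.inr ())))
    rw [h'] at this
    simpa using this

/-- The equations of N have constant coefficients in the frame, so they can be differentiated. -/
lemma flatPart_mem {X Y : VField (2 * m + 2) M} (hx : x ∈ U)
    (hN : ∀ᶠ y in 𝓝 x, cvec (X y) (Y y) ∈ R.N y) (v : TangentSpace (𝓡 (2 * m + 2)) x) :
    cvec (∑ i, mvfderiv (𝓡 (2 * m + 2)) (fun y => F.frame.coeff i y (X y)) x v
        • frameFamily k ℓ A B i x)
      (∑ i, mvfderiv (𝓡 (2 * m + 2)) (fun y => F.frame.coeff i y (Y y)) x v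
        • frameFamily k ℓ A B i x) ∈ R.N x := by
  have hU := F.isOpen.mem_nhds hx
  have h0 : ∀ {f : M → ℝ}, (∀ᶠ y in 𝓝 x, f y = 0) → mvfderiv (𝓡 (2 * m + 2)) f x v = 0 := by
    intro f hf
    rw [mvfderiv_congr (f' := fun _ => (0 : ℝ)) hf, mvfderiv_const]; simp
  rw [F.mem_N_iff hx, AdaptedFrame.sum_eq, AdaptedFrame.sum_eq, (F.pairing_comb hx _ _ _ _).1,
    (F.pairing_comb hx _ _ _ _).1]
  refine ⟨h0 ?_, h0 ?_, fun j => ?_⟩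
  · filter_upwards [hN, hU] with y hy hyU
    rw [(F.coeff_eq hyU _).2]
    exact ((F.mem_N_iff hyU).1 hy).1
  · filter_upwards [hN, hU] with y hy hyU
    rw [(F.coeff_eq hyU _).2]
    exact ((F.mem_N_iff hyU).1 hy).2.1
  · rw [F.coA_comb hx, F.coB_comb hx, F.coA_comb hx, F.coB_comb hx]
    constructor
    · rw [← neg_apply, ← mvfderiv_neg]
      refine mvfderiv_eq_of_eventuallyEq ?_ v
      filter_upwards [hN, hU] with y hy hyU
      exact (((F.mem_N_iff hyU).1 hy).2.2 j).1
    · refine mvfderiv_eq_of_eventuallyEq ?_ v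
      filter_upwards [hN, hU] with y hy hyU
      exact (((F.mem_N_iff hyU).1 hy).2.2 j).2

/-- The vector field with constant coefficients in the frame. -/
def const (F : R.AdaptedFrame U k ℓ A B) (c : TangentSpace (𝓡 (2 * m + 2)) x) :
    VField (2 * m + 2) M := fun y => ∑ i, F.frame.coeff i x c • frameFamily k ℓ A B i y

lemma const_mem (hx : x ∈ U) {c d : TangentSpace (𝓡 (2 * m + 2)) x} (hcd : cvec c d ∈ R.N x)
    {y : M} (hy : y ∈ U) : cvec (F.const c y) (F.const d y) ∈ R.N y := by
  obtain ⟨h1, h2, h3⟩ := (F.mem_N_iff hx).1 hcd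
  rw [F.mem_N_iff hy]
  simp only [const]
  rw [AdaptedFrame.sum_eq, AdaptedFrame.sum_eq, (F.pairing_comb hy _ _ _ _).1, (F.pairing_comb hy _ _ _ _).1,
    (F.coeff_eq hx _).2, (F.coeff_eq hx _).2]
  refine ⟨h1, h2, fun j => ?_⟩
  rw [F.coA_comb hy, F.coB_comb hy, F.coA_comb hy, F.coB_comb hy]
  exact h3 j

/-- An element w of N extends with constant coefficients to a section of N, so g(z, w) vanishes
identically and so does its derivative. Thus the dual derivative of z is orthogonal to N, hence lies
in N. -/
lemma dualPart_mem {X Y : VField (2 * m + 2) M} (hx : x ∈ U) (hX : DiffAt X x)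
    (hY : DiffAt Y x) (hN : ∀ᶠ y in 𝓝 x, cvec (X y) (Y y) ∈ R.N y)
    (v : TangentSpace (𝓡 (2 * m + 2)) x) :
    cvec (∑ i, mvfderiv (𝓡 (2 * m + 2)) (g.pair X (frameFamily k ℓ A B i)) x v
        • g.dualFrame F.frame i x)
      (∑ i, mvfderiv (𝓡 (2 * m + 2)) (g.pair Y (frameFamily k ℓ A B i)) x v
        • g.dualFrame F.frame i x) ∈ R.N x := by
  refine (R.isRobinson x).mem_of_orthogonal fun c d hcd => ?_
  rw [g.form_apply, g.form_apply, LorentzMetric.dualPart_apply F.frame F.isOpen hx hX,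
    LorentzMetric.dualPart_apply F.frame F.isOpen hx hY]
  refine mvfderiv_eq_of_eventuallyEq ?_ v
  filter_upwards [hN, F.isOpen.mem_nhds hx] with y h1 hy
  exact (R.isRobinson y).null_re h1 (F.const_mem hx hcd hy)

lemma frameConnection_mem {X Y : VField (2 * m + 2) M} (hx : x ∈ U) (hX : DiffAt X x)
    (hY : DiffAt Y x) (hN : ∀ᶠ y in 𝓝 x, cvec (X y) (Y y) ∈ R.N y)
    (v : TangentSpace (𝓡 (2 * m + 2)) x) :
    cvec (g.frameConnection F.frame X x v) (g.frameConnection F.frame Y x v) ∈ R.N x := by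
  have := (R.N x).smul_mem (1 / 2 : ℂ)
    ((R.N x).add_mem (F.flatPart_mem hx hN v) (F.dualPart_mem hx hX hY hN v))
  rw [cvec_add, smul_cvec] at this
  rw [g.frameConnection_apply, g.frameConnection_apply]
  have e1 : (1 / 2 : ℂ).re = 1 / 2 := by norm_num
  have e2 : (1 / 2 : ℂ).im = 0 := by norm_num
  rwa [e1, e2, zero_smul, zero_smul, sub_zero, zero_add] at this

lemma isAdaptedConnection : R.IsAdaptedConnection U (g.frameConnection F.frame) where
  isOpen := F.isOpen
  isCov := LorentzMetric.isCovariantDerivativeOn_frameConnection F.frame F.isOpen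
  metric _ hx _ _ hY hZ v :=
    LorentzMetric.mvfderiv_pair_frameConnection F.frame F.isOpen hx hY hZ v
  preserves _ hx _ _ hX hY hN v := F.frameConnection_mem hx hX hY hN v

end AdaptedFrame

end AlmostRobinson

end Robinson

/-! ### Intrinsic torsion and the pointwise form of the nearly Robinson condition. -/

namespace Robinson

namespace AlmostRobinson

variable {m : ℕ} {M : Type*} [TopologicalSpace M]
  [ChartedSpace (EuclideanSpace ℝ (Fin (2 * m + 2))) M] [IsManifold (𝓡 (2 * m + 2)) ∞ M]
  {g : LorentzMetric (2 * m + 2) M} {R : AlmostRobinson g} {x : M} {U : Set M}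
  {k ℓ : VField (2 * m + 2) M} {A B : Fin m → VField (2 * m + 2) M}

variable (R) in
/-- `Γ` is the value at `x` of the difference of the Levi-Civita connection and an adapted
connection `D`. -/
def IsTorsionForm (U : Set M)
    (D : VField (2 * m + 2) M →
      ((x : M) → TangentSpace (𝓡 (2 * m + 2)) x →L[ℝ] TangentSpace (𝓡 (2 * m + 2)) x))
    (x : M) (Γ : TangentSpace (𝓡 (2 * m + 2)) x →ₗ[ℝ] skewEnd (g.form x)) : Prop :=
  x ∈ U ∧ R.IsAdaptedConnection U D ∧
  ∀ Y : VField (2 * m + 2) M, DiffAt Y x → ∀ v,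
    (Γ v : TangentSpace (𝓡 (2 * m + 2)) x →ₗ[ℝ] TangentSpace (𝓡 (2 * m + 2)) x) (Y x)
      = g.nabla Y x v - D Y x v

variable {D D' : VField (2 * m + 2) M →
      ((x : M) → TangentSpace (𝓡 (2 * m + 2)) x →L[ℝ] TangentSpace (𝓡 (2 * m + 2)) x)}
  {U' : Set M} {Γ Γ' : TangentSpace (𝓡 (2 * m + 2)) x →ₗ[ℝ] skewEnd (g.form x)}

/-- The difference of two connections is tensorial, and it is skew because both connections are
metric. -/
lemma IsAdaptedConnection.exists_isTorsionForm (hD : R.IsAdaptedConnection U D) (hx : x ∈ U) :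
    ∃ Γ, R.IsTorsionForm U D x Γ := by
  have hc := g.isCovariantDerivativeOn_cov.mono (Set.subset_univ U)
  let δ := hc.difference hD.isCov x
  have hδ : ∀ {Y : VField (2 * m + 2) M}, DiffAt Y x → ∀ v, δ (Y x) v = g.nabla Y x v - D Y x v := by
    intro Y hY v
    have := hc.difference_apply hD.isCov hx hY
    rw [← g.cov_apply hY]
    exact congrArg (fun q => q v) this
  let L : TangentSpace (𝓡 (2 * m + 2)) x → TangentSpace (𝓡 (2 * m + 2)) x →ₗ[ℝ]
      TangentSpace (𝓡 (2 * m + 2)) x := fun v =>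
    { toFun := fun y => δ y v
      map_add' := by simp
      map_smul' := by simp }
  have hL : ∀ v, L v ∈ skewEnd (g.form x) := by
    intro v y z
    have hY := LorentzMetric.diffAt_extend y
    have hZ := LorentzMetric.diffAt_extend z
    have h1 := hδ hY v
    have h2 := hδ hZ v
    have h3 := g.mvfderiv_pair hY hZ v
    have h4 := hD.metric x hx _ _ hY hZ v
    rw [LorentzMetric.extend_self] at h1 h2
    rw [LorentzMetric.extend_self, LorentzMetric.extend_self] at h3 h4
    change g.val x (δ y v) z + g.val x y (δ z v) = 0
    rw [h1, h2, map_sub, map_sub, sub_apply]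
    linarith
  exact ⟨{ toFun := fun v => ⟨L v, hL v⟩
           map_add' := fun v w => by ext y; simp [L]
           map_smul' := fun c v => by ext y; simp [L] }, hx, hD, fun Y hY v => hδ hY v⟩

/-- The Levi-Civita parts cancel, leaving D' - D. Evaluated on a local section of N through the
given element, each of the two connections stays in N. -/
lemma IsTorsionForm.sub_mem (h : R.IsTorsionForm U D x Γ) (h' : R.IsTorsionForm U' D' x Γ') :
    Γ - Γ' ∈ stabilizerForms (g.form x) (R.N x) := by
  intro v
  rw [mem_stabilizer]
  intro a b hab
  obtain ⟨W, hW, hxW, X, Y, ⟨hX, hY, hN⟩, rfl, rfl⟩ := R.exists_isSection hab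
  have dX := hX.diffAt hW hxW
  have dY := hY.diffAt hW hxW
  have hN' : ∀ᶠ y in 𝓝 x, cvec (X y) (Y y) ∈ R.N y := by
    filter_upwards [hW.mem_nhds hxW] with y hy using hN y hy
  have e1 := h.2.1.preserves x h.1 X Y dX dY hN' v
  have e2 := h'.2.1.preserves x h'.1 X Y dX dY hN' v
  have := (R.N x).sub_mem e2 e1
  rw [cvec_sub] at this
  simp only [LinearMap.sub_apply, Submodule.coe_sub, h.2.2 _ dX, h.2.2 _ dY, h'.2.2 _ dX,
    h'.2.2 _ dY]
  convert this using 2 <;> abel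

lemma IsTorsionForm.intrinsicTorsion_eq (h : R.IsTorsionForm U D x Γ) :
    R.intrinsicTorsion x = (stabilizerForms (g.form x) (R.N x)).mkQ Γ := by
  obtain ⟨U', D', Γ', h1, h2, h3, h4⟩ := Classical.epsilon_spec
    (p := fun t => ∃ U D Γ, x ∈ U ∧ R.IsAdaptedConnection U D ∧
      (∀ Y : VField (2 * m + 2) M, DiffAt Y x → ∀ v,
        (Γ v : TangentSpace (𝓡 (2 * m + 2)) x →ₗ[ℝ] TangentSpace (𝓡 (2 * m + 2)) x) (Y x)
          = g.nabla Y x v - D Y x v) ∧ t = (stabilizerForms (g.form x) (R.N x)).mkQ Γ)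
    ⟨_, U, D, Γ, h.1, h.2.1, h.2.2, rfl⟩
  have h' : R.IsTorsionForm U' D' x Γ' := ⟨h1, h2, h3⟩
  exact h4.trans ((Submodule.Quotient.eq _).2 (h'.sub_mem h))

variable (R) in
lemma exists_isTorsionForm (x : M) : ∃ U D Γ, R.IsTorsionForm U D x Γ := by
  obtain ⟨U, k, ℓ, A, B, hx, F⟩ := R.exists_adaptedFrame_at x
  obtain ⟨Γ, h⟩ := F.isAdaptedConnection.exists_isTorsionForm hx
  exact ⟨_, _, Γ, h⟩

variable (R) in
/-- The pointwise form of the condition `[K, N] ⊂ N`. -/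
def PreservesAlongAt (x : M) : Prop :=
  ∃ U D Γ, R.IsTorsionForm U D x Γ ∧ ∀ v ∈ R.K x, PreservesAlong (g.form x) (R.N x) v Γ

lemma IsTorsionForm.preservesAlongAt_iff (h : R.IsTorsionForm U D x Γ) :
    R.PreservesAlongAt x ↔ ∀ v ∈ R.K x, PreservesAlong (g.form x) (R.N x) v Γ := by
  refine ⟨?_, fun H => ⟨U, D, Γ, h, H⟩⟩
  rintro ⟨U', D', Γ', h', H⟩ v hv
  exact ((R.isRobinson x).preservesAlong_congr hv (h'.sub_mem h)).1 (H v hv)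

lemma torsionCondition_iff : R.TorsionCondition ↔ ∀ x, R.PreservesAlongAt x := by
  refine forall_congr' fun x => ?_
  obtain ⟨U, D, Γ, h⟩ := R.exists_isTorsionForm x
  rw [h.preservesAlongAt_iff, h.intrinsicTorsion_eq, (R.isRobinson x).mkQ_mem_iff]

/-- K is the set of real vectors in N, so preservation of N is applied to the section k + i0. -/
lemma IsAdaptedConnection.apply_mem_K (hD : R.IsAdaptedConnection U D) (hx : x ∈ U)
    (hk : DiffAt k x) (hK : ∀ᶠ y in 𝓝 x, k y ∈ R.K y) (v : TangentSpace (𝓡 (2 * m + 2)) x) :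
    D k x v ∈ R.K x := by
  have h0 : DiffAt (0 : VField (2 * m + 2) M) x := by
    have h : DiffAt (k - k) x := mdifferentiableAt_sub_section hk hk
    rwa [sub_self] at h
  have h1 := hD.preserves x hx k 0 hk h0 (hK.mono fun y hy => ((R.isRobinson y).mem_K _).1 hy) v
  rw [hD.isCov.zero hx] at h1
  exact ((R.isRobinson x).mem_K _).2 h1

/-- Torsion-freeness gives [k, z] = D_k z - D_z k + Γ_k z - Γ_z k, and the two D-terms lie in N. It
remains to test the Γ-terms against N, which is its own orthogonal complement. -/
lemma IsTorsionForm.bracket_mem_iff (h : R.IsTorsionForm U D x Γ) (hk : DiffAt k x)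
    (hK : ∀ᶠ y in 𝓝 x, k y ∈ R.K y) {X Y : VField (2 * m + 2) M} (hX : DiffAt X x)
    (hY : DiffAt Y x) (hN : ∀ᶠ y in 𝓝 x, cvec (X y) (Y y) ∈ R.N y) :
    cvec (VectorField.mlieBracket (𝓡 (2 * m + 2)) k X x)
      (VectorField.mlieBracket (𝓡 (2 * m + 2)) k Y x) ∈ R.N x ↔
    ∀ c d, cvec c d ∈ R.N x →
      g.form x ((Γ (k x) : _ →ₗ[ℝ] TangentSpace (𝓡 (2 * m + 2)) x) (X x)) c
        - g.form x ((Γ (k x) : _ →ₗ[ℝ] TangentSpace (𝓡 (2 * m + 2)) x) (Y x)) d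
      = g.form x ((Γ (X x) : _ →ₗ[ℝ] TangentSpace (𝓡 (2 * m + 2)) x) (k x)) c
        - g.form x ((Γ (Y x) : _ →ₗ[ℝ] TangentSpace (𝓡 (2 * m + 2)) x) (k x)) d := by
  have r := R.isRobinson x
  have key : ∀ c d, cvec c d ∈ R.N x →
      g.form x (VectorField.mlieBracket (𝓡 (2 * m + 2)) k X x) c
        - g.form x (VectorField.mlieBracket (𝓡 (2 * m + 2)) k Y x) d
      = g.form x ((Γ (k x) : _ →ₗ[ℝ] TangentSpace (𝓡 (2 * m + 2)) x) (X x)) c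
        - g.form x ((Γ (k x) : _ →ₗ[ℝ] TangentSpace (𝓡 (2 * m + 2)) x) (Y x)) d
      - (g.form x ((Γ (X x) : _ →ₗ[ℝ] TangentSpace (𝓡 (2 * m + 2)) x) (k x)) c
        - g.form x ((Γ (Y x) : _ →ₗ[ℝ] TangentSpace (𝓡 (2 * m + 2)) x) (k x)) d) := by
    intro c d hcd
    have e1 := r.null_re (h.2.1.preserves x h.1 X Y hX hY hN (k x)) hcd
    have e2 := r.orthogonal_left (h.2.1.apply_mem_K h.1 hk hK (X x)) hcd
    have e3 := r.orthogonal_right (h.2.1.apply_mem_K h.1 hk hK (Y x)) hcd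
    rw [g.mlieBracket_eq hk hX, g.mlieBracket_eq hk hY, h.2.2 _ hX, h.2.2 _ hY, h.2.2 _ hk,
      h.2.2 _ hk]
    simp only [map_sub, LinearMap.sub_apply]
    linarith
  constructor
  · intro H c d hcd
    have := key c d hcd
    rw [r.null_re H hcd] at this
    linarith
  · intro H
    refine r.mem_of_orthogonal fun c d hcd => ?_
    have := key c d hcd
    have := H c d hcd
    linarith

lemma nearlyRobinson_iff : R.NearlyRobinson ↔ ∀ x, R.PreservesAlongAt x := by
  constructor
  · intro H x
    obtain ⟨U, k, ℓ, A, B, hx, F⟩ := R.exists_adaptedFrame_at x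
    obtain ⟨V, D, Γ, h⟩ := R.exists_isTorsionForm x
    rw [h.preservesAlongAt_iff, (R.isRobinson x).preservesAlong_iff (F.isSplitting hx)]
    intro a b c d hab hcd
    obtain ⟨W, hW, hxW, X, Y, ⟨hX, hY, hN⟩, rfl, rfl⟩ := R.exists_isSection hab
    have hk := F.splitting.1
    have hKx : ∀ y ∈ U, k y ∈ R.K y := fun y hy => (F.isSplitting hy).mem
    have hUW := (F.isOpen.inter hW)
    refine (h.bracket_mem_iff (hk.diffAt F.isOpen hx)
      (Filter.eventually_of_mem (F.isOpen.mem_nhds hx) hKx) (hX.diffAt hW hxW) (hY.diffAt hW hxW)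
      (Filter.eventually_of_mem (hW.mem_nhds hxW) hN)).1 ?_ c d hcd
    exact H (U ∩ W) k X Y hUW ⟨hk.mono Set.inter_subset_left, fun y hy => hKx y hy.1⟩
      ⟨hX.mono Set.inter_subset_right, hY.mono Set.inter_subset_right, fun y hy => hN y hy.2⟩
      x ⟨hx, hxW⟩
  · intro H U k X Y hU ⟨hk, hK⟩ ⟨hX, hY, hN⟩ x hx
    obtain ⟨V, D, Γ, h, hP⟩ := H x
    exact (h.bracket_mem_iff (hk.diffAt hU hx) (Filter.eventually_of_mem (hU.mem_nhds hx) hK)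
      (hX.diffAt hU hx) (hY.diffAt hU hx) (Filter.eventually_of_mem (hU.mem_nhds hx) hN)).2
      fun c d hcd => hP _ (hK x hx) _ _ _ _ (hN x hx) hcd

end AlmostRobinson

end Robinson

/-! ### Components of ∇κ and ∇ρ in a local splitting. -/

namespace Robinson

namespace AlmostRobinson

variable {m : ℕ} {M : Type*} [TopologicalSpace M]
  [ChartedSpace (EuclideanSpace ℝ (Fin (2 * m + 2))) M] [IsManifold (𝓡 (2 * m + 2)) ∞ M]
  {g : LorentzMetric (2 * m + 2) M} {R : AlmostRobinson g} {x : M} {U U' : Set M}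
  {k ℓ : VField (2 * m + 2) M} {A B : Fin m → VField (2 * m + 2) M}
  {D : VField (2 * m + 2) M →
      ((x : M) → TangentSpace (𝓡 (2 * m + 2)) x →L[ℝ] TangentSpace (𝓡 (2 * m + 2)) x)}
  {Γ : TangentSpace (𝓡 (2 * m + 2)) x →ₗ[ℝ] skewEnd (g.form x)}

variable (R) in
/-- The field of endomorphisms `J`, extended by zero on the splitting, applied to `C`. -/
def screenJField (k ℓ C : VField (2 * m + 2) M) : VField (2 * m + 2) M := fun y =>
  screenJ (g.form y) (R.N y) (k y) (ℓ y) (proj (g.form y) (k y) (ℓ y) (C y))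

lemma rhoField_eq (s : IsSplitting (g.form x) (R.K x) (k x) (ℓ x)) (B C D : VField (2 * m + 2) M) :
    R.rhoField k ℓ x (B x) (C x) (D x)
      = g.pair k B x * g.pair (R.screenJField k ℓ C) D x
        + g.pair k C x * g.pair (R.screenJField k ℓ D) B x
        + g.pair k D x * g.pair (R.screenJField k ℓ B) C x := by
  simp only [rhoField, rho, (R.isRobinson x).omega_eq s]
  rfl

namespace AdaptedFrame

variable (F : R.AdaptedFrame U k ℓ A B)
include F

lemma diffAt_screenJField (hx : x ∈ U) {C : VField (2 * m + 2) M} (hC : DiffAt C x) :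
    DiffAt (R.screenJField k ℓ C) x := by
  have h : DiffAt (fun y => ∑ j, ((-F.coB j y (C y)) • A j y + F.coA j y (C y) • B j y)) x := by
    refine MDifferentiableAt.sum_section fun j _ => mdifferentiableAt_add_section ?_ ?_
    · exact (mdifferentiableAt_coeff F.frame F.isOpen hx _ hC).neg.smul_section (F.diffAt_A hx j)
    · exact (mdifferentiableAt_coeff F.frame F.isOpen hx _ hC).smul_section (F.diffAt_B hx j)
  refine MDifferentiableAt.congr_of_eventuallyEq h ?_
  filter_upwards [F.isOpen.mem_nhds hx] with y hy
  rw [← F.Jmap_expand hy]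
  rfl

/-- In ∇_v(JC) - J∇_v C the derivative of a factor f cancels, because J is linear over functions.
This defines ∇J as a tensor without a connection on the endomorphism bundle. -/
lemma tensorialAt_screenJField (hx : x ∈ U) (v : TangentSpace (𝓡 (2 * m + 2)) x) :
    TensorialAt (𝓡 (2 * m + 2)) (EuclideanSpace ℝ (Fin (2 * m + 2)))
      (fun C : VField (2 * m + 2) M => g.cov (R.screenJField k ℓ C) x v
        - (R.isRobinson x).Jmap (F.isSplitting hx) (g.cov C x v)) x where
  smul {f C} hf hC := by
    have hJ := F.diffAt_screenJField hx hC
    have e : g.cov (R.screenJField k ℓ (f • C)) x = g.cov (f • R.screenJField k ℓ C) x := by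
      refine g.isCovariantDerivativeOn_cov.congr_of_eventuallyEq
        (F.diffAt_screenJField hx (hf.smul_section hC)) (hf.smul_section hJ) Filter.univ_mem ?_
      filter_upwards [F.isOpen.mem_nhds hx] with y hy
      exact map_smul ((R.isRobinson y).Jmap (F.isSplitting hy)) (f y) (C y)
    have e2 : R.screenJField k ℓ C x = (R.isRobinson x).Jmap (F.isSplitting hx) (C x) := rfl
    simp only [e, g.isCovariantDerivativeOn_cov.leibniz hJ hf,
      g.isCovariantDerivativeOn_cov.leibniz hC hf, add_apply, smul_apply,
      ContinuousLinearMap.smulRight_apply, map_add, map_smul, e2]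
    module
  add {C C'} hC hC' := by
    have hJ := F.diffAt_screenJField hx hC
    have hJ' := F.diffAt_screenJField hx hC'
    have e : g.cov (R.screenJField k ℓ (C + C')) x
        = g.cov (R.screenJField k ℓ C + R.screenJField k ℓ C') x := by
      refine g.isCovariantDerivativeOn_cov.congr_of_eventuallyEq
        (F.diffAt_screenJField hx (mdifferentiableAt_add_section hC hC'))
        (mdifferentiableAt_add_section hJ hJ') Filter.univ_mem ?_
      filter_upwards [F.isOpen.mem_nhds hx] with y hy
      exact map_add ((R.isRobinson y).Jmap (F.isSplitting hy)) (C y) (C' y)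
    simp only [e, g.isCovariantDerivativeOn_cov.add hJ hJ',
      g.isCovariantDerivativeOn_cov.add hC hC', add_apply, map_add]
    abel

/-- The covariant derivative of the field of endomorphisms `J`, extended by zero on the
splitting. -/
def nablaJ (F : R.AdaptedFrame U k ℓ A B) (hx : x ∈ U) (v : TangentSpace (𝓡 (2 * m + 2)) x) :
    TangentSpace (𝓡 (2 * m + 2)) x →L[ℝ] TangentSpace (𝓡 (2 * m + 2)) x :=
  TensorialAt.mkHom _ x (F.tensorialAt_screenJField hx v)

lemma nabla_screenJField (hx : x ∈ U) (v : TangentSpace (𝓡 (2 * m + 2)) x)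
    {C : VField (2 * m + 2) M} (hC : DiffAt C x) :
    g.nabla (R.screenJField k ℓ C) x v = F.nablaJ hx v (C x)
      + (R.isRobinson x).Jmap (F.isSplitting hx) (g.nabla C x v) := by
  have := TensorialAt.mkHom_apply (F.tensorialAt_screenJField hx v) hC
  rw [g.cov_apply hC, g.cov_apply (F.diffAt_screenJField hx hC)] at this
  rw [nablaJ, this, sub_add_cancel]

/-- The product rule for ρ = κ ∧ ω. All derivatives of B, C and D cancel, so the left hand side
depends only on their values at x, and the number chosen in `nablaThree` is determined. -/
lemma mvfderiv_rhoField (hx : x ∈ U) (v : TangentSpace (𝓡 (2 * m + 2)) x)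
    {B C D : VField (2 * m + 2) M} (hB : DiffAt B x) (hC : DiffAt C x) (hD : DiffAt D x) :
    mvfderiv (𝓡 (2 * m + 2)) (fun y => R.rhoField k ℓ y (B y) (C y) (D y)) x v
      - R.rhoField k ℓ x (g.nabla B x v) (C x) (D x)
      - R.rhoField k ℓ x (B x) (g.nabla C x v) (D x)
      - R.rhoField k ℓ x (B x) (C x) (g.nabla D x v)
    = (g.val x (g.nabla k x v) (B x) *
        g.val x ((R.isRobinson x).Jmap (F.isSplitting hx) (C x)) (D x)
        + g.val x (k x) (B x) * g.val x (F.nablaJ hx v (C x)) (D x))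
      + (g.val x (g.nabla k x v) (C x) *
        g.val x ((R.isRobinson x).Jmap (F.isSplitting hx) (D x)) (B x)
        + g.val x (k x) (C x) * g.val x (F.nablaJ hx v (D x)) (B x))
      + (g.val x (g.nabla k x v) (D x) *
        g.val x ((R.isRobinson x).Jmap (F.isSplitting hx) (B x)) (C x)
        + g.val x (k x) (D x) * g.val x (F.nablaJ hx v (B x)) (C x)) := by
  have hk := F.splitting.1.diffAt F.isOpen hx
  have e : (fun y => R.rhoField k ℓ y (B y) (C y) (D y)) =ᶠ[𝓝 x]
      g.pair k B * g.pair (R.screenJField k ℓ C) D + g.pair k C * g.pair (R.screenJField k ℓ D) B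
        + g.pair k D * g.pair (R.screenJField k ℓ B) C := by
    filter_upwards [F.isOpen.mem_nhds hx] with y hy
    exact rhoField_eq (F.isSplitting hy) B C D
  have key : ∀ {B C D : VField (2 * m + 2) M}, DiffAt B x → DiffAt C x → DiffAt D x →
      MDifferentiableAt (𝓡 (2 * m + 2)) 𝓘(ℝ) (g.pair k B * g.pair (R.screenJField k ℓ C) D) x ∧
      mvfderiv (𝓡 (2 * m + 2)) (g.pair k B * g.pair (R.screenJField k ℓ C) D) x v
        = (g.val x (g.nabla k x v) (B x) + g.val x (k x) (g.nabla B x v)) *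
            g.val x ((R.isRobinson x).Jmap (F.isSplitting hx) (C x)) (D x)
          + g.val x (k x) (B x) * (g.val x (F.nablaJ hx v (C x)) (D x)
            + g.val x ((R.isRobinson x).Jmap (F.isSplitting hx) (g.nabla C x v)) (D x)
            + g.val x ((R.isRobinson x).Jmap (F.isSplitting hx) (C x)) (g.nabla D x v)) := by
    intro B C D hB hC hD
    have hJ := F.diffAt_screenJField hx hC
    have h1 := g.mdifferentiableAt_pair hk hB
    have h2 := g.mdifferentiableAt_pair hJ hD
    refine ⟨h1.mul h2, ?_⟩
    rw [mvfderiv_mul h1 h2, add_apply, smul_apply, smul_apply, g.mvfderiv_pair hk hB,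
      g.mvfderiv_pair hJ hD, F.nabla_screenJField hx v hC, map_add, add_apply]
    simp only [LorentzMetric.pair, smul_eq_mul]
    have e2 : R.screenJField k ℓ C x = (R.isRobinson x).Jmap (F.isSplitting hx) (C x) := rfl
    rw [e2]
    ring
  obtain ⟨h1, e1⟩ := key hB hC hD
  obtain ⟨h2, e2⟩ := key hC hD hB
  obtain ⟨h3, e3⟩ := key hD hB hC
  rw [mvfderiv_congr e, mvfderiv_add (h1.add h2) h3, mvfderiv_add h1 h2, add_apply, add_apply, e1,
    e2, e3]
  simp only [rhoField, rho, (R.isRobinson x).omega_eq (F.isSplitting hx), g.form_apply]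
  ring

lemma nablaThree_rhoField (hx : x ∈ U) (v b c d : TangentSpace (𝓡 (2 * m + 2)) x) :
    g.nablaThree (R.rhoField k ℓ) x v b c d
    = (g.val x (g.nabla k x v) b *
        g.val x ((R.isRobinson x).Jmap (F.isSplitting hx) c) d
        + g.val x (k x) b * g.val x (F.nablaJ hx v c) d)
      + (g.val x (g.nabla k x v) c *
        g.val x ((R.isRobinson x).Jmap (F.isSplitting hx) d) b
        + g.val x (k x) c * g.val x (F.nablaJ hx v d) b)
      + (g.val x (g.nabla k x v) d *
        g.val x ((R.isRobinson x).Jmap (F.isSplitting hx) b) c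
        + g.val x (k x) d * g.val x (F.nablaJ hx v b) c) := by
  set r := (g.val x (g.nabla k x v) b *
        g.val x ((R.isRobinson x).Jmap (F.isSplitting hx) c) d
        + g.val x (k x) b * g.val x (F.nablaJ hx v c) d)
      + (g.val x (g.nabla k x v) c *
        g.val x ((R.isRobinson x).Jmap (F.isSplitting hx) d) b
        + g.val x (k x) c * g.val x (F.nablaJ hx v d) b)
      + (g.val x (g.nabla k x v) d *
        g.val x ((R.isRobinson x).Jmap (F.isSplitting hx) b) c
        + g.val x (k x) d * g.val x (F.nablaJ hx v b) c) with hr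
  have H : ∀ B C D : VField (2 * m + 2) M,
      DiffAt B x → DiffAt C x → DiffAt D x → B x = b → C x = c → D x = d →
      r = mvfderiv (𝓡 (2 * m + 2)) (fun y => R.rhoField k ℓ y (B y) (C y) (D y)) x v
      - R.rhoField k ℓ x (g.nabla B x v) c d - R.rhoField k ℓ x b (g.nabla C x v) d
      - R.rhoField k ℓ x b c (g.nabla D x v) := by
    rintro B C D hB hC hD rfl rfl rfl
    exact (F.mvfderiv_rhoField hx v hB hC hD).symm
  have h := Classical.epsilon_spec (p := fun r => ∀ B C D : VField (2 * m + 2) M,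
      DiffAt B x → DiffAt C x → DiffAt D x → B x = b → C x = c → D x = d →
      r = mvfderiv (𝓡 (2 * m + 2)) (fun y => R.rhoField k ℓ y (B y) (C y) (D y)) x v
      - R.rhoField k ℓ x (g.nabla B x v) c d - R.rhoField k ℓ x b (g.nabla C x v) d
      - R.rhoField k ℓ x b c (g.nabla D x v)) ⟨r, H⟩ _ _ _ (LorentzMetric.diffAt_extend b)
      (LorentzMetric.diffAt_extend c) (LorentzMetric.diffAt_extend d)
      (LorentzMetric.extend_self b) (LorentzMetric.extend_self c) (LorentzMetric.extend_self d)
  exact h.trans (H _ _ _ (LorentzMetric.diffAt_extend b)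
      (LorentzMetric.diffAt_extend c) (LorentzMetric.diffAt_extend d)
      (LorentzMetric.extend_self b) (LorentzMetric.extend_self c)
      (LorentzMetric.extend_self d)).symm

lemma diffAt_const (hx : x ∈ U) {y : M} (c : TangentSpace (𝓡 (2 * m + 2)) y) :
    DiffAt (F.const c) x :=
  SmoothAt.diffAt (SmoothAt.sum fun i _ =>
    SmoothAt.const_smul _ (F.frame.contMDiffAt F.isOpen hx i))

lemma const_self (hx : x ∈ U) (c : TangentSpace (𝓡 (2 * m + 2)) x) : F.const c x = c := by
  have h := F.frame.coeff_sum_eq (FiberBundle.extend (EuclideanSpace ℝ (Fin (2 * m + 2))) c) hx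
  rw [FiberBundle.extend_apply_self] at h
  exact h.symm

lemma const_mem_screen (hx : x ∈ U) {a : TangentSpace (𝓡 (2 * m + 2)) x}
    (ha : a ∈ screen (g.form x) (k x) (ℓ x)) {y : M} (hy : y ∈ U) :
    F.const a y ∈ screen (g.form y) (k y) (ℓ y) := by
  rw [mem_screen, g.form_apply, g.form_apply, const, AdaptedFrame.sum_eq, (F.pairing_comb hy _ _ _ _).1,
    (F.pairing_comb hy _ _ _ _).2, (F.coeff_eq hx _).1, (F.coeff_eq hx _).2]
  exact (mem_screen.1 ha)

/-- D_v(a + i J a) lies in N for a section a of the screen bundle, so D contributes nothing to the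
screen components of ∇J. What remains is the commutator [Γ_v, J]. -/
lemma nablaJ_apply (h : R.IsTorsionForm U' D x Γ) (hx : x ∈ U)
    {a c : TangentSpace (𝓡 (2 * m + 2)) x}
    (ha : a ∈ screen (g.form x) (k x) (ℓ x)) (hc : c ∈ screen (g.form x) (k x) (ℓ x))
    (v : TangentSpace (𝓡 (2 * m + 2)) x) :
    g.val x (F.nablaJ hx v a) c
      = g.form x ((Γ v : _ →ₗ[ℝ] TangentSpace (𝓡 (2 * m + 2)) x) a)
          ((R.isRobinson x).Jmap (F.isSplitting hx) c)
        + g.form x ((Γ v : _ →ₗ[ℝ] TangentSpace (𝓡 (2 * m + 2)) x)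
          ((R.isRobinson x).Jmap (F.isSplitting hx) a)) c := by
  have r := R.isRobinson x
  have s := F.isSplitting hx
  have hC := F.diffAt_const hx a
  have hJ := F.diffAt_screenJField hx hC
  have hN : ∀ᶠ y in 𝓝 x, cvec (F.const a y) (R.screenJField k ℓ (F.const a) y) ∈ R.N y := by
    filter_upwards [F.isOpen.mem_nhds hx] with y hy
    exact (R.isRobinson y).cvec_Jmap_mem (F.isSplitting hy) (F.const_mem_screen hx ha hy)
  have e1 := F.nabla_screenJField hx v hC
  have e2 := h.2.2 _ hC v
  have e3 := h.2.2 _ hJ v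
  have e4 := r.null_im (h.2.1.preserves x h.1 _ _ hC hJ hN v) (r.cvec_Jmap_mem s hc)
  have e5 : R.screenJField k ℓ (F.const a) x = r.Jmap s a := by
    conv_rhs => rw [← F.const_self hx a]
    rfl
  rw [F.const_self hx] at e1 e2
  rw [e5] at e3
  rw [e2, e3, eq_sub_of_add_eq e1.symm, map_sub, map_sub, map_sub, sub_apply,
    LinearMap.sub_apply, LinearMap.sub_apply]
  have e6 := r.Jmap_skew s (g.nabla (F.const a) x v) c
  simp only [g.form_apply] at e4 e6 ⊢
  linarith

lemma componentsVanish_iff (h : R.IsTorsionForm U' D x Γ) (hx : x ∈ U) :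
    ComponentsVanish m (g.form x) (R.N x) (k x) (ℓ x) (g.nablaKappa k x)
      (g.nablaThree (R.rhoField k ℓ) x) ↔ PreservesAlong (g.form x) (R.N x) (k x) Γ := by
  have r := R.isRobinson x
  have s := F.isSplitting hx
  have hk := F.splitting.1.diffAt F.isOpen hx
  refine r.componentsVanish_iff s (fun v w _ hw => ?_)
    -- The factor of the ω-term: the slot ℓ of ∇ρ contributes (∇κ)(k, ℓ) ω.
    (g.val x (g.nabla k x (k x)) (ℓ x)) fun a ha c hc => ?_
  · have hK := h.2.1.apply_mem_K h.1 hk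
      (Filter.eventually_of_mem (F.isOpen.mem_nhds hx) fun y hy => (F.isSplitting hy).mem) v
    rw [h.2.2 _ hk, map_sub, LinearMap.sub_apply, r.K_eq_smul s hK, map_smul, LinearMap.smul_apply,
      (mem_screen.1 hw).1, smul_zero, sub_zero]
    rfl
  · have J0 : ∀ v, g.val x (r.Jmap s v) (ℓ x) = 0 := fun v => by
      have := r.Jmap_skew s v (ℓ x)
      rwa [r.Jmap_right, map_zero, neg_zero] at this
    have hp : g.val x (k x) (ℓ x) = 1 := s.pairing
    have ha1 : g.val x (k x) a = 0 := (mem_screen.1 ha).1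
    have hc1 : g.val x (k x) c = 0 := (mem_screen.1 hc).1
    rw [zeta, F.nablaThree_rhoField hx, J0, ha1, hc1, hp, F.nablaJ_apply h hx ha hc, r.Jmap_right]
    simp only [g.form_apply, map_zero, zero_apply]
    ring

end AdaptedFrame

lemma componentCondition_iff : R.ComponentCondition ↔ ∀ x, R.PreservesAlongAt x := by
  constructor
  · intro H x
    obtain ⟨U, k, ℓ, A, B, hx, F⟩ := R.exists_adaptedFrame_at x
    obtain ⟨V, D, Γ, h⟩ := R.exists_isTorsionForm x
    rw [h.preservesAlongAt_iff, (R.isRobinson x).preservesAlong_iff (F.isSplitting hx),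
      ← F.componentsVanish_iff h hx]
    exact H U k ℓ F.isOpen F.splitting x hx
  · intro H U k ℓ hU s x hx
    obtain ⟨U', -, hx', A, B, F⟩ := R.exists_adaptedFrame hU s hx
    obtain ⟨V, D, Γ, h⟩ := R.exists_isTorsionForm x
    exact (F.componentsVanish_iff h hx').2
      ((h.preservesAlongAt_iff).1 (H x) _ (F.isSplitting hx').mem)

end AlmostRobinson

end Robinson

/-! ### Geodesics and the shear. -/

namespace Robinson

namespace AlmostRobinson

variable {m : ℕ} {M : Type*} [TopologicalSpace M]
  [ChartedSpace (EuclideanSpace ℝ (Fin (2 * m + 2))) M] [IsManifold (𝓡 (2 * m + 2)) ∞ M]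
  {g : LorentzMetric (2 * m + 2) M} {R : AlmostRobinson g}

lemma NearlyRobinson.geodesic (H : R.NearlyRobinson) : R.Geodesic := by
  intro U k hU ⟨hk, hK⟩ x hx
  obtain ⟨V, D, Γ, h, hP⟩ := nearlyRobinson_iff.1 H x
  have r := R.isRobinson x
  have dk := hk.diffAt hU hx
  have h1 : (Γ (k x) : TangentSpace (𝓡 (2 * m + 2)) x →ₗ[ℝ] _) (k x) ∈ R.K x := by
    refine r.mem_K_of_orthogonal fun a b hab => ?_
    -- With w = k the right hand side g(Γ_a k, k) is zero by skewness, so Γ_k k is orthogonal to Re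
    -- N and therefore lies in K; D_k k lies in K as well.
    have e := hP _ (hK x hx) a b (k x) 0 hab ((r.mem_K _).1 (hK x hx))
    have e2 := skewEnd_apply (Γ a) (k x) (k x)
    rw [r.symm (k x)] at e2
    rw [skewEnd_apply, r.symm] at e
    simp only [map_zero, sub_zero] at e
    linarith
  have h2 := h.2.1.apply_mem_K h.1 dk (Filter.eventually_of_mem (hU.mem_nhds hx) hK) (k x)
  rw [h.2.2 _ dk] at h1
  simpa using (R.K x).add_mem h1 h2

lemma NearlyRobinson.shearCommutes (H : R.NearlyRobinson) : R.ShearCommutes := by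
  intro U k ℓ hU s x hx v v' w w' hv hw
  obtain ⟨V, D, Γ, h, hP⟩ := nearlyRobinson_iff.1 H x
  have r := R.isRobinson x
  have dk := s.1.diffAt hU hx
  have hkx := (s.2.2 x hx).mem
  have hD := h.2.1.apply_mem_K h.1 dk
    (Filter.eventually_of_mem (hU.mem_nhds hx) fun y hy => (s.2.2 y hy).mem)
  have hA : ∀ u u' w w', cvec w w' ∈ R.N x →
      g.nablaKappa k x u w = g.form x ((Γ u : TangentSpace (𝓡 (2 * m + 2)) x →ₗ[ℝ] _) (k x)) w ∧
      g.nablaKappa k x u' w'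
        = g.form x ((Γ u' : TangentSpace (𝓡 (2 * m + 2)) x →ₗ[ℝ] _) (k x)) w' := by
    intro u u' w w' hw
    have e1 := r.orthogonal_left (hD u) hw
    have e2 := r.orthogonal_right (hD u') hw
    rw [h.2.2 _ dk, h.2.2 _ dk, map_sub, map_sub, LinearMap.sub_apply, LinearMap.sub_apply, e1, e2,
      sub_zero, sub_zero]
    exact ⟨rfl, rfl⟩
  -- The identity is used for (z, iw) and for (w, iz). In the sum the Γ_k-terms cancel by skewness,
  -- and the trace term of the shear cancels because J is skew for h.
  have p1 := hP _ hkx v v' _ _ hv (I_mem hw)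
  have p2 := hP _ hkx w w' _ _ hw (I_mem hv)
  have s1 := skewEnd_apply (Γ (k x)) v w'
  have s2 := skewEnd_apply (Γ (k x)) v' w
  rw [r.symm v] at s1
  rw [r.symm v'] at s2
  have n := r.null_im hv hw
  simp only [map_neg] at p1 p2
  obtain ⟨a1, a2⟩ := hA v' v w w' hw
  obtain ⟨a3, a4⟩ := hA w' w v v' hv
  have n' : g.form x v' w = - g.form x v w' := by linarith
  unfold shear
  rw [a1, a2, a3, a4, n']
  linear_combination (1 / 2) * p1 + (1 / 2) * p2 + (1 / 2) * s1 + (1 / 2) * s2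

end AlmostRobinson

end Robinson

/-! ### A coframe of Ann N and forms determined by a transverse frame. -/

namespace Robinson

namespace AlmostRobinson

variable {m : ℕ} {M : Type*} [TopologicalSpace M]
  [ChartedSpace (EuclideanSpace ℝ (Fin (2 * m + 2))) M] [IsManifold (𝓡 (2 * m + 2)) ∞ M]
  {g : LorentzMetric (2 * m + 2) M} {R : AlmostRobinson g} {x : M} {U W : Set M}
  {k ℓ : VField (2 * m + 2) M} {A B : Fin m → VField (2 * m + 2) M}

lemma AdaptedFrame.mono (F : R.AdaptedFrame U k ℓ A B) (hW : IsOpen W) (hWU : W ⊆ U) :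
    R.AdaptedFrame W k ℓ A B where
  isOpen := hW
  splitting := ⟨F.splitting.1.mono hWU, F.splitting.2.1.mono hWU,
    fun x hx => F.splitting.2.2 x (hWU hx)⟩
  mem_A x hx := F.mem_A x (hWU hx)
  mem_B x hx := F.mem_B x (hWU hx)
  mem_N x hx := F.mem_N x (hWU hx)
  frame := F.frame.mono hWU

/-- The family `ℓ, A_1, …, A_m`, which projects to a frame of the quotient of the complexified
tangent bundle by `N`. -/
def transverse (ℓ : VField (2 * m + 2) M) (A : Fin m → VField (2 * m + 2) M) :
    Fin (m + 1) → VField (2 * m + 2) M := Fin.cons ℓ A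

namespace AdaptedFrame

/-- The frame of `Ann N` dual to `transverse ℓ A`. -/
def coframe (F : R.AdaptedFrame U k ℓ A B) (x : M) :
    TangentSpace (𝓡 (2 * m + 2)) x →ₗ[ℝ] (Fin (m + 1) → ℂ) :=
  LinearMap.pi (Fin.cons (Complex.ofRealCLM.toLinearMap ∘ₗ g.form x (k x))
    fun j => Complex.ofRealCLM.toLinearMap ∘ₗ F.coA j x
      + Complex.I • (Complex.ofRealCLM.toLinearMap ∘ₗ F.coB j x))

variable (F : R.AdaptedFrame U k ℓ A B)

lemma coframe_zero (v : TangentSpace (𝓡 (2 * m + 2)) x) :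
    F.coframe x v 0 = (g.val x (k x) v : ℝ) := rfl

lemma coframe_succ (v : TangentSpace (𝓡 (2 * m + 2)) x) (j : Fin m) :
    F.coframe x v j.succ = (F.coA j x v : ℝ) + Complex.I * (F.coB j x v : ℝ) := by
  simp [coframe]

include F in
lemma smoothOn_A (j : Fin m) : SmoothOn U (A j) := F.frame.contMDiffOn (Sum.inl j)

include F in
lemma smoothOn_transverse (a : Fin (m + 1)) : SmoothOn U (transverse ℓ A a) := by
  refine Fin.cases ?_ (fun j => ?_) a
  · exact F.splitting.2.1
  · exact F.smoothOn_A j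

lemma mem_N_iff_coframe (hx : x ∈ U) {a b : TangentSpace (𝓡 (2 * m + 2)) x} :
    cvec a b ∈ R.N x ↔ ∀ j, F.coframe x a j + Complex.I * F.coframe x b j = 0 := by
  rw [F.mem_N_iff hx, Fin.forall_fin_succ]
  simp only [coframe_zero, coframe_succ, Complex.ext_iff]
  simp only [Complex.add_re, Complex.ofReal_re, Complex.mul_re, Complex.I_re, Complex.I_im,
    Complex.ofReal_im, Complex.add_im, Complex.mul_im, Complex.zero_re, Complex.zero_im]
  constructor
  · rintro ⟨h1, h2, h3⟩
    refine ⟨⟨by linarith, by linarith⟩, fun j => ⟨?_, ?_⟩⟩ <;>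
    · have := (h3 j).1
      have := (h3 j).2
      linarith
  · rintro ⟨⟨h1, h2⟩, h3⟩
    refine ⟨by linarith, by linarith, fun j => ⟨?_, ?_⟩⟩ <;>
    · have := (h3 j).1
      have := (h3 j).2
      linarith

/-- Extended complex linearly, Λ factors through the quotient by N. There k is zero and B_j equals i
A_j, so ℓ and the A_j form a complex basis. -/
lemma linear_expand (hx : x ∈ U) (Λ : TangentSpace (𝓡 (2 * m + 2)) x →ₗ[ℝ] ℂ)
    (hΛ : ∀ a b, cvec a b ∈ R.N x → Λ a + Complex.I * Λ b = 0)
    (v : TangentSpace (𝓡 (2 * m + 2)) x) :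
    Λ v = ∑ a, F.coframe x v a * Λ (transverse ℓ A a x) := by
  have hB : ∀ j, Λ (B j x) = Complex.I * Λ (A j x) := fun j => by
    have := hΛ _ _ (F.mem_N x hx j)
    linear_combination (-Complex.I) * this + Λ (B j x) * Complex.I_mul_I
  have hk : Λ (k x) = 0 := by
    have := hΛ _ _ (((R.isRobinson x).mem_K _).1 (F.isSplitting hx).mem)
    simpa using this
  conv_lhs => rw [F.expand hx v]
  rw [Fin.sum_univ_succ]
  simp only [map_add, map_sum, map_smul, hB, hk, coframe_zero, coframe_succ, transverse,
    Fin.cons_zero, Fin.cons_succ, Complex.real_smul, mul_zero, zero_add]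
  rw [add_comm]
  congr 1
  exact Finset.sum_congr rfl fun j _ => by ring

lemma coframe_transverse (hx : x ∈ U) (a b : Fin (m + 1)) :
    F.coframe x (transverse ℓ A a x) b = if a = b then 1 else 0 := by
  have s := F.isSplitting hx
  have hl : ∀ j, F.coA j x (ℓ x) = 0 ∧ F.coB j x (ℓ x) = 0 := fun j => by
    have h1 := F.coA_comb hx 0 0 0 1 j
    have h2 := F.coB_comb hx 0 0 0 1 j
    simp only [Pi.zero_apply, zero_smul, one_smul, add_zero, zero_add,
      Finset.sum_const_zero] at h1 h2
    exact ⟨h1, h2⟩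
  have hA : ∀ i j, F.coA j x (A i x) = (if i = j then 1 else 0) ∧ F.coB j x (A i x) = 0 := by
    intro i j
    have h1 := F.coA_comb hx (Pi.single i 1) 0 0 0 j
    have h2 := F.coB_comb hx (Pi.single i 1) 0 0 0 j
    have e : ∑ j, ((Pi.single i 1 : Fin m → ℝ) j • A j x + (0 : Fin m → ℝ) j • B j x)
        + ((0 : ℝ) • k x + (0 : ℝ) • ℓ x) = A i x := by
      simp [Pi.single_apply, ite_smul]
    rw [e] at h1 h2
    exact ⟨by rw [h1, Pi.single_apply]; simp [eq_comm], h2⟩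
  have hk : g.val x (k x) (ℓ x) = 1 := s.pairing
  have hkA : ∀ i, g.val x (k x) (A i x) = 0 := fun i => (mem_screen.1 (F.mem_A x hx i)).1
  refine Fin.cases ?_ (fun i => ?_) a <;> refine Fin.cases ?_ (fun j => ?_) b
  · simp [transverse, coframe_zero, hk]
  · simp [transverse, coframe_succ, hl, (Fin.succ_ne_zero j).symm]
  · simp [transverse, coframe_zero, hkA]
  · by_cases hij : i = j <;> simp [transverse, coframe_succ, hA, hij]

include F in
/-- A function on tuples of smooth vector fields that is alternating, that is tensorial at `x` and
annihilates `N` in each argument, and that is zero on the transverse frame vanishes. -/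
lemma eq_zero_of_slotwise (hx : x ∈ U) (Φ : (Fin (m + 1) → VField (2 * m + 2) M) → ℂ)
    (hslot : ∀ X : Fin (m + 1) → VField (2 * m + 2) M, (∀ j, SmoothOn U (X j)) → ∀ j,
      ∃ Λ : TangentSpace (𝓡 (2 * m + 2)) x →ₗ[ℝ] ℂ,
        (∀ a b, cvec a b ∈ R.N x → Λ a + Complex.I * Λ b = 0) ∧
        ∀ Y, SmoothOn U Y → Φ (Function.update X j Y) = Λ (Y x))
    (hperm : ∀ X (σ : Equiv.Perm (Fin (m + 1))), Φ (X ∘ σ) = Equiv.Perm.sign σ • Φ X)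
    (hV : Φ (transverse ℓ A) = 0) (X : Fin (m + 1) → VField (2 * m + 2) M)
    (hX : ∀ j, SmoothOn U (X j)) : Φ X = 0 := by
  -- The induction runs over the set of slots that are not yet known to hold a member of the
  -- transverse frame.
  suffices H : ∀ s : Finset (Fin (m + 1)), ∀ X : Fin (m + 1) → VField (2 * m + 2) M,
      (∀ j, SmoothOn U (X j)) → (∀ j ∉ s, ∃ a, X j = transverse ℓ A a) → Φ X = 0 from
    H Finset.univ X hX (by simp)
  intro s
  induction s using Finset.induction_on with
  | empty =>
    intro X _ h
    choose σ hσ using fun j => h j (by simp)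
    obtain rfl : X = transverse ℓ A ∘ σ := funext hσ
    -- All slots now hold transverse members. Without repetition this is a permutation of the
    -- transverse frame; with a repetition, swapping two equal slots gives Φ = -Φ.
    by_cases hinj : Function.Injective σ
    · have := hperm (transverse ℓ A) (Equiv.ofBijective σ (Finite.injective_iff_bijective.1 hinj))
      rw [hV, smul_zero] at this
      exact this
    · simp only [Function.Injective, not_forall] at hinj
      obtain ⟨i, j, hij, hne⟩ := hinj
      have := hperm (transverse ℓ A ∘ σ) (Equiv.swap i j)
      have e : (transverse ℓ A ∘ σ) ∘ Equiv.swap i j = transverse ℓ A ∘ σ := by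
        funext a
        simp only [Function.comp_apply]
        rcases eq_or_ne a i with rfl | hi
        · rw [Equiv.swap_apply_left, hij]
        rcases eq_or_ne a j with rfl | hj
        · rw [Equiv.swap_apply_right, hij]
        rw [Equiv.swap_apply_of_ne_of_ne hi hj]
      rw [e, Equiv.Perm.sign_swap hne, Units.neg_smul, one_smul] at this
      exact self_eq_neg.1 this
  | insert j s hj ih =>
    intro X hX h
    obtain ⟨Λ, hΛ, hΦ⟩ := hslot X hX j
    have e := hΦ (X j) (hX j)
    rw [Function.update_eq_self] at e
    rw [e, F.linear_expand hx Λ hΛ]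
    refine Finset.sum_eq_zero fun a _ => ?_
    rw [← hΦ _ (F.smoothOn_transverse a), ih, mul_zero]
    · intro i
      rcases eq_or_ne i j with rfl | hi
      · simpa using F.smoothOn_transverse a
      · simpa [hi] using hX i
    · intro i hi
      rcases eq_or_ne i j with rfl | hij
      · exact ⟨a, by simp⟩
      · simpa [hij] using h i (by simp [hij, hi])

lemma smoothOn_const {y : M} (c : TangentSpace (𝓡 (2 * m + 2)) y) : SmoothOn U (F.const c) :=
  smoothOn_of_smoothAt fun _ hx => SmoothAt.sum fun i _ =>
    SmoothAt.const_smul _ (F.frame.contMDiffAt F.isOpen hx i)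

end AdaptedFrame

end AlmostRobinson

end Robinson

/-! ### Lie derivatives of complex forms. -/

namespace Robinson

lemma contMDiffOn_mvfderiv_apply {n : ℕ} {M : Type*} [TopologicalSpace M]
    [ChartedSpace (EuclideanSpace ℝ (Fin n)) M] [IsManifold (𝓡 n) ∞ M] {F : Type*}
    [NormedAddCommGroup F] [NormedSpace ℝ F] {U : Set M} (hU : IsOpen U) {f : M → F}
    (hf : ContMDiffOn (𝓡 n) 𝓘(ℝ, F) ∞ f U) {k : VField n M} (hk : SmoothOn U k) :
    ContMDiffOn (𝓡 n) 𝓘(ℝ, F) ∞ (fun y => mvfderiv (𝓡 n) f y (k y)) U := by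
  have h1 := hf.contMDiffOn_tangentMapWithin (m := ∞) (by simp) hU.uniqueMDiffOn
  have h2 : ContMDiffOn (𝓡 n) 𝓘(ℝ, F).tangent ∞
      (fun y => tangentMapWithin (𝓡 n) 𝓘(ℝ, F) f U ⟨y, k y⟩) U :=
    h1.comp hk fun y hy => hy
  have h3 := (contMDiff_snd_tangentBundle_modelSpace F 𝓘(ℝ, F) (n := ∞)).comp_contMDiffOn h2
  refine h3.congr fun y hy => ?_
  change _ = mfderivWithin (𝓡 n) 𝓘(ℝ, F) f U y (k y)
  rw [mfderivWithin_of_isOpen hU hy]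
  rfl

lemma mvfderiv_clm_comp {n : ℕ} {M : Type*} [TopologicalSpace M]
    [ChartedSpace (EuclideanSpace ℝ (Fin n)) M] {F F' : Type*}
    [NormedAddCommGroup F] [NormedSpace ℝ F] [NormedAddCommGroup F'] [NormedSpace ℝ F']
    (L : F →L[ℝ] F') {f : M → F} {x : M} (hf : MDifferentiableAt (𝓡 n) 𝓘(ℝ, F) f x)
    (v : TangentSpace (𝓡 n) x) :
    mvfderiv (𝓡 n) (fun y => L (f y)) x v = L (mvfderiv (𝓡 n) f x v) := by
  have h := mfderiv_comp_apply (I := 𝓡 n) (I' := 𝓘(ℝ, F)) (I'' := 𝓘(ℝ, F')) (g := L) x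
    L.differentiableAt.mdifferentiableAt hf v
  rw [mfderiv_eq_fderiv, L.fderiv] at h
  exact h

lemma mvfderiv_const_mul {n : ℕ} {M : Type*} [TopologicalSpace M]
    [ChartedSpace (EuclideanSpace ℝ (Fin n)) M] {f : M → ℂ} {x : M}
    (hf : MDifferentiableAt (𝓡 n) 𝓘(ℝ, ℂ) f x) (c : ℂ) (v : TangentSpace (𝓡 n) x) :
    mvfderiv (𝓡 n) (fun y => c * f y) x v = c * mvfderiv (𝓡 n) f x v :=
  mvfderiv_clm_comp (ContinuousLinearMap.mul ℝ ℂ c) hf v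

namespace AlmostRobinson

variable {m : ℕ} {M : Type*} [TopologicalSpace M]
  [ChartedSpace (EuclideanSpace ℝ (Fin (2 * m + 2))) M] [IsManifold (𝓡 (2 * m + 2)) ∞ M]
  {g : LorentzMetric (2 * m + 2) M} {R : AlmostRobinson g} {x : M} {U W : Set M}
  {k ℓ : VField (2 * m + 2) M} {A B : Fin m → VField (2 * m + 2) M}
  {ν : (x : M) → (TangentSpace (𝓡 (2 * m + 2)) x) [⋀^Fin (m + 1)]→ₗ[ℝ] ℂ}
  {X : Fin (m + 1) → VField (2 * m + 2) M} {Y : VField (2 * m + 2) M} {j : Fin (m + 1)}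

omit [IsManifold (𝓡 (2 * m + 2)) ∞ M] in
lemma update_apply_field (X : Fin (m + 1) → VField (2 * m + 2) M) (j : Fin (m + 1))
    (Y : VField (2 * m + 2) M) (y : M) :
    (fun i => Function.update X j Y i y) = Function.update (fun i => X i y) j (Y y) := by
  funext i
  rcases eq_or_ne i j with rfl | h <;> simp [*]

omit [IsManifold (𝓡 (2 * m + 2)) ∞ M] in
lemma lieDerivForm_update (X : Fin (m + 1) → VField (2 * m + 2) M) (j : Fin (m + 1))
    (Y : VField (2 * m + 2) M) (x : M) :
    lieDerivForm ν k (Function.update X j Y) x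
      = mvfderiv (𝓡 (2 * m + 2)) (fun y => ν y (Function.update (fun i => X i y) j (Y y))) x (k x)
        - (ν x (Function.update (fun i => X i x) j (VectorField.mlieBracket (𝓡 (2 * m + 2)) k Y x))
          + ∑ i ∈ Finset.univ.erase j, ν x (Function.update (Function.update (fun i => X i x) i
              (VectorField.mlieBracket (𝓡 (2 * m + 2)) k (X i) x)) j (Y x))) := by
  rw [lieDerivForm]
  simp only [update_apply_field]
  congr 1
  rw [← Finset.add_sum_erase _ _ (Finset.mem_univ j)]
  congr 1
  · rw [Function.update_idem, Function.update_self]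
  · refine Finset.sum_congr rfl fun i hi => ?_
    have hij := Finset.ne_of_mem_erase hi
    rw [Function.update_comm hij.symm, Function.update_of_ne hij]

omit [IsManifold (𝓡 (2 * m + 2)) ∞ M] in
lemma lieDerivForm_perm (X : Fin (m + 1) → VField (2 * m + 2) M)
    (σ : Equiv.Perm (Fin (m + 1))) (x : M) :
    lieDerivForm ν k (X ∘ σ) x = Equiv.Perm.sign σ • lieDerivForm ν k X x := by
  have h1 : (fun y => ν y (fun j => (X ∘ σ) j y))
      = fun y => Equiv.Perm.sign σ • ν y (fun j => X j y) :=
    funext fun y => (ν y).map_perm (fun j => X j y) σ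
  have h2 : ∀ j, ν x (Function.update (fun i => (X ∘ σ) i x) j
      (VectorField.mlieBracket (𝓡 (2 * m + 2)) k ((X ∘ σ) j) x))
      = Equiv.Perm.sign σ • ν x (Function.update (fun i => X i x) (σ j)
        (VectorField.mlieBracket (𝓡 (2 * m + 2)) k (X (σ j)) x)) := by
    intro j
    rw [← (ν x).map_perm]
    congr 1
    rw [Function.update_comp_equiv, Equiv.symm_apply_apply]
    rfl
  rw [lieDerivForm, lieDerivForm, h1]
  simp only [h2]
  rw [Equiv.sum_comp σ fun j => Equiv.Perm.sign σ • ν x (Function.update (fun i => X i x) j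
        (VectorField.mlieBracket (𝓡 (2 * m + 2)) k (X j) x)), ← Finset.smul_sum, smul_sub]
  congr 1
  rcases Int.units_eq_one_or (Equiv.Perm.sign σ) with h | h
  · simp only [h, one_smul]
  · simp only [h, Units.neg_smul, one_smul]
    have := mvfderiv_neg (I := 𝓡 (2 * m + 2)) (g := fun y => ν y fun j => X j y) (x := x)
    exact congrArg (fun q => q (k x)) this

omit [IsManifold (𝓡 (2 * m + 2)) ∞ M] in
-- Annihilation is prescribed in the first slot only; a transposition moves it to any slot.
lemma annihilates_update {β : (TangentSpace (𝓡 (2 * m + 2)) x) [⋀^Fin (m + 1)]→ₗ[ℝ] ℂ}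
    {a b : TangentSpace (𝓡 (2 * m + 2)) x}
    (h : ∀ w : Fin m → TangentSpace (𝓡 (2 * m + 2)) x,
      β (Fin.cons a w) + Complex.I * β (Fin.cons b w) = 0)
    (w : Fin (m + 1) → TangentSpace (𝓡 (2 * m + 2)) x) (j : Fin (m + 1)) :
    β (Function.update w j a) + Complex.I * β (Function.update w j b) = 0 := by
  have key : ∀ a, β (Function.update w j a) = Equiv.Perm.sign (Equiv.swap 0 j) •
      β (Fin.cons a (Fin.tail (w ∘ Equiv.swap 0 j))) := by
    intro a
    have e : Function.update w j a ∘ Equiv.swap 0 j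
        = Fin.cons a (Fin.tail (w ∘ Equiv.swap 0 j)) := by
      rw [Function.update_comp_equiv, Equiv.symm_swap, Equiv.swap_apply_right]
      funext i
      refine Fin.cases ?_ (fun i => ?_) i
      · simp
      · simp [Fin.tail]
    rw [← e, β.map_perm, smul_smul, Int.units_mul_self, one_smul]
  rw [key, key, mul_smul_comm, ← smul_add, h, smul_zero]

/-- The smoothness hypothesis concerns smooth fields, while tensoriality needs fields differentiable
only at x. Expanding Y in the smooth frame reduces to differentiability of its coefficients. -/
lemma AdaptedFrame.mdifferentiableAt_update (F : R.AdaptedFrame U k ℓ A B)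
    (hν : ∀ X : Fin (m + 1) → VField (2 * m + 2) M, (∀ j, SmoothOn U (X j)) →
      ContMDiffOn (𝓡 (2 * m + 2)) 𝓘(ℝ, ℂ) ∞ (fun x => ν x (fun j => X j x)) U)
    (hx : x ∈ U) (hX : ∀ j, SmoothOn U (X j)) (j : Fin (m + 1)) (hY : DiffAt Y x) :
    MDifferentiableAt (𝓡 (2 * m + 2)) 𝓘(ℝ, ℂ)
      (fun y => ν y (Function.update (fun i => X i y) j (Y y))) x := by
  have e : (fun y => ν y (Function.update (fun i => X i y) j (Y y))) =ᶠ[𝓝 x]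
      fun y => ∑ i, F.frame.coeff i y (Y y) •
        ν y (fun i' => Function.update X j (frameFamily k ℓ A B i) i' y) := by
    filter_upwards [F.isOpen.mem_nhds hx] with y hy
    conv_lhs => rw [F.frame.coeff_sum_eq Y hy]
    rw [AlternatingMap.map_update_sum]
    refine Finset.sum_congr rfl fun i _ => ?_
    rw [AlternatingMap.map_update_smul, update_apply_field]
  refine MDifferentiableAt.congr_of_eventuallyEq ?_ e
  have hs : ∀ i, MDifferentiableAt (𝓡 (2 * m + 2)) 𝓘(ℝ, ℂ) (fun y => F.frame.coeff i y (Y y) •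
        ν y (fun i' => Function.update X j (frameFamily k ℓ A B i) i' y)) x := fun i => by
    refine (mdifferentiableAt_coeff F.frame F.isOpen hx i hY).smul ?_
    refine ((hν (Function.update X j (frameFamily k ℓ A B i)) ?_).contMDiffAt
      (F.isOpen.mem_nhds hx)).mdifferentiableAt (by simp)
    intro i'
    rcases eq_or_ne i' j with rfl | h
    · rw [Function.update_self]; exact F.frame.contMDiffOn i
    · rw [Function.update_of_ne h]; exact hX i'
  have := MDifferentiableAt.sum (t := Finset.univ) fun i _ => hs i
  rwa [Finset.sum_fn] at this

/-- The Lie derivative of `ν` is tensorial in each argument. -/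
lemma AdaptedFrame.tensorialAt_lieDerivForm (F : R.AdaptedFrame U k ℓ A B)
    {k' : VField (2 * m + 2) M}
    (hν : ∀ X : Fin (m + 1) → VField (2 * m + 2) M, (∀ j, SmoothOn U (X j)) →
      ContMDiffOn (𝓡 (2 * m + 2)) 𝓘(ℝ, ℂ) ∞ (fun x => ν x (fun j => X j x)) U)
    (hx : x ∈ U) (hX : ∀ j, SmoothOn U (X j)) (j : Fin (m + 1)) :
    TensorialAt (𝓡 (2 * m + 2)) (EuclideanSpace ℝ (Fin (2 * m + 2)))
      (fun Y : VField (2 * m + 2) M => lieDerivForm ν k' (Function.update X j Y) x) x where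
  smul {f Y} hf hY := by
    have h1 := F.mdifferentiableAt_update hν hx hX j hY
    have e : (fun y => ν y (Function.update (fun i => X i y) j ((f • Y) y)))
        = f • fun y => ν y (Function.update (fun i => X i y) j (Y y)) := by
      funext y
      exact (ν y).map_update_smul _ _ _ _
    simp only [lieDerivForm_update]
    rw [e, mvfderiv_smul hf h1, VectorField.mlieBracket_smul_right hf hY, add_apply, smul_apply,
      ContinuousLinearMap.smulRight_apply, AlternatingMap.map_update_add,
      AlternatingMap.map_update_smul, AlternatingMap.map_update_smul]
    simp only [Pi.smul_apply', AlternatingMap.map_update_smul, ← Finset.smul_sum]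
    module
  add {Y Y'} hY hY' := by
    have h1 := F.mdifferentiableAt_update hν hx hX j hY
    have h2 := F.mdifferentiableAt_update hν hx hX j hY'
    have e : (fun y => ν y (Function.update (fun i => X i y) j ((Y + Y') y)))
        = (fun y => ν y (Function.update (fun i => X i y) j (Y y)))
          + fun y => ν y (Function.update (fun i => X i y) j (Y' y)) := by
      funext y
      exact (ν y).map_update_add _ _ _ _
    simp only [lieDerivForm_update]
    rw [e, mvfderiv_add h1 h2, VectorField.mlieBracket_add_right hY hY', add_apply,
      AlternatingMap.map_update_add]
    simp only [Pi.add_apply, AlternatingMap.map_update_add, Finset.sum_add_distrib]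
    abel

omit [IsManifold (𝓡 (2 * m + 2)) ∞ M] in
/-- The Lie derivative of `ν`, contracted with a section of `N`. -/
lemma lieDerivForm_section {X₁ X₂ : VField (2 * m + 2) M} {k' : VField (2 * m + 2) M}
    (h1 : MDifferentiableAt (𝓡 (2 * m + 2)) 𝓘(ℝ, ℂ)
      (fun y => ν y (Function.update (fun i => X i y) j (X₁ y))) x)
    (h2 : MDifferentiableAt (𝓡 (2 * m + 2)) 𝓘(ℝ, ℂ)
      (fun y => ν y (Function.update (fun i => X i y) j (X₂ y))) x)
    (hν : ∀ᶠ y in 𝓝 x, ∀ w : Fin (m + 1) → TangentSpace (𝓡 (2 * m + 2)) y,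
      ν y (Function.update w j (X₁ y)) + Complex.I * ν y (Function.update w j (X₂ y)) = 0) :
    lieDerivForm ν k' (Function.update X j X₁) x
        + Complex.I * lieDerivForm ν k' (Function.update X j X₂) x
      = -(ν x (Function.update (fun i => X i x) j
            (VectorField.mlieBracket (𝓡 (2 * m + 2)) k' X₁ x))
          + Complex.I * ν x (Function.update (fun i => X i x) j
            (VectorField.mlieBracket (𝓡 (2 * m + 2)) k' X₂ x))) := by
  have hI : MDifferentiableAt (𝓡 (2 * m + 2)) 𝓘(ℝ, ℂ) (fun y => Complex.I *
      ν y (Function.update (fun i => X i y) j (X₂ y))) x :=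
    MDifferentiableAt.mul mdifferentiableAt_const h2
  have e : mvfderiv (𝓡 (2 * m + 2)) (fun y => ν y (Function.update (fun i => X i y) j (X₁ y))) x
      (k' x) + Complex.I * mvfderiv (𝓡 (2 * m + 2))
        (fun y => ν y (Function.update (fun i => X i y) j (X₂ y))) x (k' x) = 0 := by
    have e1 : mvfderiv (𝓡 (2 * m + 2)) (fun y => ν y (Function.update (fun i => X i y) j (X₁ y))
        + Complex.I * ν y (Function.update (fun i => X i y) j (X₂ y))) x (k' x) = 0 := by
      rw [mvfderiv_congr (f' := fun _ => (0 : ℂ)) (hν.mono fun y hy => hy _), mvfderiv_const]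
      simp
    rw [← mvfderiv_const_mul h2 Complex.I, ← add_apply, ← mvfderiv_add h1 hI]
    exact e1
  rw [lieDerivForm_update, lieDerivForm_update]
  -- The terms in which another slot is bracketed still contain the section of N and vanish.
  have e3 : ∑ i ∈ Finset.univ.erase j, ν x (Function.update (Function.update (fun i => X i x) i
        (VectorField.mlieBracket (𝓡 (2 * m + 2)) k' (X i) x)) j (X₁ x))
      + Complex.I * ∑ i ∈ Finset.univ.erase j, ν x (Function.update (Function.update
        (fun i => X i x) i (VectorField.mlieBracket (𝓡 (2 * m + 2)) k' (X i) x)) j (X₂ x)) = 0 := by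
    rw [Finset.mul_sum, ← Finset.sum_add_distrib]
    exact Finset.sum_eq_zero fun i _ => hν.self_of_nhds _
  linear_combination e - e3

end AlmostRobinson

end Robinson

/-! ### Nearly Robinson structures and preserved Robinson forms. -/

namespace Robinson

namespace AlmostRobinson

variable {m : ℕ} {M : Type*} [TopologicalSpace M]
  [ChartedSpace (EuclideanSpace ℝ (Fin (2 * m + 2))) M] [IsManifold (𝓡 (2 * m + 2)) ∞ M]
  {g : LorentzMetric (2 * m + 2) M} {R : AlmostRobinson g} {x : M} {U W : Set M}
  {k k' ℓ : VField (2 * m + 2) M} {A B : Fin m → VField (2 * m + 2) M}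
  {ν : (x : M) → (TangentSpace (𝓡 (2 * m + 2)) x) [⋀^Fin (m + 1)]→ₗ[ℝ] ℂ}
  {X : Fin (m + 1) → VField (2 * m + 2) M} {Y : VField (2 * m + 2) M}

lemma IsRobinsonForm.annihilates_slot (hν : R.IsRobinsonForm U ν) (hx : x ∈ U)
    {a b : TangentSpace (𝓡 (2 * m + 2)) x} (hab : cvec a b ∈ R.N x)
    (w : Fin (m + 1) → TangentSpace (𝓡 (2 * m + 2)) x) (j : Fin (m + 1)) :
    ν x (Function.update w j a) + Complex.I * ν x (Function.update w j b) = 0 :=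
  annihilates_update (hν.annihilates x hx a b hab) w j

/-- A form that annihilates N is determined by its value on the transverse frame, that is, such
forms make up a line at each point. -/
lemma IsRobinsonForm.transverse_ne_zero (hν : R.IsRobinsonForm W ν) (hUW : U ⊆ W)
    (F : R.AdaptedFrame U k ℓ A B) (hx : x ∈ U) : ν x (fun j => transverse ℓ A j x) ≠ 0 := by
  intro h0
  refine hν.ne_zero x (hUW hx) ?_
  ext w
  have := F.eq_zero_of_slotwise hx (fun X => ν x (fun j => X j x)) (fun X hX j => ?_)
    (fun X σ => (ν x).map_perm (fun j => X j x) σ) h0 (fun j => F.const (w j))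
    (fun j => F.smoothOn_const _)
  · simpa [F.const_self hx] using this
  · refine ⟨(ν x).toMultilinearMap.toLinearMap (fun j => X j x) j,
      fun a b hab => hν.annihilates_slot (hUW hx) hab _ _, fun Y _ => ?_⟩
    simp only [update_apply_field]
    rfl

/-- For a nearly Robinson structure, `𝓛_k ν` is proportional to `ν`. -/
lemma NearlyRobinson.lieDerivForm_eq (H : R.NearlyRobinson) (hν : R.IsRobinsonForm W ν)
    (hUW : U ⊆ W) (F : R.AdaptedFrame U k ℓ A B) (hk' : R.IsOptical U k') (hx : x ∈ U)
    (hX : ∀ j, SmoothOn U (X j)) :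
    lieDerivForm ν k' X x = lieDerivForm ν k' (transverse ℓ A) x
      / ν x (fun j => transverse ℓ A j x) * ν x (fun j => X j x) := by
  have hne := hν.transverse_ne_zero hUW F hx
  have hsm : ∀ X : Fin (m + 1) → VField (2 * m + 2) M, (∀ j, SmoothOn U (X j)) →
      ContMDiffOn (𝓡 (2 * m + 2)) 𝓘(ℝ, ℂ) ∞ (fun x => ν x (fun j => X j x)) U :=
    fun X hX => hν.smooth U X F.isOpen hUW hX
  -- With this factor 𝓛_k ν - cν vanishes on the transverse frame; it annihilates N in each slot
  -- because [k, N] ⊂ N, so it is zero.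
  set c := lieDerivForm ν k' (transverse ℓ A) x / ν x (fun j => transverse ℓ A j x) with hc
  have := F.eq_zero_of_slotwise hx (fun X => lieDerivForm ν k' X x - c * ν x (fun j => X j x))
    (fun X hX j => ?_) (fun X σ => ?_) ?_ X hX
  · exact sub_eq_zero.1 this
  · have ht := F.tensorialAt_lieDerivForm (k' := k') hsm hx hX j
    refine ⟨(TensorialAt.mkHom _ x ht).toLinearMap
      - c • (ν x).toMultilinearMap.toLinearMap (fun j => X j x) j, fun a b hab => ?_, fun Y hY => ?_⟩
    · obtain ⟨V, hV, hxV, X₁, X₂, ⟨h1, h2, hN⟩, rfl, rfl⟩ := R.exists_isSection hab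
      have d1 := h1.diffAt hV hxV
      have d2 := h2.diffAt hV hxV
      have hS := lieDerivForm_section (k' := k') (F.mdifferentiableAt_update hsm hx hX j d1)
        (F.mdifferentiableAt_update hsm hx hX j d2) (by
          filter_upwards [hV.mem_nhds hxV, F.isOpen.mem_nhds hx] with y hyV hyU w
          exact hν.annihilates_slot (hUW hyU) (hN y hyV) w j)
      have hNR := H (U ∩ V) k' X₁ X₂ (F.isOpen.inter hV)
        ⟨hk'.1.mono Set.inter_subset_left, fun y hy => hk'.2 y hy.1⟩
        ⟨h1.mono Set.inter_subset_right, h2.mono Set.inter_subset_right, fun y hy => hN y hy.2⟩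
        x ⟨hx, hxV⟩
      rw [hν.annihilates_slot (hUW hx) hNR, neg_zero] at hS
      have hA := hν.annihilates_slot (hUW hx) hab (fun j => X j x) j
      have e1 := TensorialAt.mkHom_apply ht d1
      have e2 := TensorialAt.mkHom_apply ht d2
      simp only [LinearMap.sub_apply, LinearMap.smul_apply, ContinuousLinearMap.coe_coe, e1, e2,
        smul_eq_mul, MultilinearMap.toLinearMap_apply]
      have hA' : (ν x).toMultilinearMap (Function.update (fun j => X j x) j (X₁ x)) +
        Complex.I * (ν x).toMultilinearMap (Function.update (fun j => X j x) j (X₂ x)) = 0 := hA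
      linear_combination hS - c * hA'
    · simp only [LinearMap.sub_apply, LinearMap.smul_apply, ContinuousLinearMap.coe_coe,
        TensorialAt.mkHom_apply ht (hY.diffAt F.isOpen hx), update_apply_field]
      rfl
  · have := (ν x).map_perm (fun j => X j x) σ
    rw [lieDerivForm_perm, smul_sub, ← mul_smul_comm, ← this]
    rfl
  · rw [hc, div_mul_cancel₀ _ hne, sub_self]

lemma IsRobinsonForm.contMDiffOn_lieDerivForm (hν : R.IsRobinsonForm W ν) (hU : IsOpen U)
    (hUW : U ⊆ W) (hk' : SmoothOn U k') (hX : ∀ j, SmoothOn U (X j)) :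
    ContMDiffOn (𝓡 (2 * m + 2)) 𝓘(ℝ, ℂ) ∞ (lieDerivForm ν k' X) U := by
  have : IsManifold (𝓡 (2 * m + 2)) (minSmoothness ℝ 2) M :=
    IsManifold.of_le (n := ∞) (by
      rw [minSmoothness_of_isRCLikeNormedField]
      exact WithTop.coe_le_coe.2 (le_top : (2 : ℕ∞) ≤ ⊤))
  have : IsManifold (𝓡 (2 * m + 2)) (((⊤ : ℕ∞) : WithTop ℕ∞) + 1) M :=
    IsManifold.of_le (n := ∞) (by simp)
  have hbr : ∀ j, SmoothOn U (VectorField.mlieBracket (𝓡 (2 * m + 2)) k' (X j)) := fun j =>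
    smoothOn_of_smoothAt fun y hy =>
      ContMDiffAt.mlieBracket_vectorField (m := ⊤) (n := ⊤) (hk'.smoothAt hU hy)
        ((hX j).smoothAt hU hy) (by simp)
  refine ContMDiffOn.sub (contMDiffOn_mvfderiv_apply hU (hν.smooth U X hU hUW hX) hk') ?_
  have h : ∀ j, ContMDiffOn (𝓡 (2 * m + 2)) 𝓘(ℝ, ℂ) ∞ (fun y => ν y (Function.update
      (fun i => X i y) j (VectorField.mlieBracket (𝓡 (2 * m + 2)) k' (X j) y))) U := fun j => by
    simp only [← update_apply_field]
    refine hν.smooth U _ hU hUW fun i => ?_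
    rcases eq_or_ne i j with rfl | h
    · rw [Function.update_self]; exact hbr i
    · rw [Function.update_of_ne h]; exact hX i
  exact contMDiffOn_finsetSum fun j _ => h j

lemma NearlyRobinson.formsPreserved (H : R.NearlyRobinson) : R.FormsPreserved := by
  intro U ν k' hU hν hk'
  -- The property that characterises the factor at a point. Locally it is satisfied exactly by one
  -- smooth quotient, so a pointwise choice is automatically smooth on all of U.
  let P : M → ℂ → Prop := fun x c => ∀ (W : Set M) (X : Fin (m + 1) → VField (2 * m + 2) M),
    IsOpen W → W ⊆ U → (∀ j, SmoothOn W (X j)) → x ∈ W →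
      lieDerivForm ν k' X x = c * ν x (fun j => X j x)
  have key : ∀ x ∈ U, ∃ V ⊆ U, IsOpen V ∧ x ∈ V ∧ ∃ f : M → ℂ,
      ContMDiffOn (𝓡 (2 * m + 2)) 𝓘(ℝ, ℂ) ∞ f V ∧ ∀ y ∈ V, P y (f y) ∧ ∀ c, P y c → c = f y := by
    intro x hx
    obtain ⟨V, k, ℓ, A, B, hxV, F⟩ := R.exists_adaptedFrame_at x
    have hUV := hU.inter F.isOpen
    have F' := F.mono hUV Set.inter_subset_right
    have hs : (U ∩ V) ⊆ U := Set.inter_subset_left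
    refine ⟨U ∩ V, hs, hUV, ⟨hx, hxV⟩, fun y => lieDerivForm ν k' (transverse ℓ A) y
      / ν y (fun j => transverse ℓ A j y), ?_, fun y hy => ⟨?_, fun c hc => ?_⟩⟩
    · have h1 := hν.contMDiffOn_lieDerivForm hUV hs (hk'.1.mono hs) F'.smoothOn_transverse
      have h2 := hν.smooth _ _ hUV hs F'.smoothOn_transverse
      have h3 : ContMDiffOn (𝓡 (2 * m + 2)) 𝓘(ℝ, ℂ) ∞
          (fun y => (ν y (fun j => transverse ℓ A j y))⁻¹) (U ∩ V) := fun y hy =>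
        ((contDiffAt_inv ℝ (hν.transverse_ne_zero hs F' hy)).contMDiffAt
          (n := ∞)).comp_contMDiffWithinAt y (h2 y hy)
      simp only [div_eq_mul_inv]
      exact (contDiff_mul (𝕜 := ℝ) (𝔸 := ℂ)).contMDiff.comp_contMDiffOn (h1.prodMk_space h3)
    · intro W X hW hWU hX hyW
      have hO := hW.inter hUV
      have F'' := F'.mono hO Set.inter_subset_right
      exact H.lieDerivForm_eq hν (Set.inter_subset_left.trans hWU) F''
        ⟨hk'.1.mono (Set.inter_subset_left.trans hWU), fun z hz => hk'.2 z (hWU hz.1)⟩ ⟨hyW, hy⟩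
        fun j => (hX j).mono Set.inter_subset_left
    · rw [eq_div_iff (hν.transverse_ne_zero hs F' hy)]
      exact (hc _ _ hUV hs F'.smoothOn_transverse hy).symm
  refine ⟨fun x => Classical.epsilon (P x), fun x hx => ?_, fun W X hW hWU hX x hx => ?_⟩
  · obtain ⟨V, hVU, hV, hxV, f, hf, hP⟩ := key x hx
    refine ((hf.contMDiffAt (hV.mem_nhds hxV)).congr_of_eventuallyEq ?_).contMDiffWithinAt
    filter_upwards [hV.mem_nhds hxV] with y hy
    exact (hP y hy).2 _ (Classical.epsilon_spec ⟨_, (hP y hy).1⟩)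
  · obtain ⟨V, hVU, hV, hxV, f, hf, hP⟩ := key x (hWU hx)
    exact Classical.epsilon_spec (p := P x) ⟨_, (hP x hxV).1⟩ W X hW hWU hX hx

lemma contDiff_det {q : ℕ} :
    ContDiff ℝ ∞ (fun r : Fin q → Fin q → ℂ => Matrix.detRowAlternating (R := ℂ) r) := by
  have e : (fun r : Fin q → Fin q → ℂ => Matrix.detRowAlternating (R := ℂ) r)
      = fun r => ∑ σ : Equiv.Perm (Fin q), ((Equiv.Perm.sign σ : ℤ) : ℂ) * ∏ i, r (σ i) i := by
    funext r
    exact Matrix.det_apply' _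
  rw [e]
  fun_prop

/-- The complex Robinson form of an adapted frame. -/
def AdaptedFrame.form (F : R.AdaptedFrame U k ℓ A B) (x : M) :
    (TangentSpace (𝓡 (2 * m + 2)) x) [⋀^Fin (m + 1)]→ₗ[ℝ] ℂ where
  toMultilinearMap := (MultilinearMap.restrictScalars ℝ
    (Matrix.detRowAlternating (n := Fin (m + 1)) (R := ℂ)).toMultilinearMap).compLinearMap
    fun _ => F.coframe x
  map_eq_zero_of_eq' v i j h hij := by
    refine (Matrix.detRowAlternating (n := Fin (m + 1)) (R := ℂ)).map_eq_zero_of_eq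
      (fun j => F.coframe x (v j)) ?_ hij
    simp only [h]

namespace AdaptedFrame

lemma form_apply (F : R.AdaptedFrame U k ℓ A B) (w : Fin (m + 1) → TangentSpace (𝓡 (2 * m + 2)) x) :
    F.form x w = Matrix.detRowAlternating (fun j => F.coframe x (w j)) := rfl

lemma isRobinsonForm_form (F : R.AdaptedFrame U k ℓ A B) : R.IsRobinsonForm U F.form where
  smooth W X hW hWU hX := by
    have h : ContMDiffOn (𝓡 (2 * m + 2)) 𝓘(ℝ, Fin (m + 1) → Fin (m + 1) → ℂ) ∞
        (fun y i => F.coframe y (X i y)) W := ?_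
    · exact contDiff_det.contMDiff.comp_contMDiffOn h
    rw [contMDiffOn_pi_space]
    intro i
    rw [contMDiffOn_pi_space]
    have hA : ∀ j, ContMDiffOn (𝓡 (2 * m + 2)) 𝓘(ℝ) ∞ (fun y => F.coA j y (X i y)) W :=
      fun j y hy => (contMDiffAt_coeff F.frame F.isOpen (hWU hy) _
        ((hX i).smoothAt hW hy)).contMDiffWithinAt
    have hB : ∀ j, ContMDiffOn (𝓡 (2 * m + 2)) 𝓘(ℝ) ∞ (fun y => F.coB j y (X i y)) W :=
      fun j y hy => (contMDiffAt_coeff F.frame F.isOpen (hWU hy) _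
        ((hX i).smoothAt hW hy)).contMDiffWithinAt
    have hk : ContMDiffOn (𝓡 (2 * m + 2)) 𝓘(ℝ) ∞ (fun y => g.pair k (X i) y) W :=
      fun y hy => (g.contMDiffAt_pair (F.splitting.1.smoothAt F.isOpen (hWU hy))
        ((hX i).smoothAt hW hy)).contMDiffWithinAt
    refine Fin.cases ?_ fun j => ?_
    · exact Complex.ofRealCLM.contDiff.contMDiff.comp_contMDiffOn hk
    · simp only [coframe_succ]
      exact (Complex.ofRealCLM.contDiff.contMDiff.comp_contMDiffOn (hA j)).add
        ((ContinuousLinearMap.mul ℝ ℂ Complex.I ∘L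
          Complex.ofRealCLM).contDiff.contMDiff.comp_contMDiffOn (hB j))
  ne_zero x hx h := by
    have := F.form_apply (x := x) (fun j => transverse ℓ A j x)
    have e : (fun j => F.coframe x (transverse ℓ A j x)) = (1 : Matrix _ _ ℂ) := by
      funext i j
      rw [F.coframe_transverse hx, Matrix.one_apply]
    rw [h, e] at this
    have h1 : Matrix.detRowAlternating (1 : Matrix (Fin (m + 1)) (Fin (m + 1)) ℂ) = 1 :=
      Matrix.det_one
    rw [h1] at this
    exact zero_ne_one this
  annihilates x hx a b hab w := by
    have h : F.coframe x a = -Complex.I • F.coframe x b := by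
      funext j
      have := (F.mem_N_iff_coframe hx).1 hab j
      simp only [Pi.smul_apply, smul_eq_mul]
      linear_combination this
    have e : ∀ c, (fun j => F.coframe x (Fin.cons (α := fun _ => TangentSpace (𝓡 (2 * m + 2)) x) c w j))
        = Function.update (fun j => F.coframe x (Fin.cons
          (α := fun _ => TangentSpace (𝓡 (2 * m + 2)) x) 0 w j))
          0 (F.coframe x c) := by
      intro c
      funext j
      refine Fin.cases ?_ (fun j => ?_) j <;> simp
    rw [F.form_apply, F.form_apply, e a, e b, h, AlternatingMap.map_update_smul, smul_eq_mul]
    ring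

/-- The matrix is the identity with row j replaced, and its determinant is the j-th entry of that
row. So contractions of the form recover every component of the coframe. -/
lemma form_update (F : R.AdaptedFrame U k ℓ A B) (hx : x ∈ U) (j : Fin (m + 1))
    (v : TangentSpace (𝓡 (2 * m + 2)) x) :
    F.form x (Function.update (fun i => transverse ℓ A i x) j v) = F.coframe x v j := by
  have e : (fun i => F.coframe x (Function.update (fun i => transverse ℓ A i x) j v i))
      = Matrix.updateRow (1 : Matrix _ _ ℂ) j (F.coframe x v) := by
    funext i i'
    rcases eq_or_ne i j with rfl | h
    · simp
    · rw [Function.update_of_ne h, F.coframe_transverse hx, Matrix.updateRow_ne h,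
        Matrix.one_apply]
  rw [F.form_apply, e]
  have := Matrix.cramer_transpose_apply (1 : Matrix (Fin (m + 1)) (Fin (m + 1)) ℂ)
    (F.coframe x v) j
  rw [Matrix.transpose_one, Matrix.cramer_one] at this
  exact this.symm

end AdaptedFrame

lemma FormsPreserved.nearlyRobinson (H : R.FormsPreserved) : R.NearlyRobinson := by
  intro U k' X Y hU hk' hN x hx
  obtain ⟨V, k, ℓ, A, B, hxV, F⟩ := R.exists_adaptedFrame_at x
  have hUV := hU.inter F.isOpen
  have F' := F.mono hUV Set.inter_subset_right
  have hs : U ∩ V ⊆ U := Set.inter_subset_left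
  have hx' : x ∈ U ∩ V := ⟨hx, hxV⟩
  have hν := F'.isRobinsonForm_form
  obtain ⟨f, -, hf⟩ := H (U ∩ V) F'.form k' hUV hν ⟨hk'.1.mono hs, fun y hy => hk'.2 y hy.1⟩
  have hV := F'.smoothOn_transverse
  rw [F'.mem_N_iff_coframe hx']
  intro j
  have hsm : ∀ Z, SmoothOn U Z → ∀ i, SmoothOn (U ∩ V) (Function.update (transverse ℓ A) j Z i) := by
    intro Z hZ i
    rcases eq_or_ne i j with rfl | h
    · rw [Function.update_self]; exact hZ.mono hs
    · rw [Function.update_of_ne h]; exact hV i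
  have e1 := hf _ _ hUV subset_rfl (hsm X hN.1) x hx'
  have e2 := hf _ _ hUV subset_rfl (hsm Y hN.2.1) x hx'
  have hd : ∀ X : Fin (m + 1) → VField (2 * m + 2) M, (∀ j, SmoothOn (U ∩ V) (X j)) →
      ContMDiffOn (𝓡 (2 * m + 2)) 𝓘(ℝ, ℂ) ∞ (fun x => F'.form x (fun j => X j x)) (U ∩ V) :=
    fun X hX => hν.smooth _ X hUV subset_rfl hX
  -- The contraction of 𝓛_k ν = fν with z in N vanishes on the right and equals the contraction of
  -- -ν with [k, z] on the left. The transverse frame in the other slots isolates the j-th coframe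
  -- component of [k, z].
  have hS := lieDerivForm_section (k' := k')
    (F'.mdifferentiableAt_update hd hx' hV j (hN.1.diffAt hU hx))
    (F'.mdifferentiableAt_update hd hx' hV j (hN.2.1.diffAt hU hx)) (by
      filter_upwards [hUV.mem_nhds hx'] with y hy w
      exact hν.annihilates_slot hy (hN.2.2 y hy.1) w j)
  have hA := hν.annihilates_slot hx' (hN.2.2 x hx) (fun j => transverse ℓ A j x) j
  rw [update_apply_field] at e1 e2
  rw [e1, e2] at hS
  simp only [F'.form_update hx'] at hS hA
  linear_combination hS - f x * hA

end AlmostRobinson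

end Robinson

/-! ### The Lie bracket as a commutator of derivations. -/

namespace Robinson

section Charts

variable {n : ℕ} {M : Type*} [TopologicalSpace M] [ChartedSpace (EuclideanSpace ℝ (Fin n)) M]
  [IsManifold (𝓡 n) ∞ M] {F : Type*} [NormedAddCommGroup F] [NormedSpace ℝ F] {x y : M}

lemma mfderiv_extChartAt_eq_triv (hy : y ∈ (extChartAt (𝓡 n) x).source)
    (v : TangentSpace (𝓡 n) y) :
    mfderiv (𝓡 n) 𝓘(ℝ, EuclideanSpace ℝ (Fin n)) (extChartAt (𝓡 n) x) y v = triv x y v := by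
  have : IsManifold (𝓡 n) 1 M := IsManifold.of_le (n := ∞) (by simp)
  rw [extChartAt_source] at hy
  rw [← TangentBundle.continuousLinearMapAt_trivializationAt hy]
  exact Bundle.Trivialization.continuousLinearMapAt_apply_of_mem (R := ℝ)
    (F := EuclideanSpace ℝ (Fin n)) _ hy v

lemma mdifferentiableAt_comp_extChartAt_symm {f : M → F}
    (hf : MDifferentiableAt (𝓡 n) 𝓘(ℝ, F) f y) (hy : y ∈ (extChartAt (𝓡 n) x).source) :
    DifferentiableAt ℝ (f ∘ (extChartAt (𝓡 n) x).symm) (extChartAt (𝓡 n) x y) := by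
  have : IsManifold (𝓡 n) 1 M := IsManifold.of_le (n := ∞) (by simp)
  have h1 := mdifferentiableWithinAt_extChartAt_symm (I := 𝓡 n)
    ((extChartAt (𝓡 n) x).map_source hy)
  rw [modelWithCornersSelf_coe, Set.range_id, mdifferentiableWithinAt_univ] at h1
  rw [← mdifferentiableAt_iff_differentiableAt]
  refine MDifferentiableAt.comp _ ?_ h1
  rwa [(extChartAt (𝓡 n) x).left_inv hy]

lemma fderiv_comp_extChartAt_symm {f : M → F}
    (hf : MDifferentiableAt (𝓡 n) 𝓘(ℝ, F) f y) (hy : y ∈ (extChartAt (𝓡 n) x).source)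
    (v : TangentSpace (𝓡 n) y) :
    fderiv ℝ (f ∘ (extChartAt (𝓡 n) x).symm) (extChartAt (𝓡 n) x y) (triv x y v)
      = mvfderiv (𝓡 n) f y v := by
  have : IsManifold (𝓡 n) 1 M := IsManifold.of_le (n := ∞) (by simp)
  have e : f =ᶠ[𝓝 y] (f ∘ (extChartAt (𝓡 n) x).symm) ∘ extChartAt (𝓡 n) x := by
    filter_upwards [(isOpen_extChartAt_source x).mem_nhds hy] with z hz
    simp only [Function.comp_apply, (extChartAt (𝓡 n) x).left_inv hz]
  have h1 := mfderiv_comp_apply (I := 𝓡 n) (I' := 𝓘(ℝ, EuclideanSpace ℝ (Fin n)))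
    (I'' := 𝓘(ℝ, F)) (f := extChartAt (𝓡 n) x) (g := f ∘ (extChartAt (𝓡 n) x).symm) y
    (mdifferentiableAt_comp_extChartAt_symm hf hy).mdifferentiableAt
    (mdifferentiableAt_extChartAt (by rwa [extChartAt_source] at hy)) v
  rw [mfderiv_extChartAt_eq_triv hy, mfderiv_eq_fderiv] at h1
  refine h1.symm.trans ?_
  rw [mvfderiv_congr e]
  rfl

/-- The Lie bracket acts on functions as the commutator. -/
lemma mvfderiv_mlieBracket {f : M → F} (hf : ContMDiffAt (𝓡 n) 𝓘(ℝ, F) ∞ f x)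
    {X Y : VField n M} (hX : DiffAt X x) (hY : DiffAt Y x)
    (hfX : MDifferentiableAt (𝓡 n) 𝓘(ℝ, F) (fun y => mvfderiv (𝓡 n) f y (X y)) x)
    (hfY : MDifferentiableAt (𝓡 n) 𝓘(ℝ, F) (fun y => mvfderiv (𝓡 n) f y (Y y)) x) :
    mvfderiv (𝓡 n) f x (VectorField.mlieBracket (𝓡 n) X Y x)
      = mvfderiv (𝓡 n) (fun y => mvfderiv (𝓡 n) f y (Y y)) x (X x)
        - mvfderiv (𝓡 n) (fun y => mvfderiv (𝓡 n) f y (X y)) x (Y x) := by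
  have : IsManifold (𝓡 n) 1 M := IsManifold.of_le (n := ∞) (by simp)
  have : IsManifold (𝓡 n) 2 M :=
    IsManifold.of_le (n := ∞) (WithTop.coe_le_coe.2 (le_top : (2 : ℕ∞) ≤ ⊤))
  have hx := mem_extChartAt_source (I := 𝓡 n) x
  have hfe : ∀ᶠ y in 𝓝 x, MDifferentiableAt (𝓡 n) 𝓘(ℝ, F) f y := by
    filter_upwards [contMDiffAt_iff_contMDiffAt_nhds (n := 1) (by simp) |>.1 (ContMDiffAt.of_le hf (by simp))] with y hy
    exact hy.mdifferentiableAt (by simp)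
  have hr : Set.range (𝓡 n) = Set.univ := Set.range_id
  set φ := extChartAt (𝓡 n) x with hφ
  -- T X is the field X written in the chart around x; after this translation the claim is the
  -- formula in a vector space.
  let T : (X : VField n M) → EuclideanSpace ℝ (Fin n) → EuclideanSpace ℝ (Fin n) := fun X =>
    VectorField.mpullbackWithin 𝓘(ℝ, EuclideanSpace ℝ (Fin n)) (𝓡 n) φ.symm X (Set.range (𝓡 n))
  have hT : ∀ (X : VField n M) y, y ∈ φ.source → T X (φ y) = triv x y (X y) := by
    intro X y hy
    have h2 := mfderivWithin_extChartAt_symm_comp_mfderiv_extChartAt' (I := 𝓡 n) hy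
    have h3 := isInvertible_mfderivWithin_extChartAt_symm (I := 𝓡 n) (φ.map_source hy)
    have h4 : mfderivWithin 𝓘(ℝ, EuclideanSpace ℝ (Fin n)) (𝓡 n) φ.symm (Set.range (𝓡 n)) (φ y)
        (triv x y (X y)) = X y := by
      rw [← mfderiv_extChartAt_eq_triv hy]
      exact congrArg (fun A => A (X y)) h2
    have h5 : T X (φ y) = (mfderivWithin 𝓘(ℝ, EuclideanSpace ℝ (Fin n)) (𝓡 n) φ.symm
        (Set.range (𝓡 n)) (φ y)).inverse (X (φ.symm (φ y))) := rfl
    rw [h5]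
    obtain ⟨e, he⟩ := h3
    rw [φ.left_inv hy]
    change (mfderivWithin 𝓘(ℝ, EuclideanSpace ℝ (Fin n)) (𝓡 n) φ.symm
        (Set.range (𝓡 n)) (φ y)).inverse (X y) = _
    conv_lhs => rw [← h4]
    rw [← he, ContinuousLinearMap.inverse_equiv]
    exact e.symm_apply_apply _
  have hTd : ∀ {X : VField n M}, DiffAt X x → DifferentiableAt ℝ (T X) (φ x) := by
    intro X hX
    have := MDifferentiableWithinAt.differentiableWithinAt_mpullbackWithin_vectorField
      (s := Set.univ) (V := X) (x := x) (I := 𝓡 n) (by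
        rw [mdifferentiableWithinAt_univ]; exact hX)
    rw [Set.preimage_univ, Set.univ_inter, hr] at this
    have h10 := differentiableWithinAt_univ.1 this
    simp only [T, hr]
    exact h10
  have hb : triv x x (VectorField.mlieBracket (𝓡 n) X Y x)
      = VectorField.lieBracket ℝ (T X) (T Y) (φ x) := by
    rw [← VectorField.mlieBracketWithin_univ, VectorField.mlieBracketWithin_apply,
      ← mfderiv_extChartAt_eq_triv hx]
    obtain ⟨e, he⟩ := isInvertible_mfderiv_extChartAt (I := 𝓡 n) hx
    rw [← he, ContinuousLinearMap.inverse_equiv]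
    refine (e.apply_symm_apply _).trans ?_
    rw [Set.preimage_univ, Set.univ_inter, ← VectorField.lieBracketWithin_univ]
    simp only [T, hr]
    rfl
  have hder : ∀ {X Y : VField n M},
      MDifferentiableAt (𝓡 n) 𝓘(ℝ, F) (fun y => mvfderiv (𝓡 n) f y (Y y)) x →
      fderiv ℝ (fun z => fderiv ℝ (f ∘ φ.symm) z (T Y z)) (φ x) (T X (φ x))
        = mvfderiv (𝓡 n) (fun y => mvfderiv (𝓡 n) f y (Y y)) x (X x) := by
    intro X Y h
    rw [hT X x hx, ← fderiv_comp_extChartAt_symm h hx]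
    refine congrArg (fun A : _ →L[ℝ] F => A (triv x x (X x))) (Filter.EventuallyEq.fderiv_eq ?_)
    have h6 : ∀ᶠ z in 𝓝 (φ x), z ∈ φ.target := extChartAt_target_mem_nhds x
    have h7 : ∀ᶠ z in 𝓝 (φ x), MDifferentiableAt (𝓡 n) 𝓘(ℝ, F) f (φ.symm z) := by
      have := (continuousAt_extChartAt_symm (I := 𝓡 n) x).tendsto
      rw [extChartAt_to_inv] at this
      exact this.eventually hfe
    filter_upwards [h6, h7] with z hz hz'
    have h8 := φ.map_target hz
    have h9 := fderiv_comp_extChartAt_symm hz' h8 (Y (φ.symm z))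
    rw [← hφ, ← hT Y _ h8, φ.right_inv hz] at h9
    exact h9
  rw [← fderiv_comp_extChartAt_symm hfe.self_of_nhds hx, hb, VectorField.fderiv_apply_lieBracket
    (n := ∞) ?_ ?_ (hTd hY) (hTd hX), hder hfY, hder hfX]
  · have := contMDiffAt_iff_contDiffAt.1 (ContMDiffAt.comp (φ x) (by
      rwa [extChartAt_to_inv]) ((contMDiffOn_extChartAt_symm (n := ∞) (I := 𝓡 n) x).contMDiffAt
        (extChartAt_target_mem_nhds x)) (g := f))
    exact this
  · rw [minSmoothness_of_isRCLikeNormedField]; exact WithTop.coe_le_coe.2 (le_top : (2:ℕ∞) ≤ ⊤)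

end Charts

end Robinson

/-! ### Smooth fields of endomorphisms. -/

namespace Robinson

section Calculus

variable {n : ℕ} {M : Type*} [TopologicalSpace M] [ChartedSpace (EuclideanSpace ℝ (Fin n)) M]
  [IsManifold (𝓡 n) ∞ M] {F F' : Type*} [NormedAddCommGroup F] [NormedSpace ℝ F]
  [NormedAddCommGroup F'] [NormedSpace ℝ F'] {x : M}

lemma mvfderiv_clm_apply {A : M → F →L[ℝ] F'} {f : M → F}
    (hA : MDifferentiableAt (𝓡 n) 𝓘(ℝ, F →L[ℝ] F') A x)
    (hf : MDifferentiableAt (𝓡 n) 𝓘(ℝ, F) f x) (v : TangentSpace (𝓡 n) x) :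
    mvfderiv (𝓡 n) (fun y => A y (f y)) x v
      = mvfderiv (𝓡 n) A x v (f x) + A x (mvfderiv (𝓡 n) f x v) := by
  have hx := mem_extChartAt_source (I := 𝓡 n) x
  rw [← fderiv_comp_extChartAt_symm hA hx, ← fderiv_comp_extChartAt_symm hf hx,
    ← fderiv_comp_extChartAt_symm (hA.clm_apply hf) hx]
  have h := fderiv_clm_apply (mdifferentiableAt_comp_extChartAt_symm hA hx)
    (mdifferentiableAt_comp_extChartAt_symm hf hx)
  refine (congrArg (fun B : _ →L[ℝ] F' => B (triv x x v)) h).trans ?_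
  simp only [add_apply, ContinuousLinearMap.comp_apply, ContinuousLinearMap.flip_apply,
    Function.comp_apply, extChartAt_to_inv]
  exact add_comm _ _

omit [IsManifold (𝓡 n) ∞ M] in
/-- A smooth family of bases determines a smooth family of endomorphisms by its values. -/
lemma exists_clm_of_basis [FiniteDimensional ℝ F] {ι : Type*} [Fintype ι] {a s : ι → M → F}
    {W : Set M} (hW : IsOpen W) (hx : x ∈ W) (ha : ∀ i, ContMDiffOn (𝓡 n) 𝓘(ℝ, F) ∞ (a i) W)
    (hs : ∀ i, ContMDiffOn (𝓡 n) 𝓘(ℝ, F) ∞ (s i) W)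
    (hli : LinearIndependent ℝ (fun i => a i x))
    (hcard : Fintype.card ι = Module.finrank ℝ F) :
    ∃ V ⊆ W, IsOpen V ∧ x ∈ V ∧ ∃ A : M → F →L[ℝ] F,
      ContMDiffOn (𝓡 n) 𝓘(ℝ, F →L[ℝ] F) ∞ A V ∧
      ∀ y ∈ V, LinearIndependent ℝ (fun i => a i y) ∧ ∀ i, A y (a i y) = s i y := by
  have := FiniteDimensional.complete ℝ F
  let b : Module.Basis ι ℝ F :=
    Module.Basis.mk hli (hli.span_eq_top_of_card_eq_finrank' hcard).ge
  have hb : ∀ i, b i = a i x := fun i => Module.Basis.mk_apply _ _ i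
  -- T a y sends the basis at x to the family a at y. The required endomorphism is T s composed with
  -- the inverse of T a, on the open set where T a is invertible.
  let T : (ι → M → F) → M → F →L[ℝ] F := fun a y =>
    ∑ i, (LinearMap.toContinuousLinearMap (b.coord i)).smulRight (a i y)
  have hTb : ∀ a y i, T a y (b i) = a i y := by
    classical
    intro a y i
    simp [T, Finsupp.single_apply]
  have hT : ∀ {a : ι → M → F}, (∀ i, ContMDiffOn (𝓡 n) 𝓘(ℝ, F) ∞ (a i) W) →
      ContMDiffOn (𝓡 n) 𝓘(ℝ, F →L[ℝ] F) ∞ (T a) W := by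
    intro a ha
    refine contMDiffOn_finsetSum fun i _ => ?_
    exact ((ContinuousLinearMap.smulRightL ℝ F F (LinearMap.toContinuousLinearMap
      (b.coord i))).contDiff.contMDiff).comp_contMDiffOn (ha i)
  have hTx : T a x = 1 := by
    refine ContinuousLinearMap.coe_injective (b.ext fun i => ?_)
    exact (hTb a x i).trans (hb i).symm
  refine ⟨W ∩ T a ⁻¹' {A | IsUnit A}, Set.inter_subset_left,
    (hT ha).continuousOn.isOpen_inter_preimage hW Units.isOpen,
    ⟨hx, by rw [Set.mem_preimage, hTx]; exact isUnit_one⟩,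
    fun y => T s y * Ring.inverse (T a y), fun y hy => ?_, fun y hy => ?_⟩
  · have h1 := (hT ha).contMDiffAt (hW.mem_nhds hy.1)
    have h2 := (hT hs).contMDiffAt (hW.mem_nhds hy.1)
    obtain ⟨u, hu⟩ := hy.2
    have h3 := contDiffAt_ringInverse ℝ (n := ∞) u
    rw [hu] at h3
    have h4 := h3.contMDiffAt.comp y h1
    exact (h2.clm_comp h4).contMDiffWithinAt
  · obtain ⟨u, hu⟩ : IsUnit (T a y) := hy.2
    have h5 : ∀ v, Ring.inverse (T a y) (T a y v) = v := fun v => by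
      rw [← mul_apply_eq_comp, Ring.inverse_mul_cancel _ ⟨u, hu⟩]; rfl
    refine ⟨?_, fun i => ?_⟩
    · have h6 : LinearIndependent ℝ (fun i => T a y (b i)) :=
        b.linearIndependent.map' (T a y).toLinearMap
          (LinearMap.ker_eq_bot.2 (Function.LeftInverse.injective h5))
      simpa only [hTb] using h6
    · rw [mul_apply_eq_comp, ← hTb a y i, h5, hTb]

lemma contMDiffOn_triv {X : VField n M} {U : Set M} (hU : IsOpen U)
    (hUx : U ⊆ (extChartAt (𝓡 n) x).source) :
    ContMDiffOn (𝓡 n) 𝓘(ℝ, EuclideanSpace ℝ (Fin n)) ∞ (fun y => triv x y (X y)) U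
      ↔ SmoothOn U X := by
  rw [extChartAt_source] at hUx
  exact (Bundle.Trivialization.contMDiffOn_section_iff (IB := 𝓡 n)
    (trivializationAt (EuclideanSpace ℝ (Fin n)) (TangentSpace (𝓡 n)) x) hU hUx).symm

lemma exists_triv_linearEquiv {y : M} (hy : y ∈ (extChartAt (𝓡 n) x).source) :
    ∃ φ : TangentSpace (𝓡 n) y ≃ₗ[ℝ] EuclideanSpace ℝ (Fin n), ∀ v, triv x y v = φ v := by
  rw [extChartAt_source] at hy
  exact ⟨(trivializationAt (EuclideanSpace ℝ (Fin n)) (TangentSpace (𝓡 n) (M := M))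
    x).linearEquivAt ℝ y hy, fun v => rfl⟩

end Calculus

/-! ### Almost CR structures as fields of endomorphisms. -/

section Leaf

variable {m : ℕ} {L : Type*} [TopologicalSpace L]
  [ChartedSpace (EuclideanSpace ℝ (Fin (2 * m + 1))) L] [IsManifold (𝓡 (2 * m + 1)) ∞ L]

/-- An almost CR structure is locally described by a smooth field of endomorphisms. -/
lemma AlmostCR.exists_clm (C : AlmostCR m L) (y₀ : L) :
    ∃ V : Set L, IsOpen V ∧ y₀ ∈ V ∧ V ⊆ (extChartAt (𝓡 (2 * m + 1)) y₀).source ∧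
    ∃ A : L → EuclideanSpace ℝ (Fin (2 * m + 1)) →L[ℝ] EuclideanSpace ℝ (Fin (2 * m + 1)),
      ContMDiffOn (𝓡 (2 * m + 1)) 𝓘(ℝ, EuclideanSpace ℝ (Fin (2 * m + 1)) →L[ℝ]
        EuclideanSpace ℝ (Fin (2 * m + 1))) ∞ A V ∧
      ∀ y ∈ V, ∀ a b : TangentSpace (𝓡 (2 * m + 1)) y, cvec a b ∈ C.zeroOne y ↔
        triv y₀ y b = A y (triv y₀ y a) ∧ A y (A y (triv y₀ y a)) = -triv y₀ y a := by
  obtain ⟨U, hU, hy₀, e, he, heH⟩ := C.H_frame y₀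
  have hsrc := isOpen_extChartAt_source (I := 𝓡 (2 * m + 1)) y₀
  have hmem : ∀ y ∈ U, ∀ j, e j y ∈ C.H y := fun y hy j =>
    (heH y hy).2 ▸ Submodule.subset_span ⟨j, rfl⟩
  classical
  let Y : Fin (2 * m) → VField (2 * m + 1) L := fun j y =>
    if h : y ∈ U then (C.J y ⟨e j y, hmem y h j⟩ : TangentSpace (𝓡 (2 * m + 1)) y) else 0
  have hYe : ∀ y (h : y ∈ U) j, Y j y = C.J y ⟨e j y, hmem y h j⟩ := fun y h j => dif_pos h
  have hY : ∀ j, SmoothOn U (Y j) := fun j =>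
    C.J_smooth U (e j) (Y j) hU (he j) fun y hy => ⟨hmem y hy j, (hYe y hy j).symm⟩
  set W := U ∩ (extChartAt (𝓡 (2 * m + 1)) y₀).source with hWdef
  have hW : IsOpen W := hU.inter hsrc
  have hy₀W : y₀ ∈ W := ⟨hy₀, mem_extChartAt_source y₀⟩
  obtain ⟨φ, hφ⟩ := exists_triv_linearEquiv (n := 2 * m + 1) hy₀W.2
  -- A fixed vector c completes the frame of H and is sent to zero. The extension A of J then has
  -- range in H, so A²u = -u holds exactly for u in H, and H is encoded by A alone.
  obtain ⟨c, hc⟩ := exists_linearIndependent_cons_of_lt_finrank (R := ℝ)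
    (v := fun j => triv y₀ y₀ (e j y₀)) (by
      simp only [hφ]
      exact (heH y₀ hy₀).1.map' φ.toLinearMap (LinearMap.ker_eq_bot.2 φ.injective))
    (by simp)
  let a : Fin (2 * m + 1) → L → EuclideanSpace ℝ (Fin (2 * m + 1)) :=
    Fin.cons (fun _ => c) fun j y => triv y₀ y (e j y)
  let s : Fin (2 * m + 1) → L → EuclideanSpace ℝ (Fin (2 * m + 1)) :=
    Fin.cons (fun _ => 0) fun j y => triv y₀ y (Y j y)
  obtain ⟨V, hVW, hV, hy₀V, A, hA, hAa⟩ := exists_clm_of_basis (n := 2 * m + 1) (a := a) (s := s)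
    hW hy₀W
    (fun i => by
      refine Fin.cases ?_ (fun j => ?_) i
      · exact contMDiffOn_const
      · exact (contMDiffOn_triv hW Set.inter_subset_right).2 ((he j).mono Set.inter_subset_left))
    (fun i => by
      refine Fin.cases ?_ (fun j => ?_) i
      · exact contMDiffOn_const
      · exact (contMDiffOn_triv hW Set.inter_subset_right).2 ((hY j).mono Set.inter_subset_left))
    (by
      have : (fun i => a i y₀) = Fin.cons c fun j => triv y₀ y₀ (e j y₀) :=
        funext fun i => Fin.cases rfl (fun j => rfl) i
      rw [this]
      exact hc)
    (by simp)
  refine ⟨V, hV, hy₀V, fun y hy => (hVW hy).2, A, hA, fun y hy u v => ?_⟩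
  obtain ⟨ψ, hψ⟩ := exists_triv_linearEquiv (n := 2 * m + 1) (hVW hy).2
  have hyU := (hVW hy).1
  have hAc : A y c = 0 := (hAa y hy).2 0
  have hAe : ∀ j, A y (ψ (e j y)) = ψ (Y j y) := fun j => by
    have := (hAa y hy).2 j.succ
    simp only [a, s, Fin.cons_succ, hψ] at this
    exact this
  have hAJ : ∀ w : C.H y, A y (ψ w) = ψ (C.J y w) := by
    rintro ⟨w, hw⟩
    have hw' := hw
    rw [← (heH y hyU).2, Submodule.mem_span_range_iff_exists_fun] at hw'
    obtain ⟨r, hr⟩ := hw'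
    have : (⟨w, hw⟩ : C.H y) = ∑ j, r j • ⟨e j y, hmem y hyU j⟩ := by
      ext1
      simp [hr]
    rw [this]
    simp only [Submodule.coe_sum, Submodule.coe_smul, map_sum, map_smul, hAe, hYe y hyU]
  have hrange : ∀ w, ∃ w' : C.H y, A y w = ψ w' := by
    intro w
    have hsp := (hAa y hy).1.span_eq_top_of_card_eq_finrank' (by simp)
    have hw : w ∈ Submodule.span ℝ (Set.range fun i => a i y) := hsp ▸ Submodule.mem_top
    rw [Submodule.mem_span_range_iff_exists_fun, Fin.exists_fin_succ_pi] at hw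
    obtain ⟨r₀, r, hr⟩ := hw
    refine ⟨∑ j, r j • C.J y ⟨e j y, hmem y hyU j⟩, ?_⟩
    rw [← hr, Fin.sum_univ_succ]
    simp only [a, Fin.cons_zero, Fin.cons_succ, map_add, map_smul, map_sum, hAc, hψ, hAe,
      hYe y hyU, smul_zero, zero_add, Submodule.coe_sum, Submodule.coe_smul]
  simp only [AlmostCR.zeroOne, Set.mem_ofPred_eq, cvec_inj, hψ]
  constructor
  · rintro ⟨w, rfl, rfl⟩
    refine ⟨(hAJ w).symm, ?_⟩
    rw [hAJ, hAJ, C.J_sq]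
    simp
  · rintro ⟨h1, h2⟩
    obtain ⟨w, hw⟩ := hrange (A y (ψ u))
    have hu : u = ((-w : C.H y) : TangentSpace (𝓡 (2 * m + 1)) y) := by
      apply ψ.injective
      rw [Submodule.coe_neg, map_neg, ← hw, h2, neg_neg]
    refine ⟨-w, hu, ψ.injective ?_⟩
    rw [h1, hu, hAJ]

end Leaf

end Robinson

/-! ### The leaf projection, and almost CR structures that force [K, N] ⊂ N. -/

namespace Robinson

namespace AlmostRobinson

variable {m : ℕ} {M : Type*} [TopologicalSpace M]
  [ChartedSpace (EuclideanSpace ℝ (Fin (2 * m + 2))) M] [IsManifold (𝓡 (2 * m + 2)) ∞ M]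
  {g : LorentzMetric (2 * m + 2) M} {R : AlmostRobinson g} {x y : M} {U : Set M}
  {L : Type*} [TopologicalSpace L] [ChartedSpace (EuclideanSpace ℝ (Fin (2 * m + 1))) L]
  [IsManifold (𝓡 (2 * m + 1)) ∞ L] {p : M → L}

/-- The projection to the leaf space, read in the chart around `p x`. -/
def leafMap (p : M → L) (x y : M) : EuclideanSpace ℝ (Fin (2 * m + 1)) :=
  extChartAt (𝓡 (2 * m + 1)) (p x) (p y)

/-- The domain of `leafMap p x`. -/
def leafDomain (U : Set M) (p : M → L) (x : M) : Set M :=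
  U ∩ p ⁻¹' (extChartAt (𝓡 (2 * m + 1)) (p x)).source

namespace IsLeafSpace

omit [IsManifold (𝓡 (2 * m + 1)) ∞ L] in
lemma mdifferentiableAt (hL : R.IsLeafSpace U p) (hx : x ∈ U) :
    MDifferentiableAt (𝓡 (2 * m + 2)) (𝓡 (2 * m + 1)) p x :=
  (hL.smooth.contMDiffAt (hL.isOpen.mem_nhds hx)).mdifferentiableAt (by simp)

omit [IsManifold (𝓡 (2 * m + 1)) ∞ L] in
lemma isOpen_leafDomain (hL : R.IsLeafSpace U p) (x : M) :
    IsOpen (leafDomain (m := m) U p x) :=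
  hL.smooth.continuousOn.isOpen_inter_preimage hL.isOpen (isOpen_extChartAt_source _)

omit [IsManifold (𝓡 (2 * m + 2)) ∞ M] [IsManifold (𝓡 (2 * m + 1)) ∞ L]
  [ChartedSpace (EuclideanSpace ℝ (Fin (2 * m + 2))) M] [TopologicalSpace M] in
lemma mem_leafDomain (hx : x ∈ U) : x ∈ leafDomain (m := m) U p x :=
  ⟨hx, mem_extChartAt_source (p x)⟩

lemma contMDiffOn_leafMap (hL : R.IsLeafSpace U p) (x : M) :
    ContMDiffOn (𝓡 (2 * m + 2)) 𝓘(ℝ, EuclideanSpace ℝ (Fin (2 * m + 1))) ∞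
      (leafMap (m := m) p x) (leafDomain (m := m) U p x) := by
  have h : ContMDiffOn (𝓡 (2 * m + 1)) 𝓘(ℝ, EuclideanSpace ℝ (Fin (2 * m + 1))) ∞
      (extChartAt (𝓡 (2 * m + 1)) (p x)) (extChartAt (𝓡 (2 * m + 1)) (p x)).source := by
    rw [extChartAt_source]
    exact contMDiffOn_extChartAt
  exact h.comp (hL.smooth.mono Set.inter_subset_left) fun y hy => hy.2

lemma mvfderiv_leafMap (hL : R.IsLeafSpace U p) (hy : y ∈ leafDomain (m := m) U p x)
    (v : TangentSpace (𝓡 (2 * m + 2)) y) :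
    mvfderiv (𝓡 (2 * m + 2)) (leafMap (m := m) p x) y v
      = triv (p x) (p y) (mfderiv (𝓡 (2 * m + 2)) (𝓡 (2 * m + 1)) p y v) := by
  have : IsManifold (𝓡 (2 * m + 1)) 1 L := IsManifold.of_le (n := ∞) (by simp)
  have hy2 := hy.2
  rw [Set.mem_preimage, extChartAt_source] at hy2
  have h := mfderiv_comp_apply (I := 𝓡 (2 * m + 2)) (I' := 𝓡 (2 * m + 1))
    (I'' := 𝓘(ℝ, EuclideanSpace ℝ (Fin (2 * m + 1)))) (f := p)
    (g := extChartAt (𝓡 (2 * m + 1)) (p x)) y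
    (mdifferentiableAt_extChartAt hy2) (hL.mdifferentiableAt hy.1) v
  rw [mfderiv_extChartAt_eq_triv hy.2] at h
  exact h

lemma mvfderiv_leafMap_eq_zero_iff (hL : R.IsLeafSpace U p)
    (hy : y ∈ leafDomain (m := m) U p x) (v : TangentSpace (𝓡 (2 * m + 2)) y) :
    mvfderiv (𝓡 (2 * m + 2)) (leafMap (m := m) p x) y v = 0 ↔ v ∈ R.K y := by
  obtain ⟨φ, hφ⟩ := exists_triv_linearEquiv (n := 2 * m + 1) hy.2
  rw [hL.mvfderiv_leafMap hy, hφ, ← hL.ker y hy.1 v]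
  exact φ.map_eq_zero_iff

lemma mvfderiv_leafMap_surjective (hL : R.IsLeafSpace U p)
    (hy : y ∈ leafDomain (m := m) U p x) :
    Function.Surjective (mvfderiv (𝓡 (2 * m + 2)) (leafMap (m := m) p x) y) := by
  obtain ⟨φ, hφ⟩ := exists_triv_linearEquiv (n := 2 * m + 1) hy.2
  intro w
  obtain ⟨v, hv⟩ := hL.submersion y hy.1 (φ.symm w)
  exact ⟨v, by rw [hL.mvfderiv_leafMap hy, hφ, hv, φ.apply_symm_apply]⟩

lemma mdifferentiableAt_mvfderiv_leafMap (hL : R.IsLeafSpace U p) {W : Set M} (hW : IsOpen W)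
    (hWx : W ⊆ leafDomain (m := m) U p x) {X : VField (2 * m + 2) M} (hX : SmoothOn W X)
    (hy : y ∈ W) :
    MDifferentiableAt (𝓡 (2 * m + 2)) 𝓘(ℝ, EuclideanSpace ℝ (Fin (2 * m + 1)))
      (fun y => mvfderiv (𝓡 (2 * m + 2)) (leafMap (m := m) p x) y (X y)) y :=
  ((contMDiffOn_mvfderiv_apply hW ((hL.contMDiffOn_leafMap x).mono hWx) hX).contMDiffAt
    (hW.mem_nhds hy)).mdifferentiableAt (by simp)

/-- Bracket with an optical field, projected to the leaf space. -/
lemma mvfderiv_leafMap_mlieBracket (hL : R.IsLeafSpace U p) {W : Set M} (hW : IsOpen W)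
    (hWx : W ⊆ leafDomain (m := m) U p x) {k X : VField (2 * m + 2) M} (hk : R.IsOptical W k)
    (hX : SmoothOn W X) (hy : y ∈ W) :
    mvfderiv (𝓡 (2 * m + 2)) (leafMap (m := m) p x) y
        (VectorField.mlieBracket (𝓡 (2 * m + 2)) k X y)
      = mvfderiv (𝓡 (2 * m + 2))
        (fun y => mvfderiv (𝓡 (2 * m + 2)) (leafMap (m := m) p x) y (X y)) y (k y) := by
  have h := mvfderiv_mlieBracket (n := 2 * m + 2) (((hL.contMDiffOn_leafMap x).mono
    hWx).contMDiffAt (hW.mem_nhds hy)) (hk.1.diffAt hW hy) (hX.diffAt hW hy)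
    (hL.mdifferentiableAt_mvfderiv_leafMap hW hWx hk.1 hy)
    (hL.mdifferentiableAt_mvfderiv_leafMap hW hWx hX hy)
  -- The differential of the projection kills k throughout W, so one of the two commutator terms
  -- vanishes.
  have h0 : (fun y => mvfderiv (𝓡 (2 * m + 2)) (leafMap (m := m) p x) y (k y))
      =ᶠ[𝓝 y] fun _ => 0 := by
    filter_upwards [hW.mem_nhds hy] with z hz
    exact (hL.mvfderiv_leafMap_eq_zero_iff (hWx hz) _).2 (hk.2 z hz)
  rw [mvfderiv_congr h0, mvfderiv_const] at h
  rw [h]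
  exact sub_zero _

omit [IsManifold (𝓡 (2 * m + 1)) ∞ L] in
-- The kernel of the complexified differential is ℂK, which is contained in N; so N is the full
-- preimage of its image.
lemma map_mem_iff (hL : R.IsLeafSpace U p) (hy : y ∈ U)
    {a b : TangentSpace (𝓡 (2 * m + 2)) y} :
    cvec (mfderiv (𝓡 (2 * m + 2)) (𝓡 (2 * m + 1)) p y a)
        (mfderiv (𝓡 (2 * m + 2)) (𝓡 (2 * m + 1)) p y b)
      ∈ (mfderiv (𝓡 (2 * m + 2)) (𝓡 (2 * m + 1)) p y).toLinearMap.baseChange ℂ ''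
        (R.N y : Set (ℂ ⊗[ℝ] TangentSpace (𝓡 (2 * m + 2)) y)) ↔ cvec a b ∈ R.N y := by
  constructor
  · rintro ⟨z, hz, h⟩
    obtain ⟨c, d, rfl⟩ := exists_cvec z
    rw [baseChange_cvec, cvec_inj] at h
    have hK : ∀ {v w : TangentSpace (𝓡 (2 * m + 2)) y},
        mfderiv (𝓡 (2 * m + 2)) (𝓡 (2 * m + 1)) p y v
          = mfderiv (𝓡 (2 * m + 2)) (𝓡 (2 * m + 1)) p y w → w - v ∈ R.K y := by
      intro v w h
      rw [← hL.ker y hy, map_sub, h, sub_self]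
    have h1 : cvec (a - c) (b - d) ∈ R.N y :=
      ((R.K_eq y _).1 ((cvec_mem_baseChange _ _ _).2 ⟨hK h.1, hK h.2⟩)).1
    have h2 := (R.N y).add_mem hz h1
    rwa [cvec_add, add_sub_cancel, add_sub_cancel] at h2
  · intro h
    exact ⟨_, h, baseChange_cvec _ _ _⟩

end IsLeafSpace

/-- If almost CR structures are induced on leaf spaces that cover the manifold, then the structure
is nearly Robinson. -/
theorem nearlyRobinson_of_induces {ι : Type*} {L : ι → Type*} [∀ i, TopologicalSpace (L i)]
    [∀ i, ChartedSpace (EuclideanSpace ℝ (Fin (2 * m + 1))) (L i)]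
    [∀ i, IsManifold (𝓡 (2 * m + 1)) ∞ (L i)] {U : ι → Set M} {p : ∀ i, M → L i}
    (hL : ∀ i, R.IsLeafSpace (U i) (p i)) (hU : (⋃ i, U i) = Set.univ)
    (h : ∀ i, ∃ C : AlmostCR m (L i), R.Induces (U i) (p i) C) : R.NearlyRobinson := by
  intro W₀ k X Y hW₀ hk hXY x hx₀
  obtain ⟨i, hxi⟩ := Set.mem_iUnion.1 (hU ▸ Set.mem_univ x)
  obtain ⟨C, hC⟩ := h i
  replace hL := hL i
  obtain ⟨V, hV, hxV, hVs, A, hA, hAC⟩ := C.exists_clm (p i x)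
  set W := W₀ ∩ (leafDomain (m := m) (U i) (p i) x ∩ (U i ∩ p i ⁻¹' V)) with hWdef
  have hW : IsOpen W := hW₀.inter ((hL.isOpen_leafDomain x).inter
    (hL.smooth.continuousOn.isOpen_inter_preimage hL.isOpen hV))
  have hWx : W ⊆ leafDomain (m := m) (U i) (p i) x := fun y hy => hy.2.1
  have hx : x ∈ W := ⟨hx₀, IsLeafSpace.mem_leafDomain hxi, hxi, hxV⟩
  have hk : R.IsOptical W k := ⟨hk.1.mono fun y hy => hy.1, fun y hy => hk.2 y hy.1⟩
  have hX : SmoothOn W X := hXY.1.mono fun y hy => hy.1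
  have hY : SmoothOn W Y := hXY.2.1.mono fun y hy => hy.1
  -- N is described by equations in the projected vectors whose coefficients A ∘ p are pulled back
  -- from the leaf space.
  have key : ∀ y ∈ W, ∀ a b : TangentSpace (𝓡 (2 * m + 2)) y, cvec a b ∈ R.N y ↔
      mvfderiv (𝓡 (2 * m + 2)) (leafMap (m := m) (p i) x) y b
          = A (p i y) (mvfderiv (𝓡 (2 * m + 2)) (leafMap (m := m) (p i) x) y a) ∧
        A (p i y) (A (p i y) (mvfderiv (𝓡 (2 * m + 2)) (leafMap (m := m) (p i) x) y a))
          = -mvfderiv (𝓡 (2 * m + 2)) (leafMap (m := m) (p i) x) y a := by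
    intro y hy a b
    rw [← hL.map_mem_iff hy.2.2.1, hC.map_N y hy.2.2.1, hAC _ hy.2.2.2,
      hL.mvfderiv_leafMap (hWx hy), hL.mvfderiv_leafMap (hWx hy)]
  have hAp : MDifferentiableAt (𝓡 (2 * m + 2)) 𝓘(ℝ, EuclideanSpace ℝ (Fin (2 * m + 1)) →L[ℝ]
      EuclideanSpace ℝ (Fin (2 * m + 1))) (fun y => A (p i y)) x :=
    ((hA.contMDiffAt (hV.mem_nhds hxV)).mdifferentiableAt (by simp)).comp x
      (hL.mdifferentiableAt hxi)
  have hAk : mvfderiv (𝓡 (2 * m + 2)) (fun y => A (p i y)) x (k x) = 0 := by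
    have h1 := mfderiv_comp_apply (I := 𝓡 (2 * m + 2)) (I' := 𝓡 (2 * m + 1))
      (I'' := 𝓘(ℝ, EuclideanSpace ℝ (Fin (2 * m + 1)) →L[ℝ] EuclideanSpace ℝ (Fin (2 * m + 1))))
      (f := p i) (g := A) x ((hA.contMDiffAt (hV.mem_nhds hxV)).mdifferentiableAt (by simp))
      (hL.mdifferentiableAt hxi) (k x)
    rw [(hL.ker x hxi _).2 (hk.2 x hx), map_zero] at h1
    exact h1
  have dX := hL.mdifferentiableAt_mvfderiv_leafMap hW hWx hX hx
  have dAX := hAp.clm_apply dX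
  rw [key x hx, hL.mvfderiv_leafMap_mlieBracket hW hWx hk hX hx,
    hL.mvfderiv_leafMap_mlieBracket hW hWx hk hY hx]
  have hN : ∀ᶠ y in 𝓝 x, y ∈ W ∧ cvec (X y) (Y y) ∈ R.N y := by
    filter_upwards [hW.mem_nhds hx] with y hy using ⟨hy, hXY.2.2 y hy.1⟩
  -- Since A ∘ p has zero derivative along k, differentiating the equations for X + iY along k gives
  -- the same equations for the projected brackets.
  have e1 := mvfderiv_clm_apply hAp dX (k x)
  have e2 := mvfderiv_clm_apply hAp dAX (k x)
  rw [hAk, zero_apply, zero_add] at e1 e2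
  constructor
  · rw [← e1]
    exact congrArg (fun q => q (k x)) (mvfderiv_congr (hN.mono fun y hy =>
      ((key y hy.1 _ _).1 hy.2).1))
  · rw [← e1, ← e2, mvfderiv_congr (hN.mono fun y hy => ((key y hy.1 _ _).1 hy.2).2)]
    exact congrArg (fun q => q (k x)) (mvfderiv_neg (I := 𝓡 (2 * m + 2)) (x := x)
      (g := fun y => mvfderiv (𝓡 (2 * m + 2)) (leafMap (m := m) (p i) x) y (X y)))

end AlmostRobinson

end Robinson

/-! ### Submersions: normal form and local sections. -/

namespace Robinson

section Submersion

variable {F : Type*} [NormedAddCommGroup F] [NormedSpace ℝ F] [FiniteDimensional ℝ F]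

/-- The normal form of a submersion. -/
lemma exists_openPartialHomeomorph_fst {E : Type*} [NormedAddCommGroup E] [NormedSpace ℝ E]
    [FiniteDimensional ℝ E] {q : E → F} {O : Set E} (hO : IsOpen O) {a : E} (ha : a ∈ O)
    (hq : ContDiffOn ℝ ∞ q O) (hsurj : Function.Surjective (fderiv ℝ q a)) :
    ∃ (G : Submodule ℝ E) (Φ : OpenPartialHomeomorph E (F × G)), a ∈ Φ.source ∧ Φ.source ⊆ O ∧
      (∀ z ∈ Φ.source, (Φ z).1 = q z) ∧ ContDiffOn ℝ ∞ Φ.symm Φ.target := by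
  have := FiniteDimensional.complete ℝ F
  have := FiniteDimensional.complete ℝ E
  have hqa := hq.contDiffAt (hO.mem_nhds ha)
  have hs : HasStrictFDerivAt q (fderiv ℝ q a) a := hqa.hasStrictFDerivAt (by simp)
  have hr : (fderiv ℝ q a).range = ⊤ := LinearMap.range_eq_top.2 hsurj
  have hker := (fderiv ℝ q a).ker_closedComplemented_of_finiteDimensional_range
  set D := HasStrictFDerivAt.implicitFunctionDataOfComplemented q _ hs hr hker with hD
  have hΦ : ContDiffOn ℝ ∞ D.toOpenPartialHomeomorph O := by
    rw [D.toOpenPartialHomeomorph_coe]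
    refine hq.prodMk ?_
    exact ((Classical.choose hker).contDiff.comp (contDiff_id.sub contDiff_const)).contDiffOn
  have hcont := hΦ.continuousOn_fderiv_of_isOpen hO (by simp)
  -- The implicit function theorem gives a homeomorphism near a. Restricting to the open set where
  -- its derivative is invertible makes the inverse smooth at every point of the target.
  set O' := O ∩ fderiv ℝ D.toOpenPartialHomeomorph ⁻¹' Set.range
    ((↑) : (E ≃L[ℝ] F × (fderiv ℝ q a).ker) → E →L[ℝ] F × (fderiv ℝ q a).ker) with hO'def
  have hO' : IsOpen O' := hcont.isOpen_inter_preimage hO ContinuousLinearEquiv.isOpen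
  have haO' : a ∈ O' := by
    refine ⟨ha, ?_⟩
    rw [Set.mem_preimage, D.toOpenPartialHomeomorph_coe]
    exact D.isInvertible_fderiv_prodFun
  refine ⟨(fderiv ℝ q a).ker, D.toOpenPartialHomeomorph.restrOpen O' hO',
    ⟨D.pt_mem_toOpenPartialHomeomorph_source, haO'⟩, fun z hz => hz.2.1, fun z hz => rfl, ?_⟩
  intro b hb
  have hb' := (D.toOpenPartialHomeomorph.restrOpen O' hO').map_target hb
  have hbO : D.toOpenPartialHomeomorph.symm b ∈ O' := hb'.2
  obtain ⟨f', hf'⟩ := hbO.2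
  have hd := hΦ.contDiffAt (hO.mem_nhds hbO.1)
  have h1 : HasFDerivAt D.toOpenPartialHomeomorph
      (f' : E →L[ℝ] F × (fderiv ℝ q a).ker) (D.toOpenPartialHomeomorph.symm b) := by
    rw [hf']
    exact (hd.differentiableAt (by simp)).hasFDerivAt
  have hbt : b ∈ D.toOpenPartialHomeomorph.target := hb.1
  exact (D.toOpenPartialHomeomorph.contDiffAt_symm hbt h1 hd).contDiffWithinAt

variable {n : ℕ} {M : Type*} [TopologicalSpace M] [ChartedSpace (EuclideanSpace ℝ (Fin n)) M]
  [IsManifold (𝓡 n) ∞ M]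

/-- A submersion has a smooth local section, and near a point it has connected fibres: a function
whose derivative along the fibres is zero is constant along them. -/
lemma exists_localSection {q : M → F} {W : Set M} (hW : IsOpen W) {x : M} (hx : x ∈ W)
    (hq : ContMDiffOn (𝓡 n) 𝓘(ℝ, F) ∞ q W)
    (hsurj : Function.Surjective (mvfderiv (𝓡 n) q x)) :
    ∃ (O : Set F) (V : Set M) (σ : F → M), IsOpen O ∧ IsOpen V ∧ x ∈ V ∧ V ⊆ W ∧
      Set.MapsTo q V O ∧ Set.MapsTo σ O V ∧ (∀ u ∈ O, q (σ u) = u) ∧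
      ContMDiffOn 𝓘(ℝ, F) (𝓡 n) ∞ σ O ∧
      ∀ {G : Type} [NormedAddCommGroup G] [NormedSpace ℝ G] (ζ : M → G),
        (∀ y ∈ V, MDifferentiableAt (𝓡 n) 𝓘(ℝ, G) ζ y) →
        (∀ y ∈ V, ∀ v, mvfderiv (𝓡 n) q y v = 0 → mvfderiv (𝓡 n) ζ y v = 0) →
        ∀ y ∈ V, ζ (σ (q y)) = ζ y := by
  set φ := chartAt (EuclideanSpace ℝ (Fin n)) x with hφdef
  have hφ : ContMDiffOn (𝓡 n) (𝓡 n) ∞ φ φ.source := contMDiffOn_chart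
  have hφs : ContMDiffOn (𝓡 n) (𝓡 n) ∞ φ.symm φ.target := contMDiffOn_chart_symm
  have hxφ : x ∈ φ.source := mem_chart_source _ x
  have hO₁ : IsOpen (φ.target ∩ φ.symm ⁻¹' W) := φ.isOpen_inter_preimage_symm hW
  have hdq : MDifferentiableAt (𝓡 n) 𝓘(ℝ, F) q x :=
    (hq.contMDiffAt (hW.mem_nhds hx)).mdifferentiableAt (by simp)
  obtain ⟨G', Φ, haΦ, hΦO, hΦq, hΦs⟩ := exists_openPartialHomeomorph_fst (q := q ∘ φ.symm) hO₁
    (a := φ x) ⟨φ.map_source hxφ, by rwa [Set.mem_preimage, φ.left_inv hxφ]⟩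
    (contMDiffOn_iff_contDiffOn.1 (hq.comp (hφs.mono Set.inter_subset_left) fun z hz => hz.2))
    (by
      intro w
      obtain ⟨v, hv⟩ := hsurj w
      refine ⟨triv x x v, ?_⟩
      rw [← hv]
      exact fderiv_comp_extChartAt_symm hdq (mem_extChartAt_source x) v)
  set e := φ.trans Φ with he
  have hxe : x ∈ e.source := ⟨hxφ, haΦ⟩
  have heW : ∀ y ∈ e.source, y ∈ W ∧ (e y).1 = q y := by
    intro y hy
    have hyφ : y ∈ φ.source := hy.1
    have h1 := hΦO hy.2
    have h2 : (e y).1 = q (φ.symm (φ y)) := hΦq _ hy.2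
    have h3 : φ.symm (φ y) = y := φ.left_inv hyφ
    refine ⟨by simpa [h3] using h1.2, ?_⟩
    rwa [h3] at h2
  have hes : ContMDiffOn 𝓘(ℝ, F × G') (𝓡 n) ∞ e.symm e.target :=
    hφs.comp (hΦs.contMDiffOn.mono fun b hb => hb.1) fun b hb => hb.2
  -- A ball in the product is a product of balls, so the fibres inside V are parametrised by one
  -- fixed ball. The section σ keeps the second coordinate at its value for x.
  obtain ⟨r, hr, hball⟩ := Metric.isOpen_iff.1 e.open_target (e x) (e.map_source hxe)
  have hb : ∀ u ∈ Metric.ball (e x).1 r, ∀ t ∈ Metric.ball (e x).2 r, (u, t) ∈ e.target := by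
    intro u hu t ht
    refine hball ?_
    rw [← Prod.mk.eta (p := e x), ← ball_prod_same]
    exact ⟨hu, ht⟩
  refine ⟨Metric.ball (e x).1 r, e.source ∩ e ⁻¹' Metric.ball (e x) r,
    fun u => e.symm (u, (e x).2), Metric.isOpen_ball,
    e.isOpen_inter_preimage Metric.isOpen_ball, ⟨hxe, Metric.mem_ball_self hr⟩,
    fun y hy => (heW y hy.1).1, ?_, ?_, ?_, ?_, ?_⟩
  · intro y hy
    have h1 := hy.2
    rw [Set.mem_preimage, ← Prod.mk.eta (p := e x), ← ball_prod_same] at h1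
    rw [← (heW y hy.1).2]
    exact h1.1
  · intro u hu
    have h1 := hb u hu _ (Metric.mem_ball_self hr)
    refine ⟨e.map_target h1, ?_⟩
    rw [Set.mem_preimage, e.right_inv h1, ← Prod.mk.eta (p := e x), ← ball_prod_same]
    exact ⟨hu, Metric.mem_ball_self hr⟩
  · intro u hu
    have h1 := hb u hu _ (Metric.mem_ball_self hr)
    change q (e.symm (u, (e x).2)) = u
    rw [← (heW _ (e.map_target h1)).2, e.right_inv h1]
  · have h1 : ContMDiff 𝓘(ℝ, F) 𝓘(ℝ, F × G') ∞ (fun u : F => (u, (e x).2)) :=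
      (contDiff_id.prodMk contDiff_const).contMDiff
    exact hes.comp h1.contMDiffOn fun u hu => hb u hu _ (Metric.mem_ball_self hr)
  · intro G _ _ ζ hζ hζ0 y hy
    have hyb := hy.2
    rw [Set.mem_preimage, ← Prod.mk.eta (p := e x), ← ball_prod_same] at hyb
    obtain ⟨hu, ht⟩ := hyb
    let c : G' → M := fun t => e.symm ((e y).1, t)
    have hcV : ∀ t ∈ Metric.ball (e x).2 r, c t ∈ e.source ∩ e ⁻¹' Metric.ball (e x) r := by
      intro t ht
      have h1 := hb _ hu t ht
      refine ⟨e.map_target h1, ?_⟩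
      rw [Set.mem_preimage, e.right_inv h1, ← Prod.mk.eta (p := e x), ← ball_prod_same]
      exact ⟨hu, ht⟩
    have hc : ∀ t ∈ Metric.ball (e x).2 r, MDifferentiableAt 𝓘(ℝ, G') (𝓡 n) c t := by
      intro t ht
      have h1 := (hes.contMDiffAt (e.open_target.mem_nhds (hb _ hu t ht))).mdifferentiableAt
        (by simp)
      have h2 : MDifferentiableAt 𝓘(ℝ, G') 𝓘(ℝ, F × G') (fun t : G' => ((e y).1, t)) t :=
        (contDiff_const.prodMk contDiff_id).contMDiff.mdifferentiableAt (n := 1) (by simp)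
      exact h1.comp t h2
    -- In the normal form c runs through the fibre of y, so ζ ∘ c has zero derivative on a convex
    -- set, which contains the parameters of both y and σ(q y).
    have hconst := (convex_ball (e x).2 r).is_const_of_fderivWithin_eq_zero (𝕜 := ℝ) (f := ζ ∘ c)
      (fun t ht => (((hζ _ (hcV t ht)).comp t (hc t ht)).differentiableAt).differentiableWithinAt)
      (fun t ht => ?_) (Metric.mem_ball_self hr) ht
    · have h3 : c (e y).2 = y := e.left_inv hy.1
      have h4 : c (e x).2 = e.symm (q y, (e x).2) := by rw [← (heW y hy.1).2]
      rw [Function.comp_apply, Function.comp_apply, h3, h4] at hconst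
      exact hconst
    · rw [fderivWithin_of_isOpen Metric.isOpen_ball ht]
      ext w
      have h5 := mfderiv_comp_apply (I := 𝓘(ℝ, G')) (I' := 𝓡 n) (I'' := 𝓘(ℝ, G)) t
        (hζ _ (hcV t ht)) (hc t ht) w
      have h6 := mfderiv_comp_apply (I := 𝓘(ℝ, G')) (I' := 𝓡 n) (I'' := 𝓘(ℝ, F)) t
        ((hq.contMDiffAt (hW.mem_nhds (heW _ (hcV t ht).1).1)).mdifferentiableAt (by simp))
        (hc t ht) w
      have h7 : q ∘ c =ᶠ[𝓝 t] fun _ => (e y).1 := by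
        filter_upwards [Metric.isOpen_ball.mem_nhds ht] with t' ht'
        have h1 := hb _ hu t' ht'
        change q (e.symm ((e y).1, t')) = _
        rw [← (heW _ (e.map_target h1)).2, e.right_inv h1]
      rw [mfderiv_eq_fderiv, h7.fderiv_eq, fderiv_fun_const] at h6
      rw [mfderiv_eq_fderiv] at h5
      exact h5.trans (hζ0 _ (hcV t ht) _ h6.symm)

end Submersion

end Robinson

/-! ### The complex structure seen in a chart of the leaf space. -/

namespace Robinson

/-- An endomorphism that maps `a_j` to `b_j`, `b_j` to `-a_j` and `c` to `0`. -/
lemma apply_apply_eq_neg_iff {E ι : Type*} [AddCommGroup E] [Module ℝ E] [Fintype ι] {a b : ι → E}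
    {c : E} {T : E →ₗ[ℝ] E}
    (hspan : ∀ w, ∃ (α β : ι → ℝ) (γ : ℝ), w = ∑ j, (α j • a j + β j • b j) + γ • c)
    (ha : ∀ j, T (a j) = b j) (hb : ∀ j, T (b j) = -a j) (hc : T c = 0) {w : E} :
    T (T w) = -w ↔ ∃ α β : ι → ℝ, w = ∑ j, (α j • a j + β j • b j) := by
  have hT : ∀ (α β : ι → ℝ), T (T (∑ j, (α j • a j + β j • b j)))
      = -∑ j, (α j • a j + β j • b j) := by
    intro α β
    simp only [map_sum, map_add, map_smul, ha, hb, map_neg, ← Finset.sum_neg_distrib]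
    refine Finset.sum_congr rfl fun j _ => ?_
    module
  constructor
  · intro h
    obtain ⟨α, β, γ, hw⟩ := hspan w
    refine ⟨α, β, ?_⟩
    -- T² loses the c-component and is -1 on the span of the a_j and b_j, so T²w = -w leaves no room
    -- for that component.
    rw [← neg_inj, ← h, hw, map_add, map_add, map_smul, hc, smul_zero, map_zero, add_zero, hT]
  · rintro ⟨α, β, rfl⟩
    exact hT α β

namespace AlmostRobinson

variable {m : ℕ} {M : Type*} [TopologicalSpace M]
  [ChartedSpace (EuclideanSpace ℝ (Fin (2 * m + 2))) M] [IsManifold (𝓡 (2 * m + 2)) ∞ M]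
  {g : LorentzMetric (2 * m + 2) M} {R : AlmostRobinson g} {x y : M} {U W : Set M}
  {k ℓ : VField (2 * m + 2) M} {A B : Fin m → VField (2 * m + 2) M}

namespace AdaptedFrame

lemma smoothOn_B (F : R.AdaptedFrame U k ℓ A B) (j : Fin m) : SmoothOn U (B j) :=
  F.frame.contMDiffOn (Sum.inr (Sum.inl j))

lemma isOptical (F : R.AdaptedFrame U k ℓ A B) : R.IsOptical U k :=
  ⟨F.splitting.1, fun _ hx => (F.isSplitting hx).mem⟩

section Quotient

variable {E : Type*} [AddCommGroup E] [Module ℝ E] {D : TangentSpace (𝓡 (2 * m + 2)) y →ₗ[ℝ] E}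

lemma map_expand (F : R.AdaptedFrame U k ℓ A B) (hy : y ∈ U) (hD : ∀ v, D v = 0 ↔ v ∈ R.K y)
    (v : TangentSpace (𝓡 (2 * m + 2)) y) :
    D v = ∑ j, (F.coA j y v • D (A j y) + F.coB j y v • D (B j y))
      + g.val y (k y) v • D (ℓ y) := by
  conv_lhs => rw [F.expand hy v]
  simp only [map_add, map_sum, map_smul, (hD _).2 (F.isSplitting hy).mem, smul_zero, zero_add]

lemma linearIndependent_map (F : R.AdaptedFrame U k ℓ A B) (hy : y ∈ U)
    (hD : ∀ v, D v = 0 ↔ v ∈ R.K y) :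
    LinearIndependent ℝ (Sum.elim (fun j => D (A j y))
      (Sum.elim (fun j => D (B j y)) fun _ : Unit => D (ℓ y))) := by
  rw [Fintype.linearIndependent_iff]
  intro c hc
  set v := ∑ j, (c (Sum.inl j) • A j y + c (Sum.inr (Sum.inl j)) • B j y)
    + ((0 : ℝ) • k y + c (Sum.inr (Sum.inr ())) • ℓ y) with hv
  have hDv : D v = 0 := by
    rw [← hc, hv]
    simp only [Fintype.sum_sum_type, Sum.elim_inl, Sum.elim_inr, Finset.univ_unique,
      Finset.sum_singleton, map_add, map_sum, map_smul, zero_smul, zero_add,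
      Finset.sum_add_distrib]
    exact add_assoc _ _ _
  obtain ⟨r, hr⟩ : ∃ r : ℝ, v = r • k y :=
    ⟨_, (R.isRobinson y).K_eq_smul (F.isSplitting hy) ((hD v).1 hDv)⟩
  have hv' : v = ∑ j, ((0 : Fin m → ℝ) j • A j y + (0 : Fin m → ℝ) j • B j y)
      + (r • k y + (0 : ℝ) • ℓ y) := by simp [hr]
  rintro (j | j | _)
  · have h1 := F.coA_comb hy (fun j => c (Sum.inl j)) (fun j => c (Sum.inr (Sum.inl j))) 0
      (c (Sum.inr (Sum.inr ()))) j
    have h2 := F.coA_comb hy 0 0 r 0 j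
    rw [← hv] at h1
    rw [← hv'] at h2
    exact h1.symm.trans h2
  · have h1 := F.coB_comb hy (fun j => c (Sum.inl j)) (fun j => c (Sum.inr (Sum.inl j))) 0
      (c (Sum.inr (Sum.inr ()))) j
    have h2 := F.coB_comb hy 0 0 r 0 j
    rw [← hv] at h1
    rw [← hv'] at h2
    exact h1.symm.trans h2
  · have h1 := (F.pairing_comb hy (fun j => c (Sum.inl j)) (fun j => c (Sum.inr (Sum.inl j))) 0
      (c (Sum.inr (Sum.inr ())))).1
    have h2 := (F.pairing_comb hy 0 0 r 0).1
    rw [← hv] at h1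
    rw [← hv'] at h2
    exact h1.symm.trans h2

/-- The condition T² = -1 on D a says that a has no ℓ-component, hence is in K^⊥; then D b = T(D a)
says that b represents J a modulo K = ker D. -/
lemma mem_N_iff_map (F : R.AdaptedFrame U k ℓ A B) (hy : y ∈ U) (hD : ∀ v, D v = 0 ↔ v ∈ R.K y)
    {T : E →ₗ[ℝ] E} {c : E}
    (hspan : ∀ w, ∃ (α β : Fin m → ℝ) (γ : ℝ),
      w = ∑ j, (α j • D (A j y) + β j • D (B j y)) + γ • c)
    (hA : ∀ j, T (D (A j y)) = D (B j y)) (hB : ∀ j, T (D (B j y)) = -D (A j y)) (hc : T c = 0)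
    {a b : TangentSpace (𝓡 (2 * m + 2)) y} :
    cvec a b ∈ R.N y ↔ D b = T (D a) ∧ T (T (D a)) = -D a := by
  rw [apply_apply_eq_neg_iff hspan hA hB hc]
  constructor
  · intro h
    obtain ⟨h1, h2, h3⟩ := (F.mem_N_iff hy).1 h
    have ha := F.map_expand hy hD a
    have hb := F.map_expand hy hD b
    rw [h1, zero_smul, add_zero] at ha
    rw [h2, zero_smul, add_zero] at hb
    refine ⟨?_, _, _, ha⟩
    rw [ha, hb]
    simp only [map_sum, map_add, map_smul, hA, hB, (h3 _).1, (h3 _).2]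
    refine Finset.sum_congr rfl fun j _ => ?_
    module
  · rintro ⟨h1, α, β, h2⟩
    have hN : cvec (∑ j, (α j • A j y + β j • B j y)) (∑ j, (α j • B j y - β j • A j y))
        ∈ R.N y := by
      rw [← cvec_sum]
      refine Submodule.sum_mem _ fun j _ => ?_
      have h3 := (R.N y).smul_mem (⟨α j, -β j⟩ : ℂ) (F.mem_N y hy j)
      rw [smul_cvec] at h3
      convert h3 using 2 <;> module
    have e1 : a - ∑ j, (α j • A j y + β j • B j y) ∈ R.K y := by
      rw [← hD, map_sub, h2]
      simp [map_sum]
    have e2 : b - ∑ j, (α j • B j y - β j • A j y) ∈ R.K y := by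
      rw [← hD, map_sub, h1, h2]
      simp only [map_sum, map_add, map_sub, map_smul, hA, hB]
      rw [sub_eq_zero]
      refine Finset.sum_congr rfl fun j _ => ?_
      module
    have h4 := ((R.K_eq y _).1 ((cvec_mem_baseChange _ _ _).2 ⟨e1, e2⟩)).1
    have h5 := (R.N y).add_mem hN h4
    rwa [cvec_add, add_sub_cancel, add_sub_cancel] at h5

end Quotient

end AdaptedFrame

variable {L : Type*} [TopologicalSpace L] [ChartedSpace (EuclideanSpace ℝ (Fin (2 * m + 1))) L]
  [IsManifold (𝓡 (2 * m + 1)) ∞ L] {p : M → L}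

/-- The complex structure on the quotient by `K`, read in a chart of the leaf space, is described
by a smooth field of endomorphisms, which is constant along `K`. -/
lemma NearlyRobinson.exists_clm (hR : R.NearlyRobinson) (hL : R.IsLeafSpace U p) (hx : x ∈ U) :
    ∃ V ⊆ leafDomain (m := m) U p x, IsOpen V ∧ x ∈ V ∧
    ∃ (T : M → EuclideanSpace ℝ (Fin (2 * m + 1)) →L[ℝ] EuclideanSpace ℝ (Fin (2 * m + 1)))
      (X : Fin m ⊕ Fin m → VField (2 * m + 2) M),
      ContMDiffOn (𝓡 (2 * m + 2)) 𝓘(ℝ, EuclideanSpace ℝ (Fin (2 * m + 1)) →L[ℝ]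
        EuclideanSpace ℝ (Fin (2 * m + 1))) ∞ T V ∧
      (∀ i, SmoothOn V (X i)) ∧
      (∀ y ∈ V, LinearIndependent ℝ (fun i =>
        mvfderiv (𝓡 (2 * m + 2)) (leafMap (m := m) p x) y (X i y))) ∧
      (∀ y ∈ V, ∀ w, T y (T y w) = -w ↔ w ∈ Submodule.span ℝ (Set.range fun i =>
        mvfderiv (𝓡 (2 * m + 2)) (leafMap (m := m) p x) y (X i y))) ∧
      (∀ y ∈ V, ∀ a b : TangentSpace (𝓡 (2 * m + 2)) y, cvec a b ∈ R.N y ↔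
        mvfderiv (𝓡 (2 * m + 2)) (leafMap (m := m) p x) y b
          = T y (mvfderiv (𝓡 (2 * m + 2)) (leafMap (m := m) p x) y a) ∧
        T y (T y (mvfderiv (𝓡 (2 * m + 2)) (leafMap (m := m) p x) y a))
          = -mvfderiv (𝓡 (2 * m + 2)) (leafMap (m := m) p x) y a) ∧
      ∀ y ∈ V, ∀ v ∈ R.K y, mvfderiv (𝓡 (2 * m + 2)) T y v = 0 := by
  obtain ⟨W₀, k, ℓ, A, B, hxW₀, F₀⟩ := R.exists_adaptedFrame_at x
  set W := W₀ ∩ leafDomain (m := m) U p x with hWdef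
  have hW : IsOpen W := F₀.isOpen.inter (hL.isOpen_leafDomain x)
  have F := F₀.mono hW Set.inter_subset_left
  have hWx : W ⊆ leafDomain (m := m) U p x := Set.inter_subset_right
  have hxW : x ∈ W := ⟨hxW₀, IsLeafSpace.mem_leafDomain hx⟩
  have hq := (hL.contMDiffOn_leafMap x).mono hWx
  set D := mvfderiv (𝓡 (2 * m + 2)) (leafMap (m := m) p x) with hDdef
  have hD : ∀ y ∈ W, ∀ v, (D y).toLinearMap v = 0 ↔ v ∈ R.K y := fun y hy v =>
    hL.mvfderiv_leafMap_eq_zero_iff (hWx hy) v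
  have hDA : ∀ j, ContMDiffOn (𝓡 (2 * m + 2)) 𝓘(ℝ, EuclideanSpace ℝ (Fin (2 * m + 1))) ∞
      (fun y => D y (A j y)) W := fun j => contMDiffOn_mvfderiv_apply hW hq (F.smoothOn_A j)
  have hDB : ∀ j, ContMDiffOn (𝓡 (2 * m + 2)) 𝓘(ℝ, EuclideanSpace ℝ (Fin (2 * m + 1))) ∞
      (fun y => D y (B j y)) W := fun j => contMDiffOn_mvfderiv_apply hW hq (F.smoothOn_B j)
  -- The complement is frozen at its value at x, whereas D(ℓ) may vary along K. Thus T c = 0 with c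
  -- constant, and the derivative of T along k kills c.
  let c := D x (ℓ x)
  let a : Fin m ⊕ Fin m ⊕ Unit → M → EuclideanSpace ℝ (Fin (2 * m + 1)) :=
    Sum.elim (fun j y => D y (A j y)) (Sum.elim (fun j y => D y (B j y)) fun _ _ => c)
  let s : Fin m ⊕ Fin m ⊕ Unit → M → EuclideanSpace ℝ (Fin (2 * m + 1)) :=
    Sum.elim (fun j y => D y (B j y)) (Sum.elim (fun j y => -D y (A j y)) fun _ _ => 0)
  have hcard : Fintype.card (Fin m ⊕ Fin m ⊕ Unit)
      = Module.finrank ℝ (EuclideanSpace ℝ (Fin (2 * m + 1))) := by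
    simp; omega
  obtain ⟨V, hVW, hV, hxV, T, hT, hTa⟩ := exists_clm_of_basis (n := 2 * m + 2) (a := a) (s := s)
    hW hxW
    (by
      rintro (j | j | _)
      exacts [hDA j, hDB j, contMDiffOn_const])
    (by
      rintro (j | j | _)
      · exact hDB j
      · exact contDiff_neg.contMDiff.comp_contMDiffOn (hDA j)
      · exact contMDiffOn_const)
    (by
      have h := F.linearIndependent_map hxW (hD x hxW)
      convert h using 1
      funext i
      rcases i with j | j | _ <;> rfl)
    hcard
  have hTA : ∀ y ∈ V, ∀ j, T y (D y (A j y)) = D y (B j y) := fun y hy j =>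
    (hTa y hy).2 (Sum.inl j)
  have hTB : ∀ y ∈ V, ∀ j, T y (D y (B j y)) = -D y (A j y) := fun y hy j =>
    (hTa y hy).2 (Sum.inr (Sum.inl j))
  have hTc : ∀ y ∈ V, T y c = 0 := fun y hy => (hTa y hy).2 (Sum.inr (Sum.inr ()))
  have hspan : ∀ y ∈ V, ∀ w, ∃ (α β : Fin m → ℝ) (γ : ℝ),
      w = ∑ j, (α j • D y (A j y) + β j • D y (B j y)) + γ • c := by
    intro y hy w
    have hw : w ∈ Submodule.span ℝ (Set.range fun i => a i y) :=
      (hTa y hy).1.span_eq_top_of_card_eq_finrank' hcard ▸ Submodule.mem_top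
    rw [Submodule.mem_span_range_iff_exists_fun] at hw
    obtain ⟨r, hr⟩ := hw
    refine ⟨fun j => r (Sum.inl j), fun j => r (Sum.inr (Sum.inl j)), r (Sum.inr (Sum.inr ())), ?_⟩
    rw [← hr]
    simp only [a, Fintype.sum_sum_type, Sum.elim_inl, Sum.elim_inr, Finset.univ_unique,
      Finset.sum_singleton, Finset.sum_add_distrib]
    exact (add_assoc _ _ _).symm
  have hN : ∀ y ∈ V, ∀ a b : TangentSpace (𝓡 (2 * m + 2)) y, cvec a b ∈ R.N y ↔
      D y b = T y (D y a) ∧ T y (T y (D y a)) = -D y a := fun y hy a b =>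
    F.mem_N_iff_map (hVW hy) (hD y (hVW hy)) (D := (D y).toLinearMap) (T := (T y).toLinearMap)
      (hspan y hy) (hTA y hy) (hTB y hy) (hTc y hy)
  refine ⟨V, hVW.trans hWx, hV, hxV, T, Sum.elim A B, hT, ?_, ?_, ?_, hN, ?_⟩
  · rintro (j | j)
    exacts [(F.smoothOn_A j).mono hVW, (F.smoothOn_B j).mono hVW]
  · intro y hy
    have h := F.linearIndependent_map (hVW hy) (hD y (hVW hy))
    have h' := h.comp (Sum.elim Sum.inl fun j => Sum.inr (Sum.inl j))
      (by rintro (i | i) (j | j) h <;> simp_all)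
    have e : (fun i => D y (Sum.elim A B i y)) = Sum.elim (fun j => (D y).toLinearMap (A j y))
        (Sum.elim (fun j => (D y).toLinearMap (B j y)) fun _ : Unit => (D y).toLinearMap (ℓ y)) ∘
          Sum.elim Sum.inl fun j => Sum.inr (Sum.inl j) := by
      funext i
      rcases i with j | j <;> rfl
    rw [e]
    exact h'
  · intro y hy w
    refine (apply_apply_eq_neg_iff (T := (T y).toLinearMap) (hspan y hy) (hTA y hy) (hTB y hy)
      (hTc y hy)).trans ?_
    rw [Submodule.mem_span_range_iff_exists_fun]
    constructor
    · rintro ⟨α, β, rfl⟩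
      exact ⟨Sum.elim α β, by simp [Finset.sum_add_distrib]⟩
    · rintro ⟨r, rfl⟩
      exact ⟨fun j => r (Sum.inl j), fun j => r (Sum.inr j), by simp [Finset.sum_add_distrib]⟩
  · intro y hy v hv
    have hkV : R.IsOptical V k := ⟨F.isOptical.1.mono hVW, fun y hy => F.isOptical.2 y (hVW hy)⟩
    suffices h : mvfderiv (𝓡 (2 * m + 2)) T y (k y) = 0 by
      obtain ⟨r, rfl⟩ : ∃ r : ℝ, v = r • k y :=
        ⟨_, (R.isRobinson y).K_eq_smul (F.isSplitting (hVW hy)) hv⟩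
      rw [map_smul, h, smul_zero]
    have hdT := (hT.contMDiffAt (hV.mem_nhds hy)).mdifferentiableAt (n := ∞) (by simp)
    have hdA := fun j => ((hDA j).contMDiffAt (hW.mem_nhds (hVW hy))).mdifferentiableAt (by simp)
    have hdB := fun j => ((hDB j).contMDiffAt (hW.mem_nhds (hVW hy))).mdifferentiableAt (by simp)
    -- The brackets of k with A_j and B_j form elements of N. After projection they are derivatives
    -- along k, so k(D B_j) = T(k(D A_j)), with T² = -1 on k(D A_j).
    have hAB : ∀ j, D y (VectorField.mlieBracket (𝓡 (2 * m + 2)) k (B j) y)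
          = T y (D y (VectorField.mlieBracket (𝓡 (2 * m + 2)) k (A j) y)) ∧
        T y (T y (D y (VectorField.mlieBracket (𝓡 (2 * m + 2)) k (A j) y)))
          = -D y (VectorField.mlieBracket (𝓡 (2 * m + 2)) k (A j) y) := fun j =>
      (hN y hy _ _).1 (hR W k (A j) (B j) hW F.isOptical
        ⟨F.smoothOn_A j, F.smoothOn_B j, fun z hz => F.mem_N z hz j⟩ y (hVW hy))
    simp only [hDdef, hL.mvfderiv_leafMap_mlieBracket hW hWx F.isOptical (F.smoothOn_A _)
      (hVW hy), hL.mvfderiv_leafMap_mlieBracket hW hWx F.isOptical (F.smoothOn_B _)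
      (hVW hy)] at hAB
    rw [← hDdef] at hAB
    -- The product rule for T(D A_j) = D B_j leaves (k T)(D A_j) = k(D B_j) - T(k(D A_j)) = 0; the
    -- argument for D B_j uses T² = -1 as well.
    have h1 : ∀ j, mvfderiv (𝓡 (2 * m + 2)) T y (k y) (D y (A j y)) = 0 := by
      intro j
      have e1 := mvfderiv_clm_apply hdT (hdA j) (k y)
      rw [mvfderiv_congr (f' := fun y => D y (B j y)) (by
        filter_upwards [hV.mem_nhds hy] with z hz using hTA z hz j), (hAB j).1] at e1
      simpa using e1
    have h2 : ∀ j, mvfderiv (𝓡 (2 * m + 2)) T y (k y) (D y (B j y)) = 0 := by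
      intro j
      have e1 := mvfderiv_clm_apply hdT (hdB j) (k y)
      rw [mvfderiv_congr (f' := -fun y => D y (A j y)) (by
        filter_upwards [hV.mem_nhds hy] with z hz using hTB z hz j), mvfderiv_neg, (hAB j).1,
        (hAB j).2] at e1
      simpa using e1
    have h3 : mvfderiv (𝓡 (2 * m + 2)) T y (k y) c = 0 := by
      have e1 := mvfderiv_clm_apply (f := fun _ => c) hdT mdifferentiableAt_const (k y)
      rw [mvfderiv_congr (f' := fun _ => 0) (by
        filter_upwards [hV.mem_nhds hy] with z hz using hTc z hz), mvfderiv_const,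
        mvfderiv_const] at e1
      simpa using e1.symm
    ext1 w
    obtain ⟨α, β, γ, rfl⟩ := hspan y hy w
    simp [h1, h2, h3]

end AlmostRobinson

end Robinson

/-! ### Descent of the complex structure to the leaf space. -/

namespace Robinson

lemma exists_vField_triv {n : ℕ} {M : Type*} [TopologicalSpace M]
    [ChartedSpace (EuclideanSpace ℝ (Fin n)) M] [IsManifold (𝓡 n) ∞ M] (x : M)
    (w : M → EuclideanSpace ℝ (Fin n)) :
    ∃ X : VField n M, ∀ y ∈ (extChartAt (𝓡 n) x).source, triv x y (X y) = w y := by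
  have h : ∀ y, ∃ v : TangentSpace (𝓡 n) y,
      y ∈ (extChartAt (𝓡 n) x).source → triv x y v = w y := by
    intro y
    by_cases hy : y ∈ (extChartAt (𝓡 n) x).source
    · obtain ⟨φ, hφ⟩ := exists_triv_linearEquiv hy
      exact ⟨φ.symm (w y), fun _ => by rw [hφ, φ.apply_symm_apply]⟩
    · exact ⟨0, fun h => absurd h hy⟩
  choose X hX using h
  exact ⟨X, hX⟩

namespace AlmostRobinson

variable {m : ℕ} {M : Type*} [TopologicalSpace M]
  [ChartedSpace (EuclideanSpace ℝ (Fin (2 * m + 2))) M] [IsManifold (𝓡 (2 * m + 2)) ∞ M]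
  {g : LorentzMetric (2 * m + 2) M} {R : AlmostRobinson g} {x y : M} {U W : Set M}
  {L : Type*} [TopologicalSpace L] [ChartedSpace (EuclideanSpace ℝ (Fin (2 * m + 1))) L]
  {p : M → L}

variable (R p) in
/-- `u + i v` lies in the image of `N` at `x`. -/
def leafRel (x : M) (u v : EuclideanSpace ℝ (Fin (2 * m + 1))) : Prop :=
  ∃ a b : TangentSpace (𝓡 (2 * m + 2)) x, cvec a b ∈ R.N x ∧
    mfderiv (𝓡 (2 * m + 2)) (𝓡 (2 * m + 1)) p x a = u ∧
    mfderiv (𝓡 (2 * m + 2)) (𝓡 (2 * m + 1)) p x b = v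

variable [IsManifold (𝓡 (2 * m + 1)) ∞ L]

/-- The complex structure descends to a smooth one near each point of the leaf space. -/
lemma NearlyRobinson.exists_descent (hR : R.NearlyRobinson) (hL : R.IsLeafSpace U p)
    (hx : x ∈ U) :
    ∃ (O : Set L) (V : Set M), IsOpen O ∧ p x ∈ O ∧ IsOpen V ∧ x ∈ V ∧ V ⊆ U ∧
    O ⊆ (extChartAt (𝓡 (2 * m + 1)) (p x)).source ∧ Set.MapsTo p V O ∧
    (∀ y ∈ O, ∃ z ∈ V, p z = y) ∧
    ∃ (T : L → EuclideanSpace ℝ (Fin (2 * m + 1)) →L[ℝ] EuclideanSpace ℝ (Fin (2 * m + 1)))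
      (X : Fin m ⊕ Fin m → VField (2 * m + 1) L),
      ContMDiffOn (𝓡 (2 * m + 1)) 𝓘(ℝ, EuclideanSpace ℝ (Fin (2 * m + 1)) →L[ℝ]
        EuclideanSpace ℝ (Fin (2 * m + 1))) ∞ T O ∧
      (∀ i, SmoothOn O (X i)) ∧
      (∀ y ∈ O, LinearIndependent ℝ (fun i => X i y)) ∧
      (∀ y ∈ O, ∀ w : TangentSpace (𝓡 (2 * m + 1)) y,
        T y (T y (triv (p x) y w)) = -triv (p x) y w ↔
          w ∈ Submodule.span ℝ (Set.range fun i => X i y)) ∧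
      ∀ z ∈ V, ∀ u v : TangentSpace (𝓡 (2 * m + 1)) (p z), R.leafRel p z u v ↔
        triv (p x) (p z) v = T (p z) (triv (p x) (p z) u) ∧
          T (p z) (T (p z) (triv (p x) (p z) u)) = -triv (p x) (p z) u := by
  obtain ⟨V₀, hV₀x, hV₀, hxV₀, T, X, hT, hX, hXi, hTX, hTN, hTK⟩ := hR.exists_clm hL hx
  have hq := (hL.contMDiffOn_leafMap x).mono hV₀x
  obtain ⟨O₁, V, σ, hO₁, hV, hxV, hVV₀, hqV, hσV, hqσ, hσ, hconst⟩ :=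
    exists_localSection hV₀ hxV₀ hq (hL.mvfderiv_leafMap_surjective (hV₀x hxV₀))
  set χ := extChartAt (𝓡 (2 * m + 1)) (p x) with hχ
  have hχO : IsOpen (χ.source ∩ χ ⁻¹' O₁) :=
    (continuousOn_extChartAt (p x)).isOpen_inter_preimage (isOpen_extChartAt_source _) hO₁
  have hχs : ContMDiffOn (𝓡 (2 * m + 1)) 𝓘(ℝ, EuclideanSpace ℝ (Fin (2 * m + 1))) ∞ χ
      (χ.source ∩ χ ⁻¹' O₁) := by
    refine ContMDiffOn.mono ?_ Set.inter_subset_left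
    rw [hχ, extChartAt_source]
    exact contMDiffOn_extChartAt
  have hs : ContMDiffOn (𝓡 (2 * m + 1)) (𝓡 (2 * m + 2)) ∞ (fun y => σ (χ y))
      (χ.source ∩ χ ⁻¹' O₁) := hσ.comp hχs fun y hy => hy.2
  -- So σ ∘ χ is a smooth local section of p itself, and the descended data are obtained by pulling
  -- back along it.
  have hps : ∀ y ∈ χ.source ∩ χ ⁻¹' O₁, p (σ (χ y)) = y := by
    intro y hy
    exact χ.injOn (hV₀x (hVV₀ (hσV hy.2))).2 hy.1 (hqσ _ hy.2)
  -- T is constant along K, hence along the fibres inside V; so the value of T at the section equals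
  -- its value at every point of V over the same leaf.
  have hTc := hconst T (fun y hy => (hT.contMDiffAt (hV₀.mem_nhds (hVV₀ hy))).mdifferentiableAt
    (by simp)) fun y hy v hv => hTK y (hVV₀ hy) v
      ((hL.mvfderiv_leafMap_eq_zero_iff (hV₀x (hVV₀ hy)) v).1 hv)
  have hw := fun i => exists_vField_triv (n := 2 * m + 1) (p x) fun y =>
    mvfderiv (𝓡 (2 * m + 2)) (leafMap (m := m) p x) (σ (χ y)) (X i (σ (χ y)))
  choose Z hZ using hw
  refine ⟨χ.source ∩ χ ⁻¹' O₁, V, hχO, ⟨mem_extChartAt_source (p x), hqV hxV⟩, hV, hxV,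
    fun y hy => (hV₀x (hVV₀ hy)).1, Set.inter_subset_left,
    fun y hy => ⟨(hV₀x (hVV₀ hy)).2, hqV hy⟩, fun y hy => ⟨_, hσV hy.2, hps y hy⟩,
    fun y => T (σ (χ y)), Z, ?_, ?_, ?_, ?_, ?_⟩
  · exact hT.comp hs fun y hy => hVV₀ (hσV hy.2)
  · intro i
    refine (contMDiffOn_triv (x := p x) hχO Set.inter_subset_left).1 ?_
    refine ContMDiffOn.congr ?_ fun y hy => hZ i y hy.1
    exact (contMDiffOn_mvfderiv_apply hV₀ hq (hX i)).comp hs fun y hy => hVV₀ (hσV hy.2)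
  · intro y hy
    obtain ⟨φ, hφ⟩ := exists_triv_linearEquiv (n := 2 * m + 1) hy.1
    have h1 := hXi _ (hVV₀ (hσV hy.2))
    refine LinearIndependent.of_comp φ.toLinearMap ?_
    convert h1 using 1
    funext i
    exact (hφ _).symm.trans (hZ i y hy.1)
  · intro y hy w
    obtain ⟨φ, hφ⟩ := exists_triv_linearEquiv (n := 2 * m + 1) hy.1
    rw [hTX _ (hVV₀ (hσV hy.2)), Submodule.mem_span_range_iff_exists_fun,
      Submodule.mem_span_range_iff_exists_fun]
    refine exists_congr fun r => ?_
    simp only [← hZ _ y hy.1, hφ]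
    rw [← φ.injective.eq_iff, map_sum]
    simp only [map_smul]
  · intro z hz u v
    have hzx := hV₀x (hVV₀ hz)
    obtain ⟨a, ha⟩ := hL.submersion z hzx.1 u
    obtain ⟨b, hb⟩ := hL.submersion z hzx.1 v
    have h1 : R.leafRel p z u v ↔ cvec a b ∈ R.N z := by
      rw [← hL.map_mem_iff hzx.1]
      constructor
      · rintro ⟨c, d, hcd, rfl, rfl⟩
        exact ⟨_, hcd, by rw [ha, hb, baseChange_cvec]; rfl⟩
      · rintro h
        exact ⟨a, b, (hL.map_mem_iff hzx.1).1 h, ha, hb⟩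
    have h2 : T (σ (χ (p z))) = T z := hTc z hz
    rw [h1, hTN z (hVV₀ hz), hL.mvfderiv_leafMap hzx, hL.mvfderiv_leafMap hzx, ha, hb]
    beta_reduce
    rw [h2]

/-- By descent the image of N is locally constant along a fibre, and the fibre is connected. This is
the step where connectedness is needed. -/
lemma NearlyRobinson.leafRel_congr (hR : R.NearlyRobinson) (hL : R.IsLeafSpace U p)
    (hx : x ∈ U) (hy : y ∈ U) (h : p x = p y) : R.leafRel p x = R.leafRel p y := by
  refine (hL.connected (p x)).induction₂ (fun a b => R.leafRel p a = R.leafRel p b) ?_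
    (fun _ _ _ _ _ _ h1 h2 => h1.trans h2) (fun _ _ _ _ h1 => h1.symm) ⟨hx, rfl⟩ ⟨hy, h.symm⟩
  rintro z ⟨hz, hzx⟩
  obtain ⟨O, V, -, -, hV, hzV, -, -, -, -, T, -, -, -, -, -, h1⟩ := hR.exists_descent hL hz
  rw [eventually_nhdsWithin_iff]
  filter_upwards [hV.mem_nhds hzV] with w hw hwx
  have e : p w = p z := hwx.2.trans hzx.symm
  funext u v
  have h2 := h1 z hzV u v
  have h3 := h1 w hw u v
  rw [e] at h3
  exact propext (h2.trans h3.symm)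

end AlmostRobinson

end Robinson

/-! ### The induced almost CR structure. -/

namespace Robinson

namespace AlmostRobinson

variable {m : ℕ} {M : Type*} [TopologicalSpace M]
  [ChartedSpace (EuclideanSpace ℝ (Fin (2 * m + 2))) M] [IsManifold (𝓡 (2 * m + 2)) ∞ M]
  {g : LorentzMetric (2 * m + 2) M} {R : AlmostRobinson g} {U : Set M}
  {L : Type*} [TopologicalSpace L] [ChartedSpace (EuclideanSpace ℝ (Fin (2 * m + 1))) L]
  [IsManifold (𝓡 (2 * m + 1)) ∞ L] {p : M → L}

/-- A is canonical only where A² = -1; elsewhere it depends on an auxiliary complement. One A serves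
the whole fibre, because the relation is the same at all its points. -/
lemma NearlyRobinson.exists_end (hR : R.NearlyRobinson) (hL : R.IsLeafSpace U p) (y : L) :
    ∃ A : TangentSpace (𝓡 (2 * m + 1)) y →ₗ[ℝ] TangentSpace (𝓡 (2 * m + 1)) y,
      ∀ z ∈ U, p z = y → ∀ u v : TangentSpace (𝓡 (2 * m + 1)) y,
        R.leafRel p z u v ↔ v = A u ∧ A (A u) = -u := by
  obtain ⟨x, hx, rfl⟩ : y ∈ p '' U := hL.surj ▸ Set.mem_univ y
  obtain ⟨O, V, -, -, -, hxV, -, -, -, -, T, -, -, -, -, -, h⟩ := hR.exists_descent hL hx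
  obtain ⟨φ, hφ⟩ := exists_triv_linearEquiv (n := 2 * m + 1) (mem_extChartAt_source (p x))
  refine ⟨φ.symm.toLinearMap ∘ₗ (T (p x)).toLinearMap ∘ₗ φ.toLinearMap, fun z hz hzx u v => ?_⟩
  rw [hR.leafRel_congr hL hz hx hzx, h x hxV, hφ, hφ]
  simp only [LinearMap.comp_apply, LinearEquiv.coe_coe, ContinuousLinearMap.coe_coe,
    φ.apply_symm_apply]
  rw [φ.eq_symm_apply, φ.symm_apply_eq, map_neg]

/-- A nearly Robinson structure induces an almost CR structure on each leaf space. -/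
theorem NearlyRobinson.exists_induces (hR : R.NearlyRobinson) (hL : R.IsLeafSpace U p) :
    ∃ C : AlmostCR m L, R.Induces U p C := by
  choose A hA using hR.exists_end hL
  have hsurj : ∀ y, ∃ x ∈ U, p x = y := fun y => by
    have : y ∈ p '' U := hL.surj ▸ Set.mem_univ y
    exact this
  -- Defining H as the kernel of A² + 1 removes the dependence on the complement; J is then the
  -- restriction of A.
  let H : ∀ y : L, Submodule ℝ (TangentSpace (𝓡 (2 * m + 1)) y) := fun y =>
    LinearMap.ker (A y ∘ₗ A y + LinearMap.id)
  have hH : ∀ (y : L) (u : TangentSpace (𝓡 (2 * m + 1)) y), u ∈ H y ↔ A y (A y u) = -u := by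
    intro y u
    rw [LinearMap.mem_ker, LinearMap.add_apply, LinearMap.comp_apply, LinearMap.id_apply,
      eq_neg_iff_add_eq_zero]
  have hAH : ∀ (y : L), ∀ u ∈ H y, A y u ∈ H y := by
    intro y u hu
    rw [hH, (hH y u).1 hu, map_neg]
  have hrel : ∀ z ∈ U, ∀ u : TangentSpace (𝓡 (2 * m + 1)) (p z),
      u ∈ H (p z) ↔ R.leafRel p z u (A (p z) u) := by
    intro z hz u
    rw [hA (p z) z hz rfl, hH]
    simp
  let C : AlmostCR m L :=
    { H := H
      J := fun y => (A y).restrict (hAH y)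
      H_frame := by
        intro y₀
        obtain ⟨x, hx, rfl⟩ := hsurj y₀
        obtain ⟨O, V, hO, hxO, -, -, hVU, hOs, -, hOV, T, X, -, hX, hXi, hTX, h⟩ :=
          hR.exists_descent hL hx
        have e : Fin (2 * m) ≃ Fin m ⊕ Fin m :=
          (finCongr (two_mul m)).trans finSumFinEquiv.symm
        refine ⟨O, hO, hxO, fun i => X (e i), fun i => hX _, fun y hy =>
          ⟨(hXi y hy).comp e e.injective, ?_⟩⟩
        have e1 : (Set.range fun i => X (e i) y) = Set.range fun i => X i y :=
          e.surjective.range_comp fun i => X i y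
        rw [e1]
        ext u
        obtain ⟨z, hz, rfl⟩ := hOV y hy
        rw [← hTX (p z) hy, hrel z (hVU hz), h z hz]
        constructor
        · intro h1
          have h2 : ∃ v : TangentSpace (𝓡 (2 * m + 1)) (p z), R.leafRel p z u v := by
            obtain ⟨φ, hφ⟩ := exists_triv_linearEquiv (n := 2 * m + 1) (hOs hy)
            refine ⟨φ.symm (T (p z) (triv (p x) (p z) u)), (h z hz _ _).2 ⟨?_, h1⟩⟩
            rw [hφ, φ.apply_symm_apply]
          obtain ⟨v, hv⟩ := h2
          have h3 := ((hA (p z) z (hVU hz) rfl u v).1 hv).1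
          rw [← h3]
          exact (h z hz _ _).1 hv
        · exact fun h1 => h1.2
      J_sq := by
        rintro y ⟨v, hv⟩
        ext1
        exact (hH y v).1 hv
      J_smooth := by
        intro W X Y hW hX hXY
        refine smoothOn_of_smoothAt fun y₀ hy₀ => ?_
        obtain ⟨x, hx, rfl⟩ := hsurj y₀
        obtain ⟨O, V, hO, hxO, -, -, hVU, -, -, hOV, T, -, hT, -, -, -, h⟩ :=
          hR.exists_descent hL hx
        rw [smoothAt_iff]
        -- The chosen A need not vary smoothly with y, but on H it agrees with the smooth local
        -- field T obtained from descent.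
        have h1 := (hT.contMDiffAt (hO.mem_nhds hxO)).clm_apply
          (smoothAt_iff.1 (hX.smoothAt hW hy₀))
        refine h1.congr_of_eventuallyEq ?_
        filter_upwards [hO.mem_nhds hxO, hW.mem_nhds hy₀] with y hy hyW
        obtain ⟨z, hz, rfl⟩ := hOV y hy
        obtain ⟨hm, hJ⟩ := hXY _ hyW
        have h2 := (h z hz _ _).1 ((hrel z (hVU hz) _).1 hm)
        rw [← hJ]
        exact h2.1 }
  have hC : ∀ z ∈ U, ∀ u v : TangentSpace (𝓡 (2 * m + 1)) (p z),
      cvec u v ∈ C.zeroOne (p z) ↔ R.leafRel p z u v := by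
    intro z hz u v
    rw [hA (p z) z hz rfl, ← hH]
    constructor
    · rintro ⟨w, hw⟩
      rw [cvec_inj] at hw
      obtain ⟨rfl, rfl⟩ := hw
      exact ⟨rfl, w.2⟩
    · rintro ⟨rfl, hu⟩
      exact ⟨⟨u, hu⟩, rfl⟩
  refine ⟨C, ?_, ?_⟩
  · intro z hz
    ext u
    refine Iff.trans ?_ (hrel z hz u).symm
    constructor
    · rintro ⟨a, ha, rfl⟩
      obtain ⟨b, hb⟩ := (R.isRobinson z).exists_im ha
      have h1 : R.leafRel p z (mfderiv (𝓡 (2 * m + 2)) (𝓡 (2 * m + 1)) p z a)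
        (mfderiv (𝓡 (2 * m + 2)) (𝓡 (2 * m + 1)) p z b) := ⟨a, b, hb, rfl, rfl⟩
      have h2 := ((hA (p z) z hz rfl _ _).1 h1).1
      rw [← h2]
      exact h1
    · rintro ⟨a, b, hab, ha, -⟩
      exact ⟨a, fun w hw => (R.isRobinson z).orthogonal_left hw hab, ha⟩
  · intro z hz
    ext w
    obtain ⟨u, v, rfl⟩ := exists_cvec w
    rw [hC z hz]
    constructor
    · rintro ⟨c, hc, h⟩
      obtain ⟨a, b, rfl⟩ := exists_cvec c
      rw [baseChange_cvec, cvec_inj] at h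
      exact ⟨a, b, hc, h.1, h.2⟩
    · rintro ⟨a, b, hab, rfl, rfl⟩
      exact ⟨_, hab, baseChange_cvec _ _ _⟩

end AlmostRobinson

end Robinson

end

theorem mainTheorem7 (m : ℕ) {M : Type*} [TopologicalSpace M] [T2Space M]
    [SecondCountableTopology M]
    [ChartedSpace (EuclideanSpace ℝ (Fin (2 * m + 2))) M] [IsManifold (𝓡 (2 * m + 2)) ∞ M]
    (g : Robinson.LorentzMetric (2 * m + 2) M) (R : Robinson.AlmostRobinson g) :
    [R.NearlyRobinson, R.FormsPreserved, R.TorsionCondition, R.ComponentCondition].TFAE ∧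
    (∀ (ι : Type*) (L : ι → Type*) [∀ i, TopologicalSpace (L i)]
      [∀ i, T2Space (L i)] [∀ i, SecondCountableTopology (L i)]
      [∀ i, ChartedSpace (EuclideanSpace ℝ (Fin (2 * m + 1))) (L i)]
      [∀ i, IsManifold (𝓡 (2 * m + 1)) ∞ (L i)]
      (U : ι → Set M) (p : ∀ i, M → L i),
      (∀ i, R.IsLeafSpace (U i) (p i)) → (⋃ i, U i) = Set.univ →
      (R.NearlyRobinson ↔ ∀ i, ∃ C : Robinson.AlmostCR m (L i), R.Induces (U i) (p i) C)) ∧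
    (R.NearlyRobinson → R.Geodesic ∧ R.ShearCommutes) := by
  refine ⟨?_, ?_, fun h => ⟨h.geodesic, h.shearCommutes⟩⟩
  · tfae_have 1 ↔ 2 := ⟨fun h => h.formsPreserved, fun h => h.nearlyRobinson⟩
    tfae_have 1 ↔ 3 := Robinson.AlmostRobinson.nearlyRobinson_iff.trans
      Robinson.AlmostRobinson.torsionCondition_iff.symm
    tfae_have 1 ↔ 4 := Robinson.AlmostRobinson.nearlyRobinson_iff.trans
      Robinson.AlmostRobinson.componentCondition_iff.symm
    tfae_finish
  · intro ι L _ _ _ _ _ U p hL hU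
    exact ⟨fun h i => h.exists_induces (hL i),
      Robinson.AlmostRobinson.nearlyRobinson_of_induces hL hU⟩
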